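/- Let $n\ge 1$ and let $(M,g)$ be an $(n+1)$-dimensional spacetime: a Hausdorff paracompact $C^4$ manifold (for instance $C^k$ with $4\le k\le\infty$, or analytic) with a $C^3$ Lorentzian metric of signature $(-,+,\dots,+)$ and a time orientation. A $C^0$ future null hypersurface (past horizon) is a subset $H\subset M$ which is a topological embedded hypersurface (locally homeomorphic to $\mathbb{R}^n$ in the induced topology), is locally achronal (each point has an open neighborhood $U$ such that no timelike curve contained in $U$ joins two points of $H\cap U$), and is such that for every $p\in H$ and every open neighborhood $U\ni p$ in which $H$ is achronal there is $q\in J^+(p,U)\cap H$ with $q\neq p$. A function $f$ on an open set $\Omega\subset\mathbb{R}^n$ belongs to $BSC_{loc}$ (semi-convex with locally bounded semi-convexity constant) if each point of $\Omega$ has a bounded open convex neighborhood $O\subset \Omega$ on which $f$ is Lipschitz and, for some constant $\rho>0$, $f(x)=\max_{s\in S}\{-\frac12\rho|x|^2+b(s)\cdot x+c(s)\}$ with $S$ compact and $b\colon S\to\mathbb{R}^n$, $c\colon S\to\mathbb{R}$ continuous. It is lower-$C^2$ if near each point of $\Omega$ it can be written as $f(x)=\max_{s\in S}F(x,s)$ with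 $S$ a compact topological space and $F$ twice differentiable in $x$ and continuous, together with its $x$-derivatives up to order two, jointly in $(x,s)$. Proposition. Let $H$ be a $C^0$ future null hypersurface and let $p\in H$. There are local coordinates $(x^0,{\bf x})=(x^0,x^1,\dots,x^n)$ around $p$ for which $\partial_0$ is future-directed timelike at $p$; and in every such $C^3$ coordinate system (in particular in the coordinates obtained by flowing a hypersurface along a smooth timelike future-directed vector field $V=\partial_0$ to which it is transverse), with $p=(t_0,{\bf x}_0)$, there are $r,\epsilon>0$ and a function $h\colon B({\bf x}_0,r)\to(t_0-\epsilon,t_0+\epsilon)$ such that the cylinder $(t_0-\epsilon,t_0+\epsilon)\times B({\bf x}_0,r)$ lies in the coordinate domain, $H$ is in this cylinder exactly the graph $x^0=h({\bf x})$, and $h\in BSC_{loc}$; hence $h$ is lower-$C^2$. Moreover the parametrization $\psi\colon{\bf x}\mapsto(h({\bf x}),{\bf x})$ of $H$ is a topological embedding of $B({\bf x}_0,r)$ in $M$, and all its components in these coordinates are $BSC_{loc}$ and lower-$C^2$. The time-dual statement holds for $C^0$ past null hypersurfaces (the definition being the same with $p\in J^+(q,U)$ in place of $q\in J^+(p,U)$),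 with coordinates for which $\partial_0$ is past-directed timelike at $p$. -/

import Mathlib

open Set Topology Bundle
open scoped Manifold ContDiff NNReal

/-! ### Semi-convex and lower-`C^k` functions on open subsets of `ℝ^d` -/

/-- `f` is lower-`C^k` on `Ω`: near every point of `Ω` it is a maximum `max_{s ∈ S} F (x, s)` over a
compact space `S`, where `F` and all its `x`-derivatives up to order `k` exist and are jointly
continuous in `(x, s)`. -/
def IsLowerC {d : ℕ} (k : ℕ∞) (f : EuclideanSpace ℝ (Fin d) → ℝ)
    (Ω : Set (EuclideanSpace ℝ (Fin d))) : Prop :=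
  ∀ x₀ ∈ Ω, ∃ O : Set (EuclideanSpace ℝ (Fin d)), IsOpen O ∧ x₀ ∈ O ∧ O ⊆ Ω ∧
    ∃ (S : Type) (_ : TopologicalSpace S) (_ : CompactSpace S)
      (F : EuclideanSpace ℝ (Fin d) → S → ℝ),
      (∀ s, ContDiffOn ℝ k (fun x => F x s) O) ∧
      (∀ m : ℕ, (m : ℕ∞) ≤ k → ContinuousOn
        (fun z : EuclideanSpace ℝ (Fin d) × S => iteratedFDeriv ℝ m (fun x => F x z.2) z.1)
        (O ×ˢ (univ : Set S))) ∧
      ∀ x ∈ O, IsGreatest (range (F x)) (f x)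

/-- `f` is `ρ`-semi-convex on `O`: `f x = max_{s ∈ S} (-(ρ/2) |x|² + b s · x + c s)` for continuous
`b`, `c` on a compact space `S`. -/
def IsSemiconvexWith {d : ℕ} (ρ : ℝ) (f : EuclideanSpace ℝ (Fin d) → ℝ)
    (O : Set (EuclideanSpace ℝ (Fin d))) : Prop :=
  ∃ (S : Type) (_ : TopologicalSpace S) (_ : CompactSpace S)
    (b : S → EuclideanSpace ℝ (Fin d)) (c : S → ℝ),
    Continuous b ∧ Continuous c ∧
    ∀ x ∈ O, IsGreatest (range fun s => -(1 / 2) * ρ * ‖x‖ ^ 2 + inner ℝ (b s) x + c s) (f x)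

/-- The class `BSC_loc` of semi-convex functions with locally bounded semi-convexity constant:
every point has a bounded open convex neighborhood on which `f` is Lipschitz and `ρ`-semi-convex
for one constant `ρ > 0`. -/
def IsBSCLoc {d : ℕ} (f : EuclideanSpace ℝ (Fin d) → ℝ)
    (Ω : Set (EuclideanSpace ℝ (Fin d))) : Prop :=
  ∀ x₀ ∈ Ω, ∃ O : Set (EuclideanSpace ℝ (Fin d)),
    IsOpen O ∧ Convex ℝ O ∧ Bornology.IsBounded O ∧ x₀ ∈ O ∧ O ⊆ Ω ∧
    (∃ K : ℝ≥0, LipschitzOnWith K f O) ∧ ∃ ρ : ℝ, 0 < ρ ∧ IsSemiconvexWith ρ f O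

/-! ### Spacetimes -/

/-- A `C^4` manifold is a `C^1` manifold (so that its tangent bundle is available). -/
instance isManifold_one_of_four {n : ℕ} {M : Type*} [TopologicalSpace M]
    [ChartedSpace (EuclideanSpace ℝ (Fin (n + 1))) M]
    [IsManifold 𝓘(ℝ, EuclideanSpace ℝ (Fin (n + 1))) 4 M] :
    IsManifold 𝓘(ℝ, EuclideanSpace ℝ (Fin (n + 1))) 1 M :=
  IsManifold.of_le (n := 4) (by norm_cast)

/-- A `C^3` Lorentzian metric of signature `(-,+,…,+)` and a time orientation on an
`(n+1)`-dimensional `C^4` manifold. -/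
structure Spacetime (n : ℕ) (M : Type*) [TopologicalSpace M]
    [ChartedSpace (EuclideanSpace ℝ (Fin (n + 1))) M]
    [IsManifold 𝓘(ℝ, EuclideanSpace ℝ (Fin (n + 1))) 4 M] where
  /-- the metric tensor -/
  metric (x : M) : TangentSpace 𝓘(ℝ, EuclideanSpace ℝ (Fin (n + 1))) x →L[ℝ]
    TangentSpace 𝓘(ℝ, EuclideanSpace ℝ (Fin (n + 1))) x →L[ℝ] ℝ
  symm (x : M) (v w : TangentSpace 𝓘(ℝ, EuclideanSpace ℝ (Fin (n + 1))) x) :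
    metric x v w = metric x w v
  /-- signature `(-,+,…,+)`: there is a negative vector with positive orthogonal complement -/
  lorentzian (x : M) : ∃ v : TangentSpace 𝓘(ℝ, EuclideanSpace ℝ (Fin (n + 1))) x,
    metric x v v < 0 ∧ ∀ w : TangentSpace 𝓘(ℝ, EuclideanSpace ℝ (Fin (n + 1))) x,
      metric x v w = 0 → w ≠ 0 → 0 < metric x w w
  contMDiff_metric : ContMDiff 𝓘(ℝ, EuclideanSpace ℝ (Fin (n + 1)))
    (𝓘(ℝ, EuclideanSpace ℝ (Fin (n + 1))).prod
      𝓘(ℝ, EuclideanSpace ℝ (Fin (n + 1)) →L[ℝ] EuclideanSpace ℝ (Fin (n + 1)) →L[ℝ] ℝ)) 3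
    (fun x => TotalSpace.mk'
      (EuclideanSpace ℝ (Fin (n + 1)) →L[ℝ] EuclideanSpace ℝ (Fin (n + 1)) →L[ℝ] ℝ)
      (E := fun x : M => TangentSpace 𝓘(ℝ, EuclideanSpace ℝ (Fin (n + 1))) x →L[ℝ]
        TangentSpace 𝓘(ℝ, EuclideanSpace ℝ (Fin (n + 1))) x →L[ℝ] ℝ)
      x (metric x))
  /-- a global timelike vector field, which by definition is future-directed -/
  timeField (x : M) : TangentSpace 𝓘(ℝ, EuclideanSpace ℝ (Fin (n + 1))) x
  continuous_timeField : Continuous fun x =>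
    (⟨x, timeField x⟩ : TangentBundle 𝓘(ℝ, EuclideanSpace ℝ (Fin (n + 1))) M)
  timelike_timeField (x : M) : metric x (timeField x) (timeField x) < 0

namespace Spacetime

variable {n : ℕ} {M : Type*} [TopologicalSpace M]
  [ChartedSpace (EuclideanSpace ℝ (Fin (n + 1))) M]
  [IsManifold 𝓘(ℝ, EuclideanSpace ℝ (Fin (n + 1))) 4 M]

/-- `v` is a future-directed timelike vector at `x`. -/
def IsFutureTimelike (g : Spacetime n M) (x : M)
    (v : TangentSpace 𝓘(ℝ, EuclideanSpace ℝ (Fin (n + 1))) x) : Prop :=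
  g.metric x v v < 0 ∧ g.metric x v (g.timeField x) < 0

/-- `v` is a future-directed causal (timelike or lightlike, nonzero) vector at `x`. -/
def IsFutureCausal (g : Spacetime n M) (x : M)
    (v : TangentSpace 𝓘(ℝ, EuclideanSpace ℝ (Fin (n + 1))) x) : Prop :=
  v ≠ 0 ∧ g.metric x v v ≤ 0 ∧ g.metric x v (g.timeField x) < 0

/-- There is a `C^1` future-directed timelike curve in `U` from `p` to `q`. -/
def TimelikeStep (g : Spacetime n M) (U : Set M) (p q : M) : Prop :=
  ∃ γ : ℝ → M, ContMDiffOn 𝓘(ℝ, ℝ) 𝓘(ℝ, EuclideanSpace ℝ (Fin (n + 1))) 1 γ (Icc 0 1) ∧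
    γ 0 = p ∧ γ 1 = q ∧ ∀ t ∈ Icc (0 : ℝ) 1, γ t ∈ U ∧
      g.IsFutureTimelike (γ t) (mfderivWithin 𝓘(ℝ, ℝ) 𝓘(ℝ, EuclideanSpace ℝ (Fin (n + 1))) γ
        (Icc 0 1) t (1 : ℝ))

/-- There is a `C^1` future-directed causal curve in `U` from `p` to `q`. -/
def CausalStep (g : Spacetime n M) (U : Set M) (p q : M) : Prop :=
  ∃ γ : ℝ → M, ContMDiffOn 𝓘(ℝ, ℝ) 𝓘(ℝ, EuclideanSpace ℝ (Fin (n + 1))) 1 γ (Icc 0 1) ∧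
    γ 0 = p ∧ γ 1 = q ∧ ∀ t ∈ Icc (0 : ℝ) 1, γ t ∈ U ∧
      g.IsFutureCausal (γ t) (mfderivWithin 𝓘(ℝ, ℝ) 𝓘(ℝ, EuclideanSpace ℝ (Fin (n + 1))) γ
        (Icc 0 1) t (1 : ℝ))

/-- `I⁺(p, U)`: the points reached from `p` by piecewise `C^1` future-directed timelike curves
in `U`. -/
def chronologicalFuture (g : Spacetime n M) (p : M) (U : Set M) : Set M :=
  {q | Relation.TransGen (g.TimelikeStep U) p q}

/-- `J⁺(p, U)`: the point `p` and the points reached from `p` by piecewise `C^1` future-directed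
causal curves in `U`. -/
def causalFuture (g : Spacetime n M) (p : M) (U : Set M) : Set M :=
  {q | Relation.ReflTransGen (g.CausalStep U) p q}

/-- `H` is achronal in `U`: no timelike curve in `U` joins two (possibly equal) points of
`H ∩ U`. -/
def IsAchronalIn (g : Spacetime n M) (H U : Set M) : Prop :=
  ∀ p ∈ H ∩ U, ∀ q ∈ H ∩ U, q ∉ g.chronologicalFuture p U

/-- `H` is a locally achronal topological embedded hypersurface: in the induced topology it is
locally homeomorphic to `ℝ^n`, and every point has an open neighborhood in which `H` is
achronal. -/
def IsLocallyAchronalHypersurface (g : Spacetime n M) (H : Set M) : Prop :=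
  (∀ p ∈ H, ∃ W : Set M, IsOpen W ∧ p ∈ W ∧
    Nonempty (↥(H ∩ W) ≃ₜ EuclideanSpace ℝ (Fin n))) ∧
  ∀ p ∈ H, ∃ U : Set M, IsOpen U ∧ p ∈ U ∧ g.IsAchronalIn H U

/-- `H` is a `C^0` future null hypersurface (past horizon). -/
def IsFutureNullHypersurface (g : Spacetime n M) (H : Set M) : Prop :=
  g.IsLocallyAchronalHypersurface H ∧
  ∀ p ∈ H, ∀ U : Set M, IsOpen U → p ∈ U → g.IsAchronalIn H U →
    ∃ q ∈ g.causalFuture p U ∩ H, q ≠ p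

/-- `H` is a `C^0` past null hypersurface (future horizon): the time-dual notion. -/
def IsPastNullHypersurface (g : Spacetime n M) (H : Set M) : Prop :=
  g.IsLocallyAchronalHypersurface H ∧
  ∀ p ∈ H, ∀ U : Set M, IsOpen U → p ∈ U → g.IsAchronalIn H U →
    ∃ q ∈ H, p ∈ g.causalFuture q U ∧ q ≠ p

/-- `e` is a local `C^3` coordinate system `(x⁰, x¹, …, xⁿ)` around `p` whose coordinate vector
`∂₀` is future-directed timelike at `p`. -/
def IsFutureChartAt (g : Spacetime n M)
    (e : OpenPartialHomeomorph M (EuclideanSpace ℝ (Fin (n + 1)))) (p : M) : Prop :=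
  e ∈ IsManifold.maximalAtlas 𝓘(ℝ, EuclideanSpace ℝ (Fin (n + 1))) 3 M ∧ p ∈ e.source ∧
  ∃ v : TangentSpace 𝓘(ℝ, EuclideanSpace ℝ (Fin (n + 1))) p,
    mfderiv 𝓘(ℝ, EuclideanSpace ℝ (Fin (n + 1))) 𝓘(ℝ, EuclideanSpace ℝ (Fin (n + 1))) e p v =
      EuclideanSpace.single (0 : Fin (n + 1)) (1 : ℝ) ∧ g.IsFutureTimelike p v

/-- As `IsFutureChartAt`, with `∂₀` past-directed timelike at `p`. -/
def IsPastChartAt (g : Spacetime n M)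
    (e : OpenPartialHomeomorph M (EuclideanSpace ℝ (Fin (n + 1)))) (p : M) : Prop :=
  e ∈ IsManifold.maximalAtlas 𝓘(ℝ, EuclideanSpace ℝ (Fin (n + 1))) 3 M ∧ p ∈ e.source ∧
  ∃ v : TangentSpace 𝓘(ℝ, EuclideanSpace ℝ (Fin (n + 1))) p,
    mfderiv 𝓘(ℝ, EuclideanSpace ℝ (Fin (n + 1))) 𝓘(ℝ, EuclideanSpace ℝ (Fin (n + 1))) e p v =
      EuclideanSpace.single (0 : Fin (n + 1)) (1 : ℝ) ∧ g.IsFutureTimelike p (-v)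

end Spacetime

/-! ### Graphs in a coordinate system -/

/-- The coordinate point `(x⁰, 𝐱) = (t, x)`. -/
def timeSpace {n : ℕ} (t : ℝ) (x : EuclideanSpace ℝ (Fin n)) : EuclideanSpace ℝ (Fin (n + 1)) :=
  WithLp.toLp 2 (Fin.cons t fun i => x i)

/-- The spatial coordinates `𝐱 = (x¹, …, xⁿ)` of a coordinate point. -/
def spacePart {n : ℕ} (y : EuclideanSpace ℝ (Fin (n + 1))) : EuclideanSpace ℝ (Fin n) :=
  WithLp.toLp 2 fun i => y i.succ

/-- In the coordinates `e`, the set `H` is, near `p`, the graph `x⁰ = h 𝐱` of a function `h` in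
`BSC_loc`. Precisely: there is a coordinate cylinder `(t₀ - ε, t₀ + ε) × B(x₀, r)` centered at the
coordinates `(t₀, x₀)` of `p` in which `H` is the graph of `h : B(x₀, r) → (t₀ - ε, t₀ + ε)`, the
function `h` is `BSC_loc` and lower-`C^2`, and the parametrization `ψ : 𝐱 ↦ (h 𝐱, 𝐱)` of this piece
of `H` is a topological embedding which is `BSC_loc` and lower-`C^2` in coordinates. -/
def IsBSCGraphNear {n : ℕ} {M : Type*} [TopologicalSpace M]
    (e : OpenPartialHomeomorph M (EuclideanSpace ℝ (Fin (n + 1)))) (H : Set M) (p : M) : Prop :=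
  ∃ r > 0, ∃ ε > 0, ∃ h : EuclideanSpace ℝ (Fin n) → ℝ,
    let B := Metric.ball (spacePart (e p)) r
    let T := Metric.ball (e p 0) ε
    let ψ : EuclideanSpace ℝ (Fin n) → M := fun x => e.symm (timeSpace (h x) x)
    (∀ t ∈ T, ∀ x ∈ B, timeSpace t x ∈ e.target) ∧
    (∀ x ∈ B, h x ∈ T) ∧
    (∀ t ∈ T, ∀ x ∈ B, e.symm (timeSpace t x) ∈ H ↔ t = h x) ∧
    IsBSCLoc h B ∧ IsLowerC 2 h B ∧
    IsEmbedding (B.domRestrict ψ) ∧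
    ∀ i : Fin (n + 1), IsBSCLoc (fun x => e (ψ x) i) B ∧ IsLowerC 2 (fun x => e (ψ x) i) B

/-!
# Horizons are semi-convex graphs

The proof works with the defining property of a horizon alone, without geodesics or generators.

**Reduction to coordinates.** The components of the metric in a `C^3` chart are `C^2`, and near the
given point they form a field of Lorentzian cones (`IsConeField`, `exists_isConeField`): with a
fixed linear functional `θ` as clock, future causal vectors `u` satisfy `‖u‖ ≤ L θ u` and
`G(u, e₀) ≤ -c θ u`, and all vectors close to `e₀ = ∂₀` are timelike. Because of the last property,
local achronality makes the spatial projection injective on `H` with a Lipschitz inverse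
(`IsConeField.width_mul_abs_le`). By invariance of domain
(`image_mem_nhds_of_continuousOn_injOn`) the projection is onto a neighborhood, so `H` is locally
the graph of a Lipschitz function `h`. Mathlib has no invariance of domain; it is derived here from
the no-retraction theorem, which follows from the change of variables formula.

**Supporting paraboloids.** A function is `BSC_loc` once it has, at every point, a supporting
paraboloid of locally uniform opening and slope from below
(`isBSCLoc_of_forall_exists_support`), and then it is lower-`C^k` for every `k`. Let `p` be a
point of the graph over `x`. Suppose that there are causal chains to one point `q` of the graph
from the points `p - η e₀`, for arbitrarily small `η > 0`. Such a chain is perturbed as follows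
(`IsConeField.exists_perturbed_chain`): for each small spatial vector `w`, displace its points by
`(θ q - θ) w` spatially and by `b w` vertically, where `b` is a linear form along the chain that
solves the linear differential equation expressing that the first order change of `G(γ', γ')`
vanishes; then shift downwards by `σ e^(Λ (θ q - θ))` with `σ` comparable to `‖w‖²`. The growth of
the exponential makes the shift dominate all second order terms, so the new chain is timelike. It
ends below `q`, hence by achronality its starting point is not above the graph, and this is the
inequality `h (x + s w) ≥ h x + b w - C ‖w‖²`, with `s` the elapsed clock time. Since the curves are
merely `C^1`, no regularity beyond that of `G` is used.

**Uniformity.** The opening and slope obtained this way are bounded if `s` is bounded below. The set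
of points `q` of the graph that are reached from `p` in the above approximate sense is compact, and
it is stable under prolongation of chains. At a point of it with the largest clock value the horizon
property would allow a further prolongation, unless that point lies over the boundary of the domain
of the graph. So `q` can be chosen at a distance from `p` bounded below
(`IsConeField.exists_uniform_support`).

The time-dual statement follows by reversing the time orientation.
-/

-- the spaces of trilinear forms need a deeper instance search

set_option maxSynthPendingDepth 3

/-! ### Invariance of domain -/

section InvarianceOfDomain

open MeasureTheory Metric Function

variable {E : Type*} [NormedAddCommGroup E] [InnerProductSpace ℝ E] [FiniteDimensional ℝ E]

/-- `t ↦ det (1 + t A)` is a polynomial of degree at most `dim E`, hence its value at `1` is given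
by Lagrange interpolation at `dim E + 1` nodes. -/
lemma det_one_add_eq_sum_lagrange (A : E →L[ℝ] E) {v : ℕ → ℝ}
    (hv : InjOn v (Finset.range (Module.finrank ℝ E + 1))) :
    (1 + A).det = ∑ i ∈ Finset.range (Module.finrank ℝ E + 1),
      (Lagrange.basis (Finset.range (Module.finrank ℝ E + 1)) v i).eval 1 *
        (1 + v i • A).det := by
  set d := Module.finrank ℝ E with hd
  let b := Module.finBasis ℝ E
  let M := LinearMap.toMatrix b b (A : E →ₗ[ℝ] E)
  let P : Polynomial ℝ := Matrix.det ((Polynomial.X : Polynomial ℝ) • M.map Polynomial.C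
    + (1 : Matrix (Fin d) (Fin d) ℝ).map Polynomial.C)
  have hP : ∀ t : ℝ, P.eval t = (1 + t • A).det := by
    intro t
    have h1 : P.eval t = Matrix.det (t • M + 1) := by
      simp only [P]
      rw [← Polynomial.coe_evalRingHom, RingHom.map_det]
      congr 1
      ext i j
      rcases eq_or_ne i j with rfl | hij
      · simp [mul_comm t]
      · simp [hij, mul_comm t]
    rw [h1, ContinuousLinearMap.det, ← LinearMap.det_toMatrix b]
    congr 1
    simp [M, LinearMap.toMatrix_one, add_comm]
  have hdeg : P.degree < (Finset.range (d + 1)).card := by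
    rw [Finset.card_range]
    refine lt_of_le_of_lt Polynomial.degree_le_natDegree ?_
    have := Polynomial.natDegree_det_X_add_C_le M (1 : Matrix (Fin d) (Fin d) ℝ)
    rw [Fintype.card_fin] at this
    exact_mod_cast Nat.lt_succ_of_le this
  have := Lagrange.eq_interpolate hv hdeg
  have h1 := congrArg (Polynomial.eval (1 : ℝ)) this
  rw [hP, one_smul, Lagrange.interpolate_apply, Polynomial.eval_finsetSum] at h1
  rw [h1]
  refine Finset.sum_congr rfl fun i _ => ?_
  rw [Polynomial.eval_mul, Polynomial.eval_C, hP, mul_comm]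

lemma det_one_add_pos {A : E →L[ℝ] E} (hA : ‖A‖ < 1) : 0 < (1 + A).det := by
  have hne : ∀ t ∈ Icc (0 : ℝ) 1, (1 + t • A).det ≠ 0 := by
    intro t ht h0
    have hn : ‖-(t • A)‖ < 1 := by
      rw [norm_neg, norm_smul, Real.norm_of_nonneg ht.1]
      nlinarith [ht.2, norm_nonneg A]
    have hu : IsUnit (1 + t • A) := by
      have := isUnit_one_sub_of_norm_lt_one hn
      rwa [sub_neg_eq_add] at this
    have hu' : IsUnit ((1 + t • A : E →L[ℝ] E) : E →ₗ[ℝ] E) := by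
      obtain ⟨u, hu⟩ := hu
      rw [← hu]
      exact (u.map (ContinuousLinearMap.toLinearMapRingHom :
        (E →L[ℝ] E) →+* (E →ₗ[ℝ] E)).toMonoidHom).isUnit
    exact (LinearMap.isUnit_det _ hu').ne_zero h0
  have hc : ContinuousOn (fun t : ℝ => (1 + t • A).det) (Icc 0 1) :=
    (ContinuousLinearMap.continuous_det.comp (by fun_prop)).continuousOn
  by_contra hle
  have h1 : (1 + (1 : ℝ) • A).det ≤ 0 := by simpa using hle
  have h0 : (0 : ℝ) ≤ (1 + (0 : ℝ) • A).det := by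
    simp [ContinuousLinearMap.det]
  obtain ⟨t, ht, h⟩ := intermediate_value_Icc' zero_le_one hc ⟨h1, h0⟩
  exact hne t ht h

/-- A Lipschitz retraction onto the complement of an open ball, differentiable inside the ball and
with values on the sphere there, does not exist: otherwise `∫ det (1 + t g')`, `g = r - id`, over
the ball, is polynomial in `t` and equal to the volume of the ball for small `t`, but it vanishes
for `t = 1`. -/
lemma false_of_lipschitz_retraction {r : E → E} {R : ℝ} (hR : 0 < R) {K : ℝ≥0}
    (hlip : LipschitzWith K fun x => r x - x) (hout : ∀ x, R ≤ ‖x‖ → r x = x)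
    (hdiff : ∀ x ∈ ball (0 : E) R, DifferentiableAt ℝ r x)
    (hin : ∀ x ∈ ball (0 : E) R, ‖r x‖ = R) : False := by
  borelize E
  let μ : Measure E := volume
  set g : E → E := fun x => r x - x with hg
  set B := ball (0 : E) R with hB
  have hgd : ∀ x ∈ B, DifferentiableAt ℝ g x := fun x hx =>
    (hdiff x hx).sub differentiableAt_id
  have hgn : ∀ x, ‖fderiv ℝ g x‖ ≤ K := fun x => norm_fderiv_le_of_lipschitz ℝ hlip
  have hmeas : Measurable (fderiv ℝ g) := measurable_fderiv ℝ g
  have hBfin : μ B ≠ ⊤ := measure_ball_lt_top.ne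
  have hcdet : ∀ t : ℝ, Continuous fun A : E →L[ℝ] E => (1 + t • A).det := fun t =>
    ContinuousLinearMap.continuous_det.comp (by fun_prop)
  have hint : ∀ t : ℝ, IntegrableOn (fun x => (1 + t • fderiv ℝ g x).det) B μ := by
    intro t
    obtain ⟨C, hC⟩ := (isCompact_closedBall (0 : E →L[ℝ] E) K).exists_bound_of_continuousOn
      (hcdet t).continuousOn
    refine Measure.integrableOn_of_bounded hBfin
      ((hcdet t).measurable.comp hmeas).aestronglyMeasurable (M := C) ?_
    exact Filter.Eventually.of_forall fun x => hC _ (by simpa using hgn x)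
  have hvol : ∀ t : ℝ, 0 ≤ t → t * (K + 1) < 1 →
      ∫ x in B, (1 + t • fderiv ℝ g x).det ∂μ = μ.real B := by
    intro t ht0 ht
    have happ : ApproximatesLinearOn (fun x => x + t • g x)
        ((ContinuousLinearEquiv.refl ℝ E : E ≃L[ℝ] E) : E →L[ℝ] E) univ
        (Real.toNNReal t * K) := by
      intro x _ y _
      have : x + t • g x - (y + t • g y) -
          ((ContinuousLinearEquiv.refl ℝ E : E ≃L[ℝ] E) : E →L[ℝ] E) (x - y)
          = t • (g x - g y) := by
        simp only [ContinuousLinearEquiv.coe_refl, ContinuousLinearMap.coe_id', id_eq, smul_sub]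
        abel
      rw [this, norm_smul, Real.norm_of_nonneg ht0]
      have := hlip.norm_sub_le x y
      simp only [NNReal.coe_mul, Real.coe_toNNReal _ ht0]
      rw [mul_assoc]
      exact mul_le_mul_of_nonneg_left this ht0
    have hc : Subsingleton E ∨ Real.toNNReal t * K <
        ‖(((ContinuousLinearEquiv.refl ℝ E).symm : E ≃L[ℝ] E) : E →L[ℝ] E)‖₊⁻¹ := by
      rcases subsingleton_or_nontrivial E with h | h
      · exact Or.inl h
      · right
        have h1 : ‖(((ContinuousLinearEquiv.refl ℝ E).symm : E ≃L[ℝ] E) : E →L[ℝ] E)‖₊ = 1 := by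
          ext; simp
        rw [h1, inv_one, ← NNReal.coe_lt_coe]
        simp only [NNReal.coe_mul, Real.coe_toNNReal _ ht0, NNReal.coe_one]
        nlinarith
    have hinj : Injective fun x => x + t • g x := by
      have := happ.injOn hc
      rwa [← injOn_univ]
    have hsurj := happ.surjective hc
    have himg : (fun x => x + t • g x) '' B = B := by
      have hfix : ∀ x, x ∉ B → x + t • g x = x := by
        intro x hx
        have : r x = x := hout x (by simpa [hB] using hx)
        simp [hg, this]
      ext y
      constructor
      · rintro ⟨x, hx, rfl⟩
        by_contra hy
        have hx' : x + t • g x = x := hinj (hfix _ hy)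
        change x + t • g x ∉ B at hy
        rw [hx'] at hy
        exact hy hx
      · intro hy
        obtain ⟨x, hx⟩ := hsurj y
        refine ⟨x, ?_, hx⟩
        by_contra hxB
        simp only at hx
        rw [hfix x hxB] at hx
        exact hxB (hx ▸ hy)
    have hder : ∀ x ∈ B, HasFDerivWithinAt (fun x => x + t • g x)
        (1 + t • fderiv ℝ g x) B x := fun x hx =>
      ((hasFDerivAt_id x).add ((hgd x hx).hasFDerivAt.const_smul t)).hasFDerivWithinAt
    have hlint := lintegral_abs_det_fderiv_eq_addHaar_image μ measurableSet_ball hder hinj.injOn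
    rw [himg] at hlint
    have hpos : ∀ x, 0 < (1 + t • fderiv ℝ g x).det := by
      intro x
      apply det_one_add_pos
      rw [norm_smul, Real.norm_of_nonneg ht0]
      have := hgn x
      nlinarith [norm_nonneg (fderiv ℝ g x)]
    rw [integral_eq_lintegral_of_nonneg_ae (Filter.Eventually.of_forall fun x => (hpos x).le)
      (hint t).aestronglyMeasurable, Measure.real, ← hlint]
    congr 2
    ext x
    rw [abs_of_pos (hpos x)]
  set d := Module.finrank ℝ E
  let v : ℕ → ℝ := fun i => (i : ℝ) / ((d + 1) * (K + 1))
  have hKd : (0 : ℝ) < (d + 1) * (K + 1) := by positivity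
  have hv : InjOn v (Finset.range (d + 1)) := by
    intro i _ j _ hij
    simp only [v] at hij
    rw [div_left_inj' hKd.ne'] at hij
    exact_mod_cast hij
  have hvt : ∀ i ∈ Finset.range (d + 1), 0 ≤ v i ∧ v i * (K + 1) < 1 := by
    intro i hi
    refine ⟨by positivity, ?_⟩
    simp only [v]
    rw [div_mul_eq_mul_div, div_lt_one hKd]
    have : (i : ℝ) < d + 1 := by exact_mod_cast Finset.mem_range.1 hi
    have hK : (0 : ℝ) < K + 1 := by positivity
    nlinarith
  have hone : ∫ x in B, (1 + fderiv ℝ g x).det ∂μ = μ.real B := by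
    rw [integral_congr_ae (Filter.Eventually.of_forall fun x =>
      det_one_add_eq_sum_lagrange (fderiv ℝ g x) hv)]
    rw [integral_finsetSum _ fun i _ => (hint (v i)).const_mul _]
    simp_rw [integral_const_mul]
    rw [Finset.sum_congr rfl fun i hi => by rw [hvol (v i) (hvt i hi).1 (hvt i hi).2],
      ← Finset.sum_mul, ← Polynomial.eval_finsetSum,
      Lagrange.sum_basis hv ⟨0, by simp⟩, Polynomial.eval_one, one_mul]
  have hzero : ∀ x ∈ B, (1 + fderiv ℝ g x).det = 0 := by
    intro x hx
    have hr : HasFDerivAt r (1 + fderiv ℝ g x) x := by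
      have := (hasFDerivAt_id x).add (hgd x hx).hasFDerivAt
      refine this.congr_of_eventuallyEq (Filter.Eventually.of_forall fun y => ?_)
      simp [hg]
    by_contra hdet
    have hu : IsUnit ((1 + fderiv ℝ g x : E →L[ℝ] E) : E →ₗ[ℝ] E) := by
      rw [LinearMap.isUnit_iff_isUnit_det]
      exact isUnit_iff_ne_zero.2 hdet
    obtain ⟨w, hw⟩ := ((Module.End.isUnit_iff _).1 hu).2 (r x)
    have hn : HasFDerivAt (fun y => inner ℝ (r y) (r y)) _ x := hr.inner ℝ hr
    have hconst : (fun y => inner ℝ (r y) (r y)) =ᶠ[𝓝 x] fun _ => R * R := by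
      filter_upwards [isOpen_ball.mem_nhds hx] with y hy
      rw [real_inner_self_eq_norm_mul_norm, hin y hy]
    have h0 := (hn.congr_of_eventuallyEq hconst.symm).unique (hasFDerivAt_const (R * R) x)
    have h1 := congrArg (fun T : E →L[ℝ] ℝ => T w) h0
    have hw' : (1 + fderiv ℝ g x) w = r x := hw
    simp only [ContinuousLinearMap.comp_apply, ContinuousLinearMap.prod_apply,
      fderivInnerCLM_apply, hw', zero_apply] at h1
    rw [real_inner_self_eq_norm_mul_norm, hin x hx] at h1
    nlinarith
  rw [setIntegral_congr_fun measurableSet_ball hzero] at hone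
  simp only [integral_zero] at hone
  have : 0 < μ.real B := ENNReal.toReal_pos (measure_ball_pos μ 0 hR).ne' hBfin
  linarith

/-- A continuous map that differs from the identity only on a bounded set has a zero: otherwise a
`C^1` approximation of it, projected radially to a large sphere, is a retraction. -/
lemma exists_add_eq_zero_of_hasCompactSupport {k : E → E} (hk : Continuous k)
    (hs : HasCompactSupport k) : ∃ x, x + k x = 0 := by
  by_contra! hne
  obtain ⟨R₀, hR₀⟩ := hs.isCompact.isBounded.subset_closedBall (0 : E)
  set R := max R₀ 1 with hRdef
  have hR1 : 1 ≤ R := le_max_right _ _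
  have hsR : support k ⊆ closedBall 0 R :=
    (subset_tsupport k).trans (hR₀.trans (closedBall_subset_closedBall (le_max_left _ _)))
  obtain ⟨m, hm, hmk⟩ : ∃ m > 0, ∀ x ∈ closedBall (0 : E) R, m ≤ ‖x + k x‖ := by
    obtain ⟨x₀, -, hx₀⟩ := (isCompact_closedBall (0 : E) R).exists_isMinOn
      ⟨0, by simp; linarith⟩ (f := fun x => ‖x + k x‖) (by fun_prop)
    exact ⟨_, norm_pos_iff.2 (hne x₀), fun x hx => hx₀ hx⟩
  obtain ⟨k', hk', hkk', hsk⟩ := hk.exists_contDiff_approx (ε := fun _ => m) 1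
    continuous_const fun _ => hm
  set F : E → E := fun x => x + k' x with hF
  have hFc : ContDiff ℝ 1 F := contDiff_id.add hk'
  have hFout : ∀ x, R < ‖x‖ → F x = x := by
    intro x hx
    have : k' x = 0 := by
      by_contra h
      have := hsR (hsk h)
      simp at this
      linarith
    simp [hF, this]
  have hFne : ∀ x, F x ≠ 0 := by
    intro x h0
    rcases le_or_gt ‖x‖ R with h | h
    · have h1 := hmk x (by simpa using h)
      have h2 := hkk' x
      have h3 : x + k x = k x - k' x := by
        have : x = -k' x := eq_neg_of_add_eq_zero_left h0
        nth_rewrite 1 [this]; abel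
      rw [h3, ← dist_eq_norm, dist_comm] at h1
      linarith
    · rw [hFout x h] at h0
      rw [h0, norm_zero] at h
      linarith
  set S := R + 1 with hS
  have hRS : R < S := by linarith
  have hS0 : 0 < S := by linarith
  set q : E → E := fun x => (S / ‖F x‖) • F x with hq
  have hqc : ContDiff ℝ 1 q := by
    refine ContDiff.smul ?_ hFc
    exact contDiff_const.div (hFc.norm ℝ hFne) fun x => norm_ne_zero_iff.2 (hFne x)
  have hqn : ∀ x, ‖q x‖ = S := by
    intro x
    rw [hq]
    simp only [norm_smul, norm_div, norm_norm, Real.norm_of_nonneg hS0.le]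
    exact div_mul_cancel₀ _ (norm_ne_zero_iff.2 (hFne x))
  have hqs : ∀ x, ‖x‖ = S → q x = x := by
    intro x hx
    simp only [hq]
    rw [hFout x (by linarith), hx, div_self hS0.ne', one_smul]
  obtain ⟨K, hK⟩ := (((hqc.sub contDiff_id).locallyLipschitz).locallyLipschitzOn
    (s := closedBall (0 : E) S)).exists_lipschitzOnWith_of_compact (isCompact_closedBall _ _)
  classical
  set r : E → E := fun x => if ‖x‖ < S then q x else x with hr
  have hrin : ∀ x, ‖x‖ < S → r x = q x := fun x hx => if_pos hx
  have hrout : ∀ x, S ≤ ‖x‖ → r x = x := fun x hx => if_neg (not_lt.2 hx)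
  have key : ∀ x y, ‖x‖ < S → S ≤ ‖y‖ → ‖r x - x‖ ≤ K * ‖x - y‖ := by
    intro x y hx hy
    rw [hrin x hx]
    -- a point of the sphere between `x` and the exterior of the ball
    obtain ⟨z, hz, hxz⟩ : ∃ z : E, ‖z‖ = S ∧ ‖x - z‖ ≤ ‖x - y‖ := by
      rcases eq_or_ne x 0 with rfl | hx0
      · have hy0 : 0 < ‖y‖ := by linarith
        have : ‖(S / ‖y‖) • y‖ = S := by
          rw [norm_smul, norm_div, norm_norm, Real.norm_of_nonneg hS0.le,
            div_mul_cancel₀ _ hy0.ne']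
        exact ⟨(S / ‖y‖) • y, this, by rw [zero_sub, norm_neg, this]; simpa using hy⟩
      · have hx0' : 0 < ‖x‖ := norm_pos_iff.2 hx0
        refine ⟨(S / ‖x‖) • x, ?_, ?_⟩
        · rw [norm_smul, norm_div, norm_norm, Real.norm_of_nonneg hS0.le,
            div_mul_cancel₀ _ hx0'.ne']
        · have h1 : x - (S / ‖x‖) • x = ((‖x‖ - S) / ‖x‖) • x := by
            rw [sub_div, div_self hx0'.ne', sub_smul, one_smul]
          rw [h1, norm_smul, norm_div, norm_norm, div_mul_cancel₀ _ hx0'.ne', Real.norm_eq_abs,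
            abs_of_neg (by linarith)]
          have := norm_sub_norm_le y x
          rw [norm_sub_rev] at this
          linarith
    have h1 := hK.norm_sub_le (show x ∈ closedBall (0 : E) S by simpa using hx.le)
      (show z ∈ closedBall (0 : E) S by simpa using hz.le)
    simp only [hqs z hz, id, sub_self, sub_zero] at h1
    exact h1.trans (by gcongr)
  refine false_of_lipschitz_retraction (r := r) (K := K) hS0 ?_ hrout ?_ ?_
  · refine LipschitzWith.of_dist_le_mul fun x y => ?_
    rw [dist_eq_norm, dist_eq_norm]
    rcases lt_or_ge ‖x‖ S with hx | hx <;> rcases lt_or_ge ‖y‖ S with hy | hy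
    · have := hK.norm_sub_le (show x ∈ closedBall (0 : E) S by simpa using hx.le)
        (show y ∈ closedBall (0 : E) S by simpa using hy.le)
      simpa [hrin x hx, hrin y hy] using this
    · simpa [hrout y hy] using key x y hx hy
    · have := key y x hy hx
      rw [norm_sub_rev y x] at this
      rw [hrout x hx, sub_self, zero_sub, norm_neg]
      exact this
    · simp [hrout x hx, hrout y hy]
      positivity
  · intro x hx
    have hx' : ‖x‖ < S := by simpa using hx
    have : r =ᶠ[𝓝 x] q := by
      filter_upwards [isOpen_ball.mem_nhds hx] with y hy
      exact hrin y (by simpa using hy)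
    exact (hqc.differentiable one_ne_zero x).congr_of_eventuallyEq this
  · intro x hx
    rw [hrin x (by simpa using hx), hqn]

/-- A continuous map on the unit ball that is uniformly close to the identity has a zero. -/
lemma exists_eq_zero_of_norm_sub_le {F : E → E} (hF : ContinuousOn F (closedBall 0 1))
    (h : ∀ x ∈ closedBall (0 : E) 1, ‖F x - x‖ ≤ 1 / 2) : ∃ x ∈ closedBall (0 : E) 1, F x = 0 := by
  -- extend `F` radially to a map which is the identity away from the ball of radius `2`
  let pr : E → E := fun x => (max 1 ‖x‖)⁻¹ • x
  have hmx : ∀ x : E, 0 < max 1 ‖x‖ := fun x => lt_of_lt_of_le one_pos (le_max_left _ _)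
  have hpc : Continuous pr :=
    ((continuous_const.max continuous_norm).inv₀ fun x => (hmx x).ne').smul continuous_id
  have hp : ∀ x, pr x ∈ closedBall (0 : E) 1 := by
    intro x
    rw [mem_closedBall_zero_iff]
    simp only [pr, norm_smul, norm_inv, Real.norm_of_nonneg (hmx x).le]
    rw [inv_mul_le_one₀ (hmx x)]
    exact le_max_right _ _
  have hp1 : ∀ x, ‖x‖ ≤ 1 → pr x = x := by
    intro x hx
    simp [pr, max_eq_left hx]
  let c : E → ℝ := fun x => max 0 (min 1 (2 - ‖x‖))
  have hc1 : ∀ x, |c x| ≤ 1 := by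
    intro x
    rw [abs_of_nonneg (le_max_left _ _)]
    exact max_le zero_le_one (min_le_left _ _)
  let k : E → E := fun x => c x • (F (pr x) - pr x)
  have hk : Continuous k := by
    refine Continuous.smul (by fun_prop) (Continuous.sub ?_ hpc)
    exact hF.comp_continuous hpc hp
  have hs : HasCompactSupport k := by
    refine HasCompactSupport.intro (isCompact_closedBall (0 : E) 2) fun x hx => ?_
    have hx : 2 < ‖x‖ := by simpa using hx
    have : c x = 0 := max_eq_left ((min_le_right _ _).trans (by linarith))
    simp [k, this]
  obtain ⟨x, hx⟩ := exists_add_eq_zero_of_hasCompactSupport hk hs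
  have hkx : ‖k x‖ ≤ 1 / 2 := by
    simp only [k, norm_smul, Real.norm_eq_abs]
    have := h _ (hp x)
    nlinarith [hc1 x, abs_nonneg (c x), norm_nonneg (F (pr x) - pr x)]
  have hx1 : ‖x‖ ≤ 1 := by
    rw [eq_neg_of_add_eq_zero_left hx, norm_neg]
    linarith
  refine ⟨x, by simpa using hx1, ?_⟩
  have : c x = 1 := by
    simp only [c]
    rw [min_eq_left (by linarith), max_eq_right zero_le_one]
  simpa [k, this, hp1 x hx1] using hx

/-- Invariance of domain for a ball, by the argument of Kulpa and Tao: if `f 0` were not interior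
to the image, then the inverse of `f` could be perturbed to a map without zeros. -/
lemma image_closedBall_mem_nhds {f : E → E} (hf : ContinuousOn f (closedBall 0 1))
    (hinj : InjOn f (closedBall 0 1)) : f '' closedBall 0 1 ∈ 𝓝 (f 0) := by
  borelize E
  set B := closedBall (0 : E) 1 with hB
  have h0B : (0 : E) ∈ B := by simp [hB]
  have hBc : IsCompact B := isCompact_closedBall _ _
  have hKc : IsCompact (f '' B) := hBc.image_of_continuousOn hf
  have : CompactSpace B := isCompact_iff_compactSpace.1 hBc
  have hemb : IsClosedEmbedding (B.domRestrict f) :=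
    Continuous.isClosedEmbedding (continuousOn_iff_continuous_domRestrict.1 hf)
      (injOn_iff_injective.1 hinj)
  have : TietzeExtension E := TietzeExtension.of_tvs ℝ
  obtain ⟨G, hG⟩ := ContinuousMap.exists_extension hemb (⟨Subtype.val, continuous_subtype_val⟩ :
    C(B, E))
  have hGf : ∀ x ∈ B, G (f x) = x := fun x hx => congrArg (fun φ : C(B, E) => φ ⟨x, hx⟩) hG
  by_contra hnot
  obtain ⟨ε, hε, hGε⟩ : ∃ ε > 0, ∀ y, ‖y - f 0‖ ≤ 2 * ε → ‖G y‖ ≤ 1 / 8 := by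
    have := Metric.continuous_iff.1 G.continuous (f 0) (1 / 8) (by norm_num)
    obtain ⟨δ, hδ, h⟩ := this
    refine ⟨δ / 3, by positivity, fun y hy => ?_⟩
    have := h y (by rw [dist_eq_norm]; linarith)
    rw [hGf 0 h0B, dist_zero_right] at this
    exact this.le
  obtain ⟨c, hc, hcK⟩ : ∃ c ∈ ball (f 0) ε, c ∉ f '' B := by
    by_contra! hcon
    exact hnot (Filter.mem_of_superset (ball_mem_nhds _ hε) hcon)
  rw [mem_ball, dist_eq_norm] at hc
  have hyc : ∀ y ∈ f '' B, 0 < ‖y - c‖ := fun y hy =>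
    norm_pos_iff.2 (sub_ne_zero.2 fun h => hcK (h ▸ hy))
  obtain ⟨δ, hδ, hδ4, hGδ⟩ : ∃ δ > 0, δ ≤ 1 / 4 ∧ ∀ y ∈ f '' B, ε ≤ ‖y - c‖ → δ ≤ ‖G y‖ := by
    have hcomp : IsCompact (f '' B ∩ {y | ε ≤ ‖y - c‖}) :=
      hKc.inter_right (isClosed_le continuous_const (by fun_prop))
    rcases (f '' B ∩ {y | ε ≤ ‖y - c‖}).eq_empty_or_nonempty with he | hne
    · refine ⟨1 / 4, by norm_num, le_rfl, fun y hy hy' => ?_⟩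
      have : y ∈ f '' B ∩ {y | ε ≤ ‖y - c‖} := ⟨hy, hy'⟩
      rw [he] at this
      exact this.elim
    · obtain ⟨y₀, hy₀, hmin⟩ := hcomp.exists_isMinOn hne (f := fun y => ‖G y‖) (by fun_prop)
      refine ⟨min (1 / 4) ‖G y₀‖, lt_min (by norm_num) ?_, min_le_left _ _, fun y hy hy' =>
        (min_le_right _ _).trans (hmin ⟨hy, hy'⟩)⟩
      obtain ⟨x, hx, rfl⟩ := hy₀.1
      rw [hGf x hx, norm_pos_iff]
      rintro rfl
      have h1 := hy₀.2
      simp only [mem_ofPred_eq] at h1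
      rw [norm_sub_rev] at h1
      linarith
  obtain ⟨P, hP, hPG, -⟩ := G.continuous.exists_contDiff_approx (ε := fun _ => δ / 2) 1
    continuous_const fun _ => by positivity
  simp only [dist_eq_norm] at hPG
  have hnull : (volume : Measure E) (P '' sphere c ε) = 0 :=
    addHaar_image_eq_zero_of_differentiableOn_of_addHaar_eq_zero _
      (hP.differentiable one_ne_zero).differentiableOn
      (Measure.addHaar_sphere_of_ne_zero _ c hε.ne')
  obtain ⟨v, hv, hvP⟩ : ∃ v ∈ ball (0 : E) (δ / 2), v ∉ P '' sphere c ε := by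
    by_contra! hcon
    have h1 := measure_mono (μ := (volume : Measure E)) (show ball (0 : E) (δ / 2) ⊆ _ from hcon)
    rw [hnull] at h1
    exact (measure_ball_pos (volume : Measure E) 0 (by positivity)).not_ge h1
  rw [mem_ball_zero_iff] at hv
  -- push the part of `f '' B` in the ball around `c` out to the sphere, where `P` avoids `v`
  let Φ : E → E := fun y => c + max 1 (ε / ‖y - c‖) • (y - c)
  have hΦc : ContinuousOn Φ (f '' B) := by
    refine continuousOn_const.add (ContinuousOn.smul ?_ (by fun_prop))
    refine ContinuousOn.sup continuousOn_const
      (ContinuousOn.div continuousOn_const (by fun_prop) ?_)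
    exact fun y hy => (hyc y hy).ne'
  have hΦ1 : ∀ y ∈ f '' B, ε ≤ ‖y - c‖ → Φ y = y := by
    intro y hy h
    have : max 1 (ε / ‖y - c‖) = 1 := max_eq_left ((div_le_one (hyc y hy)).2 h)
    simp [Φ, this]
  have hΦ2 : ∀ y ∈ f '' B, ‖y - c‖ < ε → Φ y ∈ sphere c ε := by
    intro y hy h
    have : max 1 (ε / ‖y - c‖) = ε / ‖y - c‖ := max_eq_right ((one_le_div (hyc y hy)).2 h.le)
    simp only [Φ, this, mem_sphere, dist_eq_norm, add_sub_cancel_left, norm_smul, norm_div,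
      norm_norm, Real.norm_of_nonneg hε.le]
    exact div_mul_cancel₀ _ (hyc y hy).ne'
  have hFc : ContinuousOn (fun x => P (Φ (f x)) - v) B :=
    (hP.continuous.comp_continuousOn (hΦc.comp hf (mapsTo_image f B))).sub continuousOn_const
  obtain ⟨x, hx, hx0⟩ := exists_eq_zero_of_norm_sub_le hFc (by
    intro x hx
    have hy : f x ∈ f '' B := mem_image_of_mem f hx
    rcases le_or_gt ε ‖f x - c‖ with h | h
    · simp only [hΦ1 _ hy h]
      have h1 := hPG (f x)
      rw [hGf x hx] at h1
      have : P (f x) - v - x = (P (f x) - x) - v := by abel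
      rw [this]
      linarith [norm_sub_le (P (f x) - x) v]
    · have h1 := hPG (Φ (f x))
      have h2 : ‖Φ (f x) - c‖ = ε := by simpa [dist_eq_norm] using hΦ2 _ hy h
      have h3 : ‖G (Φ (f x))‖ ≤ 1 / 8 := by
        apply hGε
        have : Φ (f x) - f 0 = (Φ (f x) - c) + (c - f 0) := by abel
        rw [this]
        linarith [norm_add_le (Φ (f x) - c) (c - f 0)]
      have h4 : ‖x‖ ≤ 1 / 8 := by
        rw [← hGf x hx]
        apply hGε
        have : f x - f 0 = (f x - c) + (c - f 0) := by abel
        rw [this]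
        linarith [norm_add_le (f x - c) (c - f 0)]
      have : P (Φ (f x)) - v - x = (P (Φ (f x)) - G (Φ (f x))) - v + (G (Φ (f x)) - x) := by abel
      rw [this]
      linarith [norm_add_le (P (Φ (f x)) - G (Φ (f x)) - v) (G (Φ (f x)) - x),
        norm_sub_le (P (Φ (f x)) - G (Φ (f x))) v, norm_sub_le (G (Φ (f x))) x])
  have hy : f x ∈ f '' B := mem_image_of_mem f hx
  have hPv : P (Φ (f x)) = v := sub_eq_zero.1 hx0
  rcases le_or_gt ε ‖f x - c‖ with h | h
  · rw [hΦ1 _ hy h] at hPv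
    have h1 := hPG (f x)
    have h2 := hGδ _ hy h
    rw [hPv, norm_sub_rev] at h1
    linarith [norm_sub_norm_le (G (f x)) v]
  · exact hvP ⟨_, hΦ2 _ hy h, hPv⟩

/-- **Invariance of domain**: an injective continuous map between Euclidean spaces of the same
dimension maps neighborhoods to neighborhoods. -/
theorem image_mem_nhds_of_continuousOn_injOn {f : E → E} {U : Set E} {a : E} (hU : U ∈ 𝓝 a)
    (hf : ContinuousOn f U) (hinj : InjOn f U) : f '' U ∈ 𝓝 (f a) := by
  obtain ⟨ρ, hρ, hρU⟩ := Metric.nhds_basis_closedBall.mem_iff.1 hU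
  have hmaps : MapsTo (fun x : E => a + ρ • x) (closedBall 0 1) U := by
    intro x hx
    apply hρU
    rw [mem_closedBall_zero_iff] at hx
    rw [mem_closedBall, dist_eq_norm, add_sub_cancel_left, norm_smul, Real.norm_of_nonneg hρ.le]
    nlinarith
  have h := image_closedBall_mem_nhds (f := fun x => f (a + ρ • x))
    (hf.comp (by fun_prop) hmaps) (fun x hx y hy hxy => by
      have := hinj (hmaps hx) (hmaps hy) hxy
      exact smul_right_injective E hρ.ne' (add_left_cancel this))
  simp only [smul_zero, add_zero] at h
  refine Filter.mem_of_superset h ?_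
  rintro _ ⟨x, hx, rfl⟩
  exact ⟨_, hmaps hx, rfl⟩

end InvarianceOfDomain

/-! ### Semi-convexity from supporting paraboloids -/

/-- A function with a supporting paraboloid of uniformly bounded opening and slope at every point,
locally uniformly, is `BSC_loc`. The compact family consists of all paraboloids of a fixed opening
below the function, with bounded coefficients. -/
lemma isBSCLoc_of_forall_exists_support {d : ℕ} {f : EuclideanSpace ℝ (Fin d) → ℝ}
    {Ω : Set (EuclideanSpace ℝ (Fin d))}
    (hf : ∀ x₀ ∈ Ω, ∃ r > 0, ∃ C K : ℝ, Metric.ball x₀ r ⊆ Ω ∧ ∀ x ∈ Metric.ball x₀ r,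
      ∃ b : EuclideanSpace ℝ (Fin d), ‖b‖ ≤ K ∧ ∀ y ∈ Metric.ball x₀ r,
        f x + inner ℝ b (y - x) - C * ‖y - x‖ ^ 2 ≤ f y) : IsBSCLoc f Ω := by
  intro x₀ hx₀
  obtain ⟨r, hr, C₀, K, hrΩ, hsupp₀⟩ := hf x₀ hx₀
  set O := Metric.ball x₀ r with hO
  set C := max C₀ 1 with hC
  have hC1 : 1 ≤ C := le_max_right _ _
  have hK : 0 ≤ K := by
    obtain ⟨b, hb, -⟩ := hsupp₀ x₀ (Metric.mem_ball_self hr)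
    exact (norm_nonneg b).trans hb
  have hsupp : ∀ x ∈ O, ∃ b : EuclideanSpace ℝ (Fin d), ‖b‖ ≤ K ∧ ∀ y ∈ O,
      f x + inner ℝ b (y - x) - C * ‖y - x‖ ^ 2 ≤ f y := by
    intro x hx
    obtain ⟨b, hb, h⟩ := hsupp₀ x hx
    refine ⟨b, hb, fun y hy => le_trans ?_ (h y hy)⟩
    have : C₀ * ‖y - x‖ ^ 2 ≤ C * ‖y - x‖ ^ 2 :=
      mul_le_mul_of_nonneg_right (le_max_left _ _) (by positivity)
    linarith
  have hdist : ∀ x ∈ O, ∀ y ∈ O, ‖y - x‖ ≤ 2 * r := by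
    intro x hx y hy
    rw [← dist_eq_norm]
    have := dist_triangle_right y x x₀
    rw [hO, Metric.mem_ball] at hx hy
    linarith
  have hlip : ∀ x ∈ O, ∀ y ∈ O, f x - f y ≤ (K + 2 * C * r) * ‖x - y‖ := by
    intro x hx y hy
    obtain ⟨b, hb, h⟩ := hsupp x hx
    have h1 := h y hy
    have h2 : -inner ℝ b (y - x) ≤ K * ‖y - x‖ :=
      (neg_le_abs _).trans ((abs_real_inner_le_norm _ _).trans (by gcongr))
    have h3 : C * ‖y - x‖ ^ 2 ≤ 2 * C * r * ‖y - x‖ := by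
      have := mul_le_mul_of_nonneg_left (hdist x hx y hy) (norm_nonneg (y - x))
      nlinarith
    rw [norm_sub_rev x y]
    linarith
  have hL : 0 ≤ K + 2 * C * r := by positivity
  refine ⟨O, Metric.isOpen_ball, convex_ball _ _, Metric.isBounded_ball, Metric.mem_ball_self hr,
    hrΩ, ⟨Real.toNNReal (K + 2 * C * r), ?_⟩, 2 * C, by positivity, ?_⟩
  · refine LipschitzOnWith.of_dist_le_mul fun x hx y hy => ?_
    rw [Real.coe_toNNReal _ hL, dist_eq_norm, dist_eq_norm, Real.norm_eq_abs]
    refine abs_le.2 ⟨?_, hlip x hx y hy⟩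
    have := hlip y hy x hx
    rw [norm_sub_rev] at this
    linarith
  · set R := ‖x₀‖ + r with hR
    have hOR : ∀ x ∈ O, ‖x‖ ≤ R := by
      intro x hx
      have : ‖x - x₀‖ < r := by simpa [hO, dist_eq_norm] using hx
      have h2 := norm_sub_norm_le x x₀
      linarith
    set M := |f x₀| + (K + 2 * C * r) * (2 * r) with hM
    have hfM : ∀ x ∈ O, |f x| ≤ M := by
      intro x hx
      have hx0 := Metric.mem_ball_self (x := x₀) hr
      have h1 := hlip x hx x₀ hx0
      have h2 := hlip x₀ hx0 x hx
      have h3 := mul_le_mul_of_nonneg_left (hdist x₀ hx0 x hx) hL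
      have h4 := mul_le_mul_of_nonneg_left (hdist x hx x₀ hx0) hL
      rw [abs_le]
      constructor <;> linarith [neg_abs_le (f x₀), le_abs_self (f x₀)]
    let S : Set (EuclideanSpace ℝ (Fin d) × ℝ) :=
      Metric.closedBall 0 (K + 2 * C * R) ×ˢ Metric.closedBall 0 (M + K * R + C * R ^ 2) ∩
        {s | ∀ y ∈ O, -(1 / 2) * (2 * C) * ‖y‖ ^ 2 + inner ℝ s.1 y + s.2 ≤ f y}
    have hS : IsCompact S := by
      refine ((isCompact_closedBall _ _).prod (isCompact_closedBall _ _)).inter_right ?_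
      have : {s : EuclideanSpace ℝ (Fin d) × ℝ | ∀ y ∈ O,
          -(1 / 2) * (2 * C) * ‖y‖ ^ 2 + inner ℝ s.1 y + s.2 ≤ f y} = ⋂ y ∈ O,
          {s | -(1 / 2) * (2 * C) * ‖y‖ ^ 2 + inner ℝ s.1 y + s.2 ≤ f y} := by
        ext s; simp
      rw [this]
      exact isClosed_biInter fun y _ => isClosed_le (by fun_prop) continuous_const
    refine ⟨S, inferInstance, isCompact_iff_compactSpace.1 hS, fun s => s.1.1, fun s => s.1.2,
      by fun_prop, by fun_prop, fun x hx => ⟨?_, ?_⟩⟩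
    · obtain ⟨b, hb, h⟩ := hsupp x hx
      have hxR := hOR x hx
      have hbx : |inner ℝ b x| ≤ K * R := (abs_real_inner_le_norm _ _).trans (by gcongr)
      refine ⟨⟨(b + (2 * C) • x, f x - inner ℝ b x - C * ‖x‖ ^ 2), ⟨?_, ?_⟩, ?_⟩, ?_⟩
      · rw [mem_closedBall_zero_iff]
        refine (norm_add_le _ _).trans ?_
        rw [norm_smul, Real.norm_of_nonneg (by positivity)]
        gcongr
      · rw [mem_closedBall_zero_iff, Real.norm_eq_abs]
        refine (abs_sub _ _).trans (add_le_add ((abs_sub _ _).trans (add_le_add (hfM x hx) hbx)) ?_)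
        rw [abs_of_nonneg (by positivity)]
        gcongr
      · intro y hy
        refine le_trans (le_of_eq ?_) (h y hy)
        simp only [norm_sub_sq_real, inner_add_left, inner_smul_left, inner_sub_right,
          real_inner_comm x y, RCLike.conj_to_real]
        ring
      · simp only [inner_add_left, inner_smul_left, real_inner_self_eq_norm_sq,
          RCLike.conj_to_real]
        ring
    · rintro _ ⟨s, rfl⟩
      exact s.2.2 x hx

lemma IsSemiconvexWith.isLowerC {d : ℕ} {ρ : ℝ} {f : EuclideanSpace ℝ (Fin d) → ℝ}
    {O : Set (EuclideanSpace ℝ (Fin d))} (hO : IsOpen O) (hf : IsSemiconvexWith ρ f O) (k : ℕ∞) :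
    IsLowerC k f O := by
  obtain ⟨S, _, _, b, c, hb, hc, hmax⟩ := hf
  -- the family of paraboloids, as a function of the coefficients and of the point
  let Φ : (EuclideanSpace ℝ (Fin d) × ℝ) × EuclideanSpace ℝ (Fin d) → ℝ :=
    fun z => -(1 / 2) * ρ * ‖z.2‖ ^ 2 + inner ℝ z.1.1 z.2 + z.1.2
  have hΦ : ∀ m : ℕ∞, ContDiff ℝ m Φ := fun m =>
    ((contDiff_const.mul (contDiff_snd.norm_sq ℝ)).add
      (contDiff_fst.fst.inner ℝ contDiff_snd)).add contDiff_fst.snd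
  refine fun x₀ hx₀ => ⟨O, hO, hx₀, subset_rfl, S, ‹_›, ‹_›,
    fun x s => Φ ((b s, c s), x), fun s => ?_, fun m _ => ?_, hmax⟩
  · exact ((hΦ k).comp (contDiff_const.prodMk contDiff_id)).contDiffOn
  · have key : ∀ z : EuclideanSpace ℝ (Fin d) × S,
        iteratedFDeriv ℝ m (fun x => Φ ((b z.2, c z.2), x)) z.1 =
        (iteratedFDeriv ℝ m Φ ((b z.2, c z.2), z.1)).compContinuousLinearMap
          fun _ => ContinuousLinearMap.inr ℝ (EuclideanSpace ℝ (Fin d) × ℝ) _ := by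
      intro z
      have h1 := ContinuousLinearMap.iteratedFDeriv_comp_right
        (ContinuousLinearMap.inr ℝ (EuclideanSpace ℝ (Fin d) × ℝ) (EuclideanSpace ℝ (Fin d)))
        (f := fun w => Φ (((b z.2, c z.2), 0) + w))
        ((hΦ m).comp (contDiff_const.add contDiff_id)) z.1 (i := m) le_rfl
      rw [iteratedFDeriv_comp_add_left] at h1
      simpa [Function.comp_def] using h1
    simp_rw [key]
    refine Continuous.continuousOn ?_
    have h2 : Continuous fun z : EuclideanSpace ℝ (Fin d) × S =>
        iteratedFDeriv ℝ m Φ ((b z.2, c z.2), z.1) :=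
      ((hΦ m).continuous_iteratedFDeriv (m := m) le_rfl).comp (by fun_prop)
    exact (ContinuousMultilinearMap.compContinuousLinearMapL
      (F := ℝ) fun _ : Fin m =>
        ContinuousLinearMap.inr ℝ (EuclideanSpace ℝ (Fin d) × ℝ)
          (EuclideanSpace ℝ (Fin d))).continuous.comp h2

lemma IsBSCLoc.isLowerC {d : ℕ} {f : EuclideanSpace ℝ (Fin d) → ℝ}
    {Ω : Set (EuclideanSpace ℝ (Fin d))} (hf : IsBSCLoc f Ω) (k : ℕ∞) : IsLowerC k f Ω := by
  intro x₀ hx₀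
  obtain ⟨O, hO, -, -, hx₀O, hOΩ, -, ρ, -, hρ⟩ := hf x₀ hx₀
  obtain ⟨O', hO', hx₀', hO'O, h⟩ := hρ.isLowerC hO k x₀ hx₀O
  exact ⟨O', hO', hx₀', hO'O.trans hOΩ, h⟩

/-- Linear functions are `BSC_loc`. -/
lemma isBSCLoc_coord {d : ℕ} {Ω : Set (EuclideanSpace ℝ (Fin d))} (hΩ : IsOpen Ω) (i : Fin d) :
    IsBSCLoc (fun x : EuclideanSpace ℝ (Fin d) => x i) Ω := by
  refine isBSCLoc_of_forall_exists_support fun x₀ hx₀ => ?_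
  obtain ⟨r, hr, hrΩ⟩ := Metric.isOpen_iff.1 hΩ x₀ hx₀
  refine ⟨r, hr, 0, 1, hrΩ, fun x _ => ⟨EuclideanSpace.single i 1, by simp, fun y _ => ?_⟩⟩
  simp [EuclideanSpace.inner_single_left]

/-! ### Fields of Lorentzian cones -/

section ConeField

variable {E W : Type*} [NormedAddCommGroup E] [NormedSpace ℝ E]
  [NormedAddCommGroup W] [NormedSpace ℝ W]

/-- Quantitative data on a field `G` of Lorentzian forms on a subset `D` of a vector space: `G'` is
its derivative, the vector `e₀` and its neighbors at distance at most `α` are future timelike, and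
the future causal vectors are those causal vectors on which the functional `θ` is positive; they
are uniformly transverse to `ker θ` and to the orthogonal complement of `e₀`. One constant `L`
serves as bound in all upper estimates. -/
structure IsConeField (G : E → E →L[ℝ] E →L[ℝ] ℝ) (G' : E → E →L[ℝ] E →L[ℝ] E →L[ℝ] ℝ)
    (θ : E →L[ℝ] ℝ) (e₀ : E) (D : Set E) (L c α : ℝ) : Prop where
  symm : ∀ z ∈ D, ∀ u v, G z u v = G z v u
  continuousOn : ContinuousOn G D
  continuousOn' : ContinuousOn G' D
  norm_le : ∀ z ∈ D, ‖G z‖ ≤ L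
  norm_le' : ∀ z ∈ D, ‖G' z‖ ≤ L
  taylor : ∀ z ∈ D, ∀ w ∈ D, ‖G w - G z - G' z (w - z)‖ ≤ L * ‖w - z‖ ^ 2
  norm_functional_le : ‖θ‖ ≤ L
  norm_vector_le : ‖e₀‖ ≤ L
  one_le : 1 ≤ L
  pos : 0 < c
  cone : ∀ z ∈ D, ∀ u, G z u u ≤ 0 → 0 < θ u → ‖u‖ ≤ L * θ u ∧ G z u e₀ ≤ -c * θ u
  width_pos : 0 < α
  wide : ∀ z ∈ D, ∀ v, ‖v‖ ≤ α → G z (e₀ + v) (e₀ + v) < 0 ∧ 0 < θ (e₀ + v)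

/-- Future causal vectors of a cone field. -/
def ConeCausal (G : E → E →L[ℝ] E →L[ℝ] ℝ) (θ : E →L[ℝ] ℝ) (z u : E) : Prop :=
  G z u u ≤ 0 ∧ 0 < θ u

/-- Future timelike vectors of a cone field. -/
def ConeTimelike (G : E → E →L[ℝ] E →L[ℝ] ℝ) (θ : E →L[ℝ] ℝ) (z u : E) : Prop :=
  G z u u < 0 ∧ 0 < θ u

/-- There is a `C^1` curve in `D` from `z` to `z'` all of whose velocities satisfy `P`. The
derivatives at the end points are one-sided. -/
def IsCurveStep (P : E → E → Prop) (D : Set E) (z z' : E) : Prop :=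
  ∃ γ γ' : ℝ → E, ContinuousOn γ' (Icc 0 1) ∧
    (∀ s ∈ Icc (0 : ℝ) 1, HasDerivWithinAt γ (γ' s) (Icc 0 1) s) ∧ γ 0 = z ∧ γ 1 = z' ∧
    ∀ s ∈ Icc (0 : ℝ) 1, γ s ∈ D ∧ P (γ s) (γ' s)

variable {G : E → E →L[ℝ] E →L[ℝ] ℝ} {G' : E → E →L[ℝ] E →L[ℝ] E →L[ℝ] ℝ}
  {θ : E →L[ℝ] ℝ} {e₀ : E} {D : Set E} {L c α : ℝ}

lemma abs_apply₂_le (T : E →L[ℝ] E →L[ℝ] ℝ) {t a b : ℝ} {u v : E} (hT : ‖T‖ ≤ t) (hu : ‖u‖ ≤ a)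
    (hv : ‖v‖ ≤ b) : |T u v| ≤ t * a * b := by
  have ht := (norm_nonneg T).trans hT
  have ha := (norm_nonneg u).trans hu
  rw [← Real.norm_eq_abs]
  refine (T.le_opNorm₂ u v).trans ?_
  gcongr

lemma abs_apply₃_le (T : E →L[ℝ] E →L[ℝ] E →L[ℝ] ℝ) {t a b d : ℝ} {x u v : E} (hT : ‖T‖ ≤ t)
    (hx : ‖x‖ ≤ a) (hu : ‖u‖ ≤ b) (hv : ‖v‖ ≤ d) : |T x u v| ≤ t * a * b * d := by
  have ht := (norm_nonneg T).trans hT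
  refine abs_apply₂_le (T x) ((T.le_opNorm x).trans ?_) hu hv
  gcongr

/-- Choice of the constants for `IsConeField.exists_perturbation_constants`: `x` stands for the size
of a spatial displacement and `a` for the resulting size of the displacement of a curve. -/
lemma exists_shift_constants {L c B l I ρ N : ℝ} (hL : 1 ≤ L) (hc : 0 < c) (hB : 0 ≤ B)
    (hl : 0 ≤ l) (hI : 0 ≤ I) (hρ : 0 < ρ) (hN : 1 ≤ N) :
    ∃ Λ > 0, ∃ C₀ > 0, ∃ κ₀ > 0, 2 * Λ * c = L ^ 4 + 2 ∧ ∀ x κ : ℝ, 0 ≤ x → 0 < κ → κ ≤ κ₀ →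
      C₀ * x ^ 2 ≤ κ → ∃ a : ℝ, 0 ≤ a ∧ (B * x + κ) * L + l * (I * x) ≤ a ∧
        (B * x + Λ * κ) * L + I * x ≤ a ∧ a < ρ ∧ a ≤ 1 ∧ L * a ≤ 1 / 2 ∧ N * a ^ 2 ≤ κ := by
  obtain ⟨Λ, hΛ, hΛc⟩ : ∃ Λ > 0, 2 * Λ * c = L ^ 4 + 2 :=
    ⟨(L ^ 4 + 2) / (2 * c), by positivity, by field_simp⟩
  obtain ⟨M, hM1, hM2, hM3⟩ : ∃ M : ℝ, 1 ≤ M ∧ (B + Λ + 1) * L + l * I ≤ M ∧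
      (B + Λ + 1) * L + I ≤ M := by
    have h1 : 0 ≤ (B + Λ + 1) * L := by positivity
    have h2 : 0 ≤ l * I := by positivity
    exact ⟨(B + Λ + 1) * L + l * I + I + 1, by linarith, by linarith, by linarith⟩
  obtain ⟨τ, hτ0, hτ1, hτρ, hτL⟩ : ∃ τ > 0, τ ≤ 1 ∧ τ < ρ ∧ L * τ ≤ 1 / 2 := by
    refine ⟨min 1 (min (ρ / 2) (1 / (2 * L))), by positivity, min_le_left _ _,
      ((min_le_right _ _).trans (min_le_left _ _)).trans_lt (by linarith), ?_⟩
    have := mul_le_mul_of_nonneg_left ((min_le_right 1 (min (ρ / 2) (1 / (2 * L)))).trans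
      (min_le_right _ _)) (by linarith : 0 ≤ L)
    have h3 : L * (1 / (2 * L)) = 1 / 2 := by field_simp
    linarith only [this, h3]
  -- `P` absorbs the constants of the remainder
  obtain ⟨P, hP⟩ : ∃ P, P = N * M ^ 2 := ⟨_, rfl⟩
  have hP1 : 1 ≤ P := by
    rw [hP]; nlinarith only [hN, hM1, mul_le_mul hN (one_le_pow₀ hM1 (n := 2)) zero_le_one
      (by linarith : 0 ≤ N)]
  refine ⟨Λ, hΛ, 4 * P, by positivity,
    min (1 / (4 * P)) (min (τ / (2 * M)) ((τ / (2 * M)) ^ 2)), by positivity, hΛc, ?_⟩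
  intro x κ hx hκ hκ₀ hxκ
  have hκP : κ ≤ 1 / (4 * P) := hκ₀.trans (min_le_left _ _)
  have hκτ : κ ≤ τ / (2 * M) := hκ₀.trans ((min_le_right _ _).trans (min_le_left _ _))
  have hκτ2 : κ ≤ (τ / (2 * M)) ^ 2 := hκ₀.trans ((min_le_right _ _).trans (min_le_right _ _))
  have hxτ : x ≤ τ / (2 * M) := by
    refine abs_le_of_sq_le_sq' ?_ (by positivity) |>.2
    have : x ^ 2 ≤ 4 * P * x ^ 2 := by nlinarith only [sq_nonneg x, hP1]
    linarith only [this, hxκ, hκτ2]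
  have haτ : M * (x + κ) ≤ τ := by
    have h1 : τ / M = τ / (2 * M) + τ / (2 * M) := by field_simp; ring
    have h2 : x + κ ≤ τ / M := by rw [h1]; exact add_le_add hxτ hκτ
    rw [le_div_iff₀ (by positivity)] at h2
    linarith only [h2]
  refine ⟨M * (x + κ), by positivity, ?_, ?_, haτ.trans_lt hτρ, haτ.trans hτ1, ?_, ?_⟩
  · have h1 := mul_le_mul_of_nonneg_right hM2 (by positivity : 0 ≤ x + κ)
    have h2 : 0 ≤ B * κ * L + (Λ + 1) * L * x + Λ * L * κ + l * I * κ := by positivity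
    linarith only [h1, h2]
  · have h1 := mul_le_mul_of_nonneg_right hM3 (by positivity : 0 ≤ x + κ)
    have h2 : 0 ≤ B * κ * L + (Λ + 1) * L * x + L * κ + I * κ := by positivity
    linarith only [h1, h2]
  · exact (mul_le_mul_of_nonneg_left haτ (by linarith)).trans hτL
  · have h1 : (x + κ) ^ 2 ≤ 2 * x ^ 2 + 2 * κ ^ 2 := by nlinarith only [sq_nonneg (x - κ)]
    have h2 : P * κ ≤ 1 / 4 := by
      have := mul_le_mul_of_nonneg_left hκP (by positivity : (0 : ℝ) ≤ P)
      have h3 : P * (1 / (4 * P)) = 1 / 4 := by field_simp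
      linarith only [this, h3]
    have h3 := mul_le_mul_of_nonneg_left h1 (by positivity : (0 : ℝ) ≤ P)
    have h4 := mul_le_mul_of_nonneg_right h2 hκ.le
    have h5 : N * (M * (x + κ)) ^ 2 = P * (x + κ) ^ 2 := by rw [hP]; ring
    rw [h5]
    linarith only [h3, h4, hxκ]

/-- Second order expansion of `G (z + ξ) (u + η) (u + η)`, with a bound for the remainder. -/
lemma IsConeField.apply_add_le (hG : IsConeField G G' θ e₀ D L c α) {z ξ u η : E} {a : ℝ}
    (hz : z ∈ D) (hzξ : z + ξ ∈ D) (hu : ‖u‖ ≤ L) (hξ : ‖ξ‖ ≤ a) (hη : ‖η‖ ≤ a) (ha : a ≤ 1) :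
    G (z + ξ) (u + η) (u + η) ≤ G z u u + 2 * G z u η + G' z ξ u u +
      (2 * L + 2 * L ^ 2 + L * (L + 1) ^ 2) * a ^ 2 := by
  have hL := hG.one_le
  have ha0 : 0 ≤ a := (norm_nonneg _).trans hξ
  obtain ⟨T, hT⟩ : ∃ T, T = G (z + ξ) - G z - G' z ξ := ⟨_, rfl⟩
  have hTn : ‖T‖ ≤ L * a ^ 2 := by
    have := hG.taylor z hz _ hzξ
    rw [add_sub_cancel_left, ← hT] at this
    exact this.trans (by gcongr)
  have hv : ‖u + η‖ ≤ L + 1 := (norm_add_le _ _).trans (by linarith)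
  have hexp : G (z + ξ) (u + η) (u + η) = G z u u + 2 * G z u η + G z η η + G' z ξ u u +
      G' z ξ u η + G' z ξ η u + G' z ξ η η + T (u + η) (u + η) := by
    have : G (z + ξ) = G z + G' z ξ + T := by rw [hT]; abel
    rw [this]
    simp only [add_apply, map_add, hG.symm z hz η u]
    ring
  have b1 := (abs_le.1 (abs_apply₂_le (G z) (hG.norm_le z hz) hη hη)).2
  have b2 := (abs_le.1 (abs_apply₃_le (G' z) (hG.norm_le' z hz) hξ hu hη)).2
  have b3 := (abs_le.1 (abs_apply₃_le (G' z) (hG.norm_le' z hz) hξ hη hu)).2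
  have b4 := (abs_le.1 (abs_apply₃_le (G' z) (hG.norm_le' z hz) hξ hη hη)).2
  have b5 := (abs_le.1 (abs_apply₂_le T hTn hv hv)).2
  have b6 : L * a ^ 2 * a ≤ L * a ^ 2 * 1 := mul_le_mul_of_nonneg_left ha (by positivity)
  rw [hexp]
  linarith only [b1, b2, b3, b4, b5, b6]

/-- The heart of the matter: if a future causal vector `u` at `z`, normalized by `θ u = 1`, is
displaced to `u + η` at `z + ξ`, where the first order effect of the part linear in `w` cancels,
then an additional exponentially growing downward shift `κ` dominates the quadratic remainder and
makes the displaced vector timelike. -/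
lemma IsConeField.exists_perturbation_constants (hG : IsConeField G G' θ e₀ D L c α)
    (ι : W →L[ℝ] E) {B l ρ : ℝ} (hB : 0 ≤ B) (hl : 0 ≤ l) (hρ : 0 < ρ) :
    ∃ Λ > 0, ∃ C₀ > 0, ∃ κ₀ > 0, ∀ z, Metric.ball z ρ ⊆ D → ∀ u, G z u u ≤ 0 → θ u = 1 →
      ∀ (w : W) (p r ζ κ : ℝ), |ζ| ≤ l → |p| ≤ B * ‖w‖ → |r| ≤ B * ‖w‖ → 0 < κ → κ ≤ κ₀ →
      C₀ * ‖w‖ ^ 2 ≤ κ →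
      2 * r * G z u e₀ - 2 * G z u (ι w) + p * G' z e₀ u u + ζ * G' z (ι w) u u = 0 →
      z + ((p - κ) • e₀ + ζ • ι w) ∈ D ∧
      ConeTimelike G θ (z + ((p - κ) • e₀ + ζ • ι w)) (u + ((r + Λ * κ) • e₀ - ι w)) := by
  have hL := hG.one_le
  have hc := hG.pos
  obtain ⟨Λ, hΛ, C₀, hC₀, κ₀, hκ₀, hΛc, hconst⟩ := exists_shift_constants
    (N := 2 * L + 2 * L ^ 2 + L * (L + 1) ^ 2) hL hc hB hl (norm_nonneg ι) hρ
    (by have : 0 ≤ 2 * L ^ 2 + L * (L + 1) ^ 2 := by positivity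
        linarith)
  refine ⟨Λ, hΛ, C₀, hC₀, κ₀, hκ₀, ?_⟩
  intro z hzD u huu hθu w p r ζ κ hζ hp hr hκ hκκ₀ hwκ hlin
  obtain ⟨a, ha0, ha1, ha2, haρ, ha, hLa, hNa⟩ := hconst ‖w‖ κ (norm_nonneg w) hκ hκκ₀ hwκ
  have hz : z ∈ D := hzD (Metric.mem_ball_self hρ)
  have hιw : ‖ι w‖ ≤ ‖ι‖ * ‖w‖ := ι.le_opNorm w
  have hξa : ‖(p - κ) • e₀ + ζ • ι w‖ ≤ a := by
    have h1 : ‖(p - κ) • e₀‖ ≤ (B * ‖w‖ + κ) * L := by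
      rw [norm_smul, Real.norm_eq_abs]
      gcongr
      · exact (abs_sub _ _).trans (by rw [abs_of_pos hκ]; linarith)
      · exact hG.norm_vector_le
    have h2 : ‖ζ • ι w‖ ≤ l * (‖ι‖ * ‖w‖) := by
      rw [norm_smul, Real.norm_eq_abs]
      gcongr
    exact (norm_add_le _ _).trans ((add_le_add h1 h2).trans ha1)
  have hηa : ‖(r + Λ * κ) • e₀ - ι w‖ ≤ a := by
    have h1 : ‖(r + Λ * κ) • e₀‖ ≤ (B * ‖w‖ + Λ * κ) * L := by
      rw [norm_smul, Real.norm_eq_abs]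
      gcongr
      · exact (abs_add_le _ _).trans (by rw [abs_of_pos (mul_pos hΛ hκ)]; linarith)
      · exact hG.norm_vector_le
    exact (norm_sub_le _ _).trans ((add_le_add h1 hιw).trans ha2)
  obtain ⟨hu, hue⟩ := hG.cone z hz u huu (by rw [hθu]; exact one_pos)
  rw [hθu, mul_one] at hu hue
  have hzξ : z + ((p - κ) • e₀ + ζ • ι w) ∈ D := by
    apply hzD
    rw [Metric.mem_ball, dist_eq_norm, add_sub_cancel_left]
    linarith only [hξa, haρ]
  refine ⟨hzξ, ?_, ?_⟩
  · have hexp := hG.apply_add_le hz hzξ hu hξa hηa ha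
    have h1 : G z u ((r + Λ * κ) • e₀ - ι w) = (r + Λ * κ) * G z u e₀ - G z u (ι w) := by
      simp [map_sub]
    have h2 : G' z ((p - κ) • e₀ + ζ • ι w) u u =
        (p - κ) * G' z e₀ u u + ζ * G' z (ι w) u u := by
      simp
    rw [h1, h2] at hexp
    have b6 := (abs_le.1 (abs_apply₃_le (G' z) (hG.norm_le' z hz) hG.norm_vector_le hu hu)).1
    have h3 : 2 * Λ * κ * G z u e₀ ≤ -(L ^ 4 + 2) * κ := by
      have := mul_le_mul_of_nonneg_left hue (by positivity : 0 ≤ 2 * Λ * κ)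
      rw [← hΛc]
      linarith only [this]
    have h4 : -(κ * G' z e₀ u u) ≤ κ * L ^ 4 := by
      have := mul_le_mul_of_nonneg_left b6 hκ.le
      linarith only [this]
    refine hexp.trans_lt ?_
    linarith only [huu, hlin, h3, h4, hNa, hκ]
  · have h1 : |θ ((r + Λ * κ) • e₀ - ι w)| ≤ L * a := by
      rw [← Real.norm_eq_abs]
      refine (θ.le_opNorm _).trans ?_
      gcongr
      exact hG.norm_functional_le
    rw [map_add, hθu]
    linarith only [(abs_le.1 h1).1, hLa]

end ConeField

/-! ### Linear differential equations along a curve -/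

section LinearODE

/-- A scalar linear equation with a vector valued inhomogeneity, solved by variation of constants
from its terminal value. -/
lemma exists_hasDerivWithinAt_linear {X : Type*} [NormedAddCommGroup X] [NormedSpace ℝ X]
    [CompleteSpace X] {a : ℝ → ℝ} {d : ℝ → X} (ha : ContinuousOn a (Icc 0 1))
    (hd : ContinuousOn d (Icc 0 1)) (x₁ : X) :
    ∃ β : ℝ → X, (∀ s ∈ Icc (0 : ℝ) 1,
      HasDerivWithinAt β (a s • β s + d s) (Icc 0 1) s) ∧ β 1 = x₁ := by
  obtain ⟨a', ha', haa⟩ : ∃ a' : ℝ → ℝ, Continuous a' ∧ ∀ s ∈ Icc (0 : ℝ) 1, a' s = a s :=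
    ⟨IccExtend zero_le_one ((Icc (0 : ℝ) 1).domRestrict a), ha.domRestrict.Icc_extend',
      fun s hs => by rw [IccExtend_of_mem _ _ hs]; rfl⟩
  obtain ⟨d', hd', hdd⟩ : ∃ d' : ℝ → X, Continuous d' ∧ ∀ s ∈ Icc (0 : ℝ) 1, d' s = d s :=
    ⟨IccExtend zero_le_one ((Icc (0 : ℝ) 1).domRestrict d), hd.domRestrict.Icc_extend',
      fun s hs => by rw [IccExtend_of_mem _ _ hs]; rfl⟩
  let A : ℝ → ℝ := fun s => ∫ t in (1 : ℝ)..s, a' t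
  have hA : ∀ s, HasDerivAt A (a' s) s := fun s => ha'.integral_hasStrictDerivAt 1 s |>.hasDerivAt
  have hAc : Continuous A := continuous_iff_continuousAt.2 fun s => (hA s).continuousAt
  let I : ℝ → X := fun s => ∫ t in (1 : ℝ)..s, Real.exp (-A t) • d' t
  have hI : ∀ s, HasDerivAt I (Real.exp (-A s) • d' s) s := fun s =>
    Continuous.integral_hasStrictDerivAt (by fun_prop) 1 s |>.hasDerivAt
  refine ⟨fun s => Real.exp (A s) • (x₁ + I s), fun s hs => ?_, ?_⟩
  · have h := ((hA s).exp.smul ((hI s).const_add x₁)).hasDerivWithinAt (s := Icc 0 1)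
    refine h.congr_deriv ?_
    rw [haa s hs, hdd s hs, smul_smul, ← Real.exp_add, add_neg_cancel, Real.exp_zero, one_smul,
      smul_smul, mul_comm (Real.exp _), add_comm]
  · simp [A, I]

/-- Grönwall estimate, backwards from the terminal value and with respect to the clock `φ`. -/
lemma norm_le_exp_of_hasDerivWithinAt {X : Type*} [NormedAddCommGroup X] [NormedSpace ℝ X]
    {β β' : ℝ → X} {φ lam : ℝ → ℝ} {A q : ℝ} (hA : 0 < A)
    (hβ : ∀ s ∈ Icc (0 : ℝ) 1, HasDerivWithinAt β (β' s) (Icc 0 1) s)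
    (hφ : ∀ s ∈ Icc (0 : ℝ) 1, HasDerivWithinAt φ (lam s) (Icc 0 1) s)
    (hlam : ∀ s ∈ Icc (0 : ℝ) 1, 0 < lam s)
    (hbound : ∀ s ∈ Icc (0 : ℝ) 1, ‖β' s‖ ≤ lam s * (A * (‖β s‖ + 1)))
    (h1 : ‖β 1‖ ≤ Real.exp (2 * A * (q - φ 1)) - 1) :
    ∀ s ∈ Icc (0 : ℝ) 1, ‖β s‖ ≤ Real.exp (2 * A * (q - φ s)) - 1 := by
  have hmem : ∀ t ∈ Icc (0 : ℝ) 1, 1 - t ∈ Icc (0 : ℝ) 1 := fun t ht =>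
    ⟨by linarith [ht.2], by linarith [ht.1]⟩
  have hmaps : MapsTo (fun t : ℝ => 1 - t) (Icc 0 1) (Icc 0 1) := hmem
  have hrev : ∀ t, HasDerivWithinAt (fun t : ℝ => 1 - t) (-1) (Icc 0 1) t := fun t =>
    ((hasDerivAt_id t).const_sub 1).hasDerivWithinAt
  have hf : ∀ t ∈ Icc (0 : ℝ) 1, HasDerivWithinAt (fun t => β (1 - t)) ((-1 : ℝ) • β' (1 - t))
      (Icc 0 1) t := fun t ht => (hβ _ (hmem t ht)).scomp t (hrev t) hmaps
  have hB : ∀ t ∈ Icc (0 : ℝ) 1, HasDerivWithinAt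
      (fun t => Real.exp (2 * A * (q - φ (1 - t))) - 1)
      (Real.exp (2 * A * (q - φ (1 - t))) * (2 * A * lam (1 - t))) (Icc 0 1) t := by
    intro t ht
    have h := (hφ _ (hmem t ht)).scomp t (hrev t) hmaps
    have h2 := (((h.const_sub q).const_mul (2 * A)).exp).sub_const 1
    refine h2.congr_deriv ?_
    simp
  have hIci : ∀ t ∈ Ico (0 : ℝ) 1, Icc (0 : ℝ) 1 ∈ 𝓝[Ici t] t := fun t ht =>
    Filter.mem_of_superset (Icc_mem_nhdsGE ht.2) (Icc_subset_Icc_left ht.1)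
  have key := image_norm_le_of_norm_deriv_right_lt_deriv_boundary' (a := (0 : ℝ)) (b := 1)
    (f := fun t => β (1 - t)) (f' := fun t => (-1 : ℝ) • β' (1 - t))
    (fun t ht => (hf t ht).continuousWithinAt)
    (fun t ht => (hf t (Ico_subset_Icc_self ht)).mono_of_mem_nhdsWithin (hIci t ht))
    (B := fun t => Real.exp (2 * A * (q - φ (1 - t))) - 1)
    (B' := fun t => Real.exp (2 * A * (q - φ (1 - t))) * (2 * A * lam (1 - t)))
    (by simpa using h1) (fun t ht => (hB t ht).continuousWithinAt)
    (fun t ht => (hB t (Ico_subset_Icc_self ht)).mono_of_mem_nhdsWithin (hIci t ht))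
    (fun t ht heq => by
      have hs := hmem t (Ico_subset_Icc_self ht)
      have hb := hbound _ hs
      rw [heq, sub_add_cancel] at hb
      rw [norm_smul, norm_neg, norm_one, one_mul]
      refine hb.trans_lt ?_
      have : 0 < Real.exp (2 * A * (q - φ (1 - t))) * (A * lam (1 - t)) := by
        have := hlam _ hs
        positivity
      linarith)
  intro s hs
  simpa using key (hmem s hs)

end LinearODE

/-! ### Perturbing causal curves in a field of cones -/

section ConeField

variable {E W : Type*} [NormedAddCommGroup E] [NormedSpace ℝ E]
  [NormedAddCommGroup W] [NormedSpace ℝ W]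
  {G : E → E →L[ℝ] E →L[ℝ] ℝ} {G' : E → E →L[ℝ] E →L[ℝ] E →L[ℝ] ℝ}
  {θ : E →L[ℝ] ℝ} {e₀ : E} {D : Set E} {L c α : ℝ}

lemma ConeTimelike.smul {z u : E} (h : ConeTimelike G θ z u) {t : ℝ} (ht : 0 < t) :
    ConeTimelike G θ z (t • u) := by
  refine ⟨?_, ?_⟩
  · have : G z (t • u) (t • u) = t ^ 2 * G z u u := by
      simp; ring
    rw [this]
    exact mul_neg_of_pos_of_neg (by positivity) h.1
  · rw [map_smul, smul_eq_mul]
    exact mul_pos ht h.2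

lemma ConeTimelike.coneCausal {z u : E} (h : ConeTimelike G θ z u) : ConeCausal G θ z u :=
  ⟨h.1.le, h.2⟩

lemma IsCurveStep.mono {P Q : E → E → Prop} {D₁ D₂ : Set E} {z z' : E}
    (hPQ : ∀ z u, P z u → Q z u) (hD : D₁ ⊆ D₂) (h : IsCurveStep P D₁ z z') :
    IsCurveStep Q D₂ z z' := by
  obtain ⟨γ, γ', h1, h2, h3, h4, h5⟩ := h
  exact ⟨γ, γ', h1, h2, h3, h4, fun s hs => ⟨hD (h5 s hs).1, hPQ _ _ (h5 s hs).2⟩⟩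

/-- Straight segments in a direction close to `e₀` are timelike. -/
lemma IsConeField.isCurveStep_segment (hG : IsConeField G G' θ e₀ D L c α) {D' : Set E}
    (hD' : D' ⊆ D) (hconv : Convex ℝ D') {z v : E} {t : ℝ} (ht : 0 < t) (hv : ‖v‖ ≤ α)
    (hz : z ∈ D') (hz' : z + t • (e₀ + v) ∈ D') :
    IsCurveStep (ConeTimelike G θ) D' z (z + t • (e₀ + v)) := by
  refine ⟨fun s => z + s • (t • (e₀ + v)), fun _ => t • (e₀ + v), continuousOn_const,
    fun s _ => ?_, by simp, by simp, fun s hs => ?_⟩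
  · have := ((hasDerivAt_id s).smul_const (t • (e₀ + v))).const_add z
    simpa using this.hasDerivWithinAt
  · have hm : z + s • (t • (e₀ + v)) ∈ D' := hconv.add_smul_mem hz hz' hs
    exact ⟨hm, ConeTimelike.smul (hG.wide _ (hD' hm) v hv) ht⟩

/-- Causal curves are Lipschitz with respect to the clock `θ`. -/
lemma IsConeField.norm_sub_le_of_coneCausal (hG : IsConeField G G' θ e₀ D L c α) {γ γ' : ℝ → E}
    (hγ : ∀ s ∈ Icc (0 : ℝ) 1, HasDerivWithinAt γ (γ' s) (Icc 0 1) s)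
    (hP : ∀ s ∈ Icc (0 : ℝ) 1, γ s ∈ D ∧ ConeCausal G θ (γ s) (γ' s)) {s t : ℝ} (hs : 0 ≤ s)
    (hst : s ≤ t) (ht : t ≤ 1) : ‖γ t - γ s‖ ≤ L * (θ (γ t) - θ (γ s)) := by
  have hsub : Icc s t ⊆ Icc 0 1 := Icc_subset_Icc hs ht
  have hθ : ∀ x ∈ Icc (0 : ℝ) 1, HasDerivWithinAt (fun x => θ (γ x)) (θ (γ' x)) (Icc 0 1) x :=
    fun x hx => θ.hasFDerivAt.comp_hasDerivWithinAt x (hγ x hx)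
  have hIci : ∀ x ∈ Ico s t, Icc (0 : ℝ) 1 ∈ 𝓝[Ici x] x := fun x hx =>
    Filter.mem_of_superset (Icc_mem_nhdsGE (hx.2.trans_le ht))
      (Icc_subset_Icc_left (hs.trans hx.1))
  have := image_norm_le_of_norm_deriv_right_le_deriv_boundary' (a := s) (b := t)
    (f := fun x => γ x - γ s) (f' := γ')
    (fun x hx => ((hγ x (hsub hx)).sub_const _).continuousWithinAt.mono hsub)
    (fun x hx => ((hγ x (hsub (Ico_subset_Icc_self hx))).sub_const _).mono_of_mem_nhdsWithin
      (hIci x hx))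
    (B := fun x => L * (θ (γ x) - θ (γ s))) (B' := fun x => L * θ (γ' x)) (by simp)
    (fun x hx => (((hθ x (hsub hx)).sub_const _).const_mul L).continuousWithinAt.mono hsub)
    (fun x hx => (((hθ x (hsub (Ico_subset_Icc_self hx))).sub_const _).const_mul
      L).mono_of_mem_nhdsWithin (hIci x hx))
    (fun x hx => by
      have h := hP x (hsub (Ico_subset_Icc_self hx))
      exact (hG.cone _ h.1 _ h.2.1 h.2.2).1)
  exact this (right_mem_Icc.2 hst)

lemma IsConeField.norm_sub_le_of_isCurveStep (hG : IsConeField G G' θ e₀ D L c α) {z z' : E}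
    (h : IsCurveStep (ConeCausal G θ) D z z') : ‖z' - z‖ ≤ L * (θ z' - θ z) := by
  obtain ⟨γ, γ', -, hγ, rfl, rfl, hP⟩ := h
  exact hG.norm_sub_le_of_coneCausal hγ hP le_rfl zero_le_one le_rfl

/-- The starting point of the perturbation of a causal curve from `z` to a point with clock value
`q`: it is displaced horizontally by a multiple of `w` which decreases to zero along the curve,
and vertically by a linear function `b` of `w` and a downward shift proportional to `σ`. -/
noncomputable def perturbedPoint (θ : E →L[ℝ] ℝ) (e₀ : E) (ι : W →L[ℝ] E) (Λ q : ℝ)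
    (b : W →L[ℝ] ℝ) (w : W) (σ : ℝ) (z : E) : E :=
  z + ((b w - σ * Real.exp (Λ * (q - θ z))) • e₀ + (q - θ z) • ι w)

/-- The coefficient and the inhomogeneity of the equation along a causal curve that expresses the
cancellation of the first order effects of a displacement. -/
lemma IsConeField.exists_slope (hG : IsConeField G G' θ e₀ D L c α) (ι : W →L[ℝ] E) {l : ℝ}
    {γ γ' : ℝ → E} (hγc : ContinuousOn γ (Icc 0 1)) (hγ'c : ContinuousOn γ' (Icc 0 1))
    (hP : ∀ s ∈ Icc (0 : ℝ) 1, γ s ∈ D ∧ ConeCausal G θ (γ s) (γ' s)) {q : ℝ}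
    (hq : ∀ s ∈ Icc (0 : ℝ) 1, |q - θ (γ s)| ≤ l) :
    ∃ (a : ℝ → ℝ) (d : ℝ → W →L[ℝ] ℝ), ContinuousOn a (Icc 0 1) ∧ ContinuousOn d (Icc 0 1) ∧
      ∀ s ∈ Icc (0 : ℝ) 1, ∀ b : W →L[ℝ] ℝ,
        ‖a s • b + d s‖ ≤ θ (γ' s) *
          ((L ^ 4 + 2 * L ^ 2 * ‖ι‖ + l * L ^ 3 * ‖ι‖) / (2 * c) * (‖b‖ + 1)) ∧
        ∀ w, let u := (θ (γ' s))⁻¹ • γ' s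
          2 * ((θ (γ' s))⁻¹ * (a s • b + d s) w) * G (γ s) u e₀ - 2 * G (γ s) u (ι w) +
            b w * G' (γ s) e₀ u u + (q - θ (γ s)) * G' (γ s) (ι w) u u = 0 := by
  have hL := hG.one_le
  have hc := hG.pos
  have hpos : ∀ s ∈ Icc (0 : ℝ) 1, 0 < θ (γ' s) := fun s hs => (hP s hs).2.2
  let u : ℝ → E := fun s => (θ (γ' s))⁻¹ • γ' s
  have huc : ContinuousOn u (Icc 0 1) :=
    ((θ.continuous.comp_continuousOn hγ'c).inv₀ fun s hs => (hpos s hs).ne').smul hγ'c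
  have hGc : ContinuousOn (fun s => G (γ s)) (Icc 0 1) :=
    hG.continuousOn.comp hγc fun s hs => (hP s hs).1
  have hGc' : ContinuousOn (fun s => G' (γ s)) (Icc 0 1) :=
    hG.continuousOn'.comp hγc fun s hs => (hP s hs).1
  have hu : ∀ s ∈ Icc (0 : ℝ) 1, θ (u s) = 1 ∧ G (γ s) (u s) (u s) ≤ 0 := by
    intro s hs
    refine ⟨by simp [u, (hpos s hs).ne'], ?_⟩
    have : G (γ s) (u s) (u s) = (θ (γ' s))⁻¹ ^ 2 * G (γ s) (γ' s) (γ' s) := by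
      simp [u]; ring
    rw [this]
    exact mul_nonpos_of_nonneg_of_nonpos (by positivity) (hP s hs).2.1
  have hcone : ∀ s ∈ Icc (0 : ℝ) 1, ‖u s‖ ≤ L ∧ G (γ s) (u s) e₀ ≤ -c := by
    intro s hs
    have := hG.cone (γ s) (hP s hs).1 (u s) (hu s hs).2 (by rw [(hu s hs).1]; exact one_pos)
    rwa [(hu s hs).1, mul_one, mul_one] at this
  -- the linear form `x ↦ G' (γ s) x (u s) (u s)`
  let Q : ℝ → E →L[ℝ] ℝ := fun s => ((G' (γ s)).flip (u s)).flip (u s)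
  have hQ : ∀ s x, Q s x = G' (γ s) x (u s) (u s) := fun s x => rfl
  have hQc : ContinuousOn Q (Icc 0 1) := by
    have h1 : ContinuousOn (fun s => (G' (γ s)).flip (u s)) (Icc 0 1) :=
      ((ContinuousLinearMap.flipₗᵢ ℝ E E (E →L[ℝ] ℝ)).continuous.comp_continuousOn hGc').clm_apply
        huc
    exact ((ContinuousLinearMap.flipₗᵢ ℝ E E ℝ).continuous.comp_continuousOn h1).clm_apply huc
  have hQn : ∀ s ∈ Icc (0 : ℝ) 1, ‖Q s‖ ≤ L ^ 3 := by
    intro s hs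
    refine ContinuousLinearMap.opNorm_le_bound _ (by positivity) fun x => ?_
    rw [hQ, Real.norm_eq_abs]
    refine (abs_apply₃_le (G' (γ s)) (hG.norm_le' _ (hP s hs).1) le_rfl (hcone s hs).1
      (hcone s hs).1).trans (le_of_eq (by ring))
  have hg : ContinuousOn (fun s => 2 * G (γ s) (u s) e₀) (Icc 0 1) :=
    continuousOn_const.mul ((hGc.clm_apply huc).clm_apply continuousOn_const)
  have hg0 : ∀ s ∈ Icc (0 : ℝ) 1, 2 * G (γ s) (u s) e₀ ≠ 0 := fun s hs => by
    have := (hcone s hs).2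
    exact ne_of_lt (by linarith)
  have hθc : ContinuousOn (fun s => θ (γ' s)) (Icc 0 1) := θ.continuous.comp_continuousOn hγ'c
  refine ⟨fun s => -(θ (γ' s) / (2 * G (γ s) (u s) e₀) * Q s e₀),
    fun s => (θ (γ' s) / (2 * G (γ s) (u s) e₀)) •
      ((2 : ℝ) • (G (γ s) (u s)).comp ι - (q - θ (γ s)) • (Q s).comp ι), ?_, ?_, ?_⟩
  · exact ((hθc.div hg hg0).mul (hQc.clm_apply continuousOn_const)).neg
  · refine (hθc.div hg hg0).smul (ContinuousOn.sub ?_ ?_)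
    · exact ((hGc.clm_apply huc).clm_comp continuousOn_const).const_smul (2 : ℝ)
    · exact (continuousOn_const.sub (θ.continuous.comp_continuousOn hγc)).smul
        (hQc.clm_comp continuousOn_const)
  · intro s hs b
    obtain ⟨hun, hue⟩ := hcone s hs
    have hlam := hpos s hs
    refine ⟨?_, ?_⟩
    · have hl : 0 ≤ l := (abs_nonneg _).trans (hq s hs)
      have h0 : (-(θ (γ' s) / (2 * G (γ s) (u s) e₀) * Q s e₀)) • b +
          (θ (γ' s) / (2 * G (γ s) (u s) e₀)) •
            ((2 : ℝ) • (G (γ s) (u s)).comp ι - (q - θ (γ s)) • (Q s).comp ι) =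
          (θ (γ' s) / (2 * G (γ s) (u s) e₀)) • (-(Q s e₀ • b) +
            ((2 : ℝ) • (G (γ s) (u s)).comp ι - (q - θ (γ s)) • (Q s).comp ι)) := by
        rw [smul_add, smul_neg, smul_smul, neg_smul]
      have h1 : ‖Q s e₀ • b‖ ≤ L ^ 4 * ‖b‖ := by
        rw [norm_smul]
        have : ‖Q s e₀‖ ≤ L ^ 3 * L :=
          ((Q s).le_opNorm e₀).trans (by gcongr; exacts [hQn s hs, hG.norm_vector_le])
        gcongr
        linarith
      have h2 : ‖(2 : ℝ) • (G (γ s) (u s)).comp ι‖ ≤ 2 * L ^ 2 * ‖ι‖ := by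
        rw [norm_smul, Real.norm_of_nonneg zero_le_two, mul_assoc]
        have h3 : ‖G (γ s) (u s)‖ ≤ L ^ 2 := by
          refine ((G (γ s)).le_opNorm (u s)).trans ?_
          rw [pow_two]
          gcongr
          exact hG.norm_le _ (hP s hs).1
        have h4 := ((G (γ s) (u s)).opNorm_comp_le ι).trans
          (mul_le_mul_of_nonneg_right h3 (norm_nonneg ι))
        linarith
      have h3 : ‖(q - θ (γ s)) • (Q s).comp ι‖ ≤ l * L ^ 3 * ‖ι‖ := by
        rw [norm_smul, Real.norm_eq_abs, mul_assoc]
        have h4 := ((Q s).opNorm_comp_le ι).trans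
          (mul_le_mul_of_nonneg_right (hQn s hs) (norm_nonneg ι))
        exact mul_le_mul (hq s hs) h4 (norm_nonneg _) hl
      have h4 : ‖-(Q s e₀ • b) +
            ((2 : ℝ) • (G (γ s) (u s)).comp ι - (q - θ (γ s)) • (Q s).comp ι)‖ ≤
          (L ^ 4 + 2 * L ^ 2 * ‖ι‖ + l * L ^ 3 * ‖ι‖) * (‖b‖ + 1) := by
        refine (norm_add_le _ _).trans ?_
        rw [norm_neg]
        have h5 := (norm_sub_le ((2 : ℝ) • (G (γ s) (u s)).comp ι)
          ((q - θ (γ s)) • (Q s).comp ι)).trans (add_le_add h2 h3)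
        have h6 : 0 ≤ L ^ 4 + (2 * L ^ 2 * ‖ι‖ + l * L ^ 3 * ‖ι‖) * ‖b‖ := by positivity
        linarith only [h1, h5, h6]
      have h5 : |θ (γ' s) / (2 * G (γ s) (u s) e₀)| ≤ θ (γ' s) / (2 * c) := by
        rw [abs_div, abs_of_pos hlam]
        refine div_le_div_of_nonneg_left hlam.le (by positivity) ?_
        rw [abs_of_neg (by linarith)]
        linarith
      rw [h0, norm_smul, Real.norm_eq_abs]
      refine (mul_le_mul h5 h4 (norm_nonneg _) (by positivity)).trans (le_of_eq ?_)
      ring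
    · intro w
      have hg := hg0 s hs
      change 2 * ((θ (γ' s))⁻¹ * _) * G (γ s) (u s) e₀ - 2 * G (γ s) (u s) (ι w) +
            b w * G' (γ s) e₀ (u s) (u s) + (q - θ (γ s)) * G' (γ s) (ι w) (u s) (u s) = 0
      rw [← hQ, ← hQ]
      have hne := hlam.ne'
      simp only [add_apply, smul_apply, sub_apply, smul_eq_mul, ContinuousLinearMap.comp_apply]
      have hg' : G (γ s) (u s) e₀ ≠ 0 := fun h => hg (by rw [h, mul_zero])
      field_simp
      ring

end ConeField

section ConeField

variable {E W : Type*} [NormedAddCommGroup E] [NormedSpace ℝ E]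
  [NormedAddCommGroup W] [NormedSpace ℝ W]
  {G : E → E →L[ℝ] E →L[ℝ] ℝ} {G' : E → E →L[ℝ] E →L[ℝ] E →L[ℝ] ℝ}
  {θ : E →L[ℝ] ℝ} {e₀ : E} {D : Set E} {L c α : ℝ}

/-- A `C^1` causal curve ending at `z'` can be perturbed, prescribing the perturbation at `z'`, to
a timelike curve whose starting point depends linearly on the spatial displacement `w`, up to an
error quadratic in `w`. -/
lemma IsConeField.exists_perturbed_step (hG : IsConeField G G' θ e₀ D L c α) (ι : W →L[ℝ] E)
    {l ρ : ℝ} (hl : 0 ≤ l) (hρ : 0 < ρ) :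
    ∃ A > 0, ∃ Λ > 0, ∃ C₀ > 0, ∃ σ₀ > 0, ∀ D' : Set E, (∀ z ∈ D', Metric.ball z ρ ⊆ D) →
      ∀ z z', IsCurveStep (ConeCausal G θ) D' z z' → ∀ q, θ z' ≤ q → q - θ z ≤ l →
      ∀ b₁ : W →L[ℝ] ℝ, ‖b₁‖ ≤ Real.exp (A * (q - θ z')) - 1 →
      ∃ b₀ : W →L[ℝ] ℝ, ‖b₀‖ ≤ Real.exp (A * (q - θ z)) - 1 ∧
        ∀ w σ, 0 < σ → σ ≤ σ₀ → C₀ * ‖w‖ ^ 2 ≤ σ →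
          IsCurveStep (ConeTimelike G θ) D (perturbedPoint θ e₀ ι Λ q b₀ w σ z)
            (perturbedPoint θ e₀ ι Λ q b₁ w σ z') := by
  have hL := hG.one_le
  have hc := hG.pos
  obtain ⟨A, hA⟩ : ∃ A, A = (L ^ 4 + 2 * L ^ 2 * ‖ι‖ + l * L ^ 3 * ‖ι‖) / (2 * c) := ⟨_, rfl⟩
  have hApos : 0 < A := by rw [hA]; positivity
  obtain ⟨B, hB⟩ : ∃ B, B = (A + 1) * Real.exp (2 * A * l) := ⟨_, rfl⟩
  have hB0 : 0 ≤ B := by rw [hB]; positivity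
  obtain ⟨Λ, hΛ, C₀, hC₀, κ₀, hκ₀, hpert⟩ := hG.exists_perturbation_constants ι hB0 hl hρ
  refine ⟨2 * A, by positivity, Λ, hΛ, C₀, hC₀, κ₀ * Real.exp (-(Λ * l)), by positivity, ?_⟩
  intro D' hD' z z' hstep q hq hql b₁ hb₁
  have hD'D : D' ⊆ D := fun x hx => hD' x hx (Metric.mem_ball_self hρ)
  obtain ⟨γ, γ', hγ'c, hγ, rfl, rfl, hP⟩ := hstep
  have hγc : ContinuousOn γ (Icc 0 1) := fun s hs => (hγ s hs).continuousWithinAt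
  have hφ : ∀ s ∈ Icc (0 : ℝ) 1, HasDerivWithinAt (fun s => θ (γ s)) (θ (γ' s)) (Icc 0 1) s :=
    fun s hs => θ.hasFDerivAt.comp_hasDerivWithinAt s (hγ s hs)
  have hmono : MonotoneOn (fun s => θ (γ s)) (Icc 0 1) := by
    refine monotoneOn_of_hasDerivWithinAt_nonneg (f' := fun s => θ (γ' s)) (convex_Icc 0 1)
      (fun s hs => (hφ s hs).continuousWithinAt) (fun s hs => ?_) (fun s hs => ?_)
    · exact (hφ s (interior_subset hs)).mono interior_subset
    · exact (hP s (interior_subset hs)).2.2.le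
  have hrange : ∀ s ∈ Icc (0 : ℝ) 1, 0 ≤ q - θ (γ s) ∧ q - θ (γ s) ≤ l := by
    intro s hs
    have h1 := hmono hs (right_mem_Icc.2 zero_le_one) hs.2
    have h2 := hmono (left_mem_Icc.2 zero_le_one) hs hs.1
    simp only at h1 h2
    constructor <;> linarith
  have habs : ∀ s ∈ Icc (0 : ℝ) 1, |q - θ (γ s)| ≤ l := fun s hs => by
    rw [abs_of_nonneg (hrange s hs).1]; exact (hrange s hs).2
  obtain ⟨a, d, ha, hd, had⟩ := hG.exists_slope ι hγc hγ'c
    (fun s hs => ⟨hD'D (hP s hs).1, (hP s hs).2⟩) habs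
  rw [← hA] at had
  obtain ⟨β, hβ, hβ1⟩ := exists_hasDerivWithinAt_linear ha hd b₁
  have hβn := norm_le_exp_of_hasDerivWithinAt hApos hβ hφ (fun s hs => (hP s hs).2.2)
    (fun s hs => (had s hs (β s)).1) (by rw [hβ1]; exact hb₁)
  refine ⟨β 0, hβn 0 (left_mem_Icc.2 zero_le_one), fun w σ hσ hσ₀ hwσ => ?_⟩
  have hβB : ∀ s ∈ Icc (0 : ℝ) 1, ‖β s‖ + 1 ≤ Real.exp (2 * A * l) := by
    intro s hs
    have h1 := hβn s hs
    have h2 : Real.exp (2 * A * (q - θ (γ s))) ≤ Real.exp (2 * A * l) := by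
      gcongr; exact (hrange s hs).2
    linarith
  have hβc : ContinuousOn β (Icc 0 1) := fun s hs => (hβ s hs).continuousWithinAt
  refine ⟨fun s => perturbedPoint θ e₀ ι Λ q (β s) w σ (γ s),
    fun s => γ' s + (((a s • β s + d s) w + Λ * θ (γ' s) *
      (σ * Real.exp (Λ * (q - θ (γ s))))) • e₀ - θ (γ' s) • ι w), ?_, ?_, rfl, ?_, ?_⟩
  · have h1 : ContinuousOn (fun s => θ (γ s)) (Icc 0 1) := θ.continuous.comp_continuousOn hγc
    have h2 : ContinuousOn (fun s => θ (γ' s)) (Icc 0 1) := θ.continuous.comp_continuousOn hγ'c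
    have h3 : ContinuousOn (fun s => (a s • β s + d s) w) (Icc 0 1) :=
      ((ha.smul hβc).add hd).clm_apply continuousOn_const
    have h4 : ContinuousOn (fun s => Real.exp (Λ * (q - θ (γ s)))) (Icc 0 1) :=
      Real.continuous_exp.comp_continuousOn (continuousOn_const.mul (continuousOn_const.sub h1))
    exact hγ'c.add (((h3.add ((continuousOn_const.mul h2).mul
      (continuousOn_const.mul h4))).smul continuousOn_const).sub (h2.smul continuousOn_const))
  · intro s hs
    have h1 : HasDerivWithinAt (fun s => β s w) ((a s • β s + d s) w) (Icc 0 1) s := by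
      simpa using (hβ s hs).clm_apply (hasDerivWithinAt_const s (Icc (0 : ℝ) 1) w)
    have h2 := ((((hφ s hs).const_sub q).const_mul Λ).exp).const_mul σ
    have h3 := ((h1.sub h2).smul_const e₀).add (((hφ s hs).const_sub q).smul_const (ι w))
    refine ((hγ s hs).add h3).congr_deriv ?_
    rw [neg_smul, ← sub_eq_add_neg]
    congr 3
    ring
  · simp only [hβ1]
  · intro s hs
    have hlam := (hP s hs).2.2
    obtain ⟨u, hu⟩ : ∃ u, u = (θ (γ' s))⁻¹ • γ' s := ⟨_, rfl⟩
    have hθu : θ u = 1 := by rw [hu, map_smul, smul_eq_mul, inv_mul_cancel₀ hlam.ne']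
    have hγu : γ' s = θ (γ' s) • u := by rw [hu, smul_smul, mul_inv_cancel₀ hlam.ne', one_smul]
    have huu : G (γ s) u u ≤ 0 := by
      have : G (γ s) u u = (θ (γ' s))⁻¹ ^ 2 * G (γ s) (γ' s) (γ' s) := by
        simp [hu]; ring
      rw [this]
      exact mul_nonpos_of_nonneg_of_nonpos (by positivity) (hP s hs).2.1
    obtain ⟨hslope, hlin⟩ := had s hs (β s)
    obtain ⟨κ, hκ⟩ : ∃ κ, κ = σ * Real.exp (Λ * (q - θ (γ s))) := ⟨_, rfl⟩
    have hσκ : σ ≤ κ := by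
      rw [hκ]
      have : 1 ≤ Real.exp (Λ * (q - θ (γ s))) := Real.one_le_exp (by
        have := (hrange s hs).1
        positivity)
      nlinarith only [this, hσ]
    have hκκ₀ : κ ≤ κ₀ := by
      rw [hκ]
      calc σ * Real.exp (Λ * (q - θ (γ s))) ≤ κ₀ * Real.exp (-(Λ * l)) * Real.exp (Λ * l) := by
            gcongr
            exact (hrange s hs).2
        _ = κ₀ := by rw [mul_assoc, ← Real.exp_add]; simp
    have hr : |(θ (γ' s))⁻¹ * (a s • β s + d s) w| ≤ B * ‖w‖ := by
      rw [abs_mul, abs_of_pos (inv_pos.2 hlam), inv_mul_le_iff₀ hlam]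
      have h1 := (a s • β s + d s).le_opNorm w
      rw [Real.norm_eq_abs] at h1
      have h2 : A * (‖β s‖ + 1) ≤ B := by
        rw [hB]
        have := hβB s hs
        have h3 := Real.exp_pos (2 * A * l)
        nlinarith only [mul_le_mul_of_nonneg_left this hApos.le, h3]
      have h3 := mul_le_mul_of_nonneg_left h2 hlam.le
      have h4 := mul_le_mul_of_nonneg_right (hslope.trans h3) (norm_nonneg w)
      linarith only [h1, h4]
    have hp : |β s w| ≤ B * ‖w‖ := by
      have h1 := (β s).le_opNorm w
      rw [Real.norm_eq_abs] at h1
      refine h1.trans (mul_le_mul_of_nonneg_right ?_ (norm_nonneg w))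
      rw [hB]
      have h2 := hβB s hs
      have h3 : 0 ≤ A * Real.exp (2 * A * l) := by positivity
      linarith only [h2, h3]
    rw [← hu] at hlin
    obtain ⟨hmem, htl⟩ := hpert (γ s) (hD' _ (hP s hs).1) u huu hθu w (β s w)
      ((θ (γ' s))⁻¹ * (a s • β s + d s) w) (q - θ (γ s)) κ (habs s hs) hp hr
      (hσ.trans_le hσκ) hκκ₀ (hwσ.trans hσκ) (hlin w)
    rw [hκ] at hmem htl
    refine ⟨hmem, ?_⟩
    have hvel : γ' s + (((a s • β s + d s) w + Λ * θ (γ' s) *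
        (σ * Real.exp (Λ * (q - θ (γ s))))) • e₀ - θ (γ' s) • ι w) =
        θ (γ' s) • (u + (((θ (γ' s))⁻¹ * (a s • β s + d s) w + Λ *
          (σ * Real.exp (Λ * (q - θ (γ s))))) • e₀ - ι w)) := by
      rw [smul_add, ← hγu, smul_sub, smul_smul, mul_add, mul_inv_cancel_left₀ hlam.ne']
      congr 4
      ring
    simp only [hvel]
    exact htl.smul hlam

/-- A causal chain from `z` to `q` can be perturbed to a timelike chain to a point just below `q`,
with starting points as in `IsConeField.exists_perturbed_step`. -/
lemma IsConeField.exists_perturbed_chain (hG : IsConeField G G' θ e₀ D L c α) (ι : W →L[ℝ] E)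
    {l ρ : ℝ} (hl : 0 ≤ l) (hρ : 0 < ρ) :
    ∃ K > 0, ∃ Λ > 0, ∃ C₀ > 0, ∃ σ₀ > 0, ∀ D' : Set E, (∀ z ∈ D', Metric.ball z ρ ⊆ D) →
      (∀ x ∈ D', ∀ y ∈ D', θ x - θ y ≤ l) → ∀ q ∈ D', ∀ z,
      Relation.ReflTransGen (IsCurveStep (ConeCausal G θ) D') z q →
      ∃ b : W →L[ℝ] ℝ, ‖b‖ ≤ K ∧ ∀ w σ, 0 < σ → σ ≤ σ₀ → C₀ * ‖w‖ ^ 2 ≤ σ →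
          Relation.ReflTransGen (IsCurveStep (ConeTimelike G θ) D)
            (perturbedPoint θ e₀ ι Λ (θ q) b w σ z) (q - σ • e₀) := by
  obtain ⟨A, hA, Λ, hΛ, C₀, hC₀, σ₀, hσ₀, hstep⟩ := hG.exists_perturbed_step ι hl hρ
  refine ⟨Real.exp (A * l), Real.exp_pos _, Λ, hΛ, C₀, hC₀, σ₀, hσ₀, ?_⟩
  intro D' hD' hlD' q hq z hz
  have hD'D : D' ⊆ D := fun x hx => hD' x hx (Metric.mem_ball_self hρ)
  suffices h : z ∈ D' ∧ θ z ≤ θ q ∧ ∃ b : W →L[ℝ] ℝ, ‖b‖ ≤ Real.exp (A * (θ q - θ z)) - 1 ∧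
      ∀ w σ, 0 < σ → σ ≤ σ₀ → C₀ * ‖w‖ ^ 2 ≤ σ →
          Relation.ReflTransGen (IsCurveStep (ConeTimelike G θ) D)
            (perturbedPoint θ e₀ ι Λ (θ q) b w σ z) (q - σ • e₀) by
    obtain ⟨hzD, -, b, hb, h⟩ := h
    refine ⟨b, hb.trans ?_, h⟩
    have : Real.exp (A * (θ q - θ z)) ≤ Real.exp (A * l) := by
      gcongr; exact hlD' q hq z hzD
    linarith
  induction hz using Relation.ReflTransGen.head_induction_on with
  | refl =>
    refine ⟨hq, le_rfl, 0, by simp, fun w σ _ _ _ => ?_⟩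
    have : perturbedPoint θ e₀ ι Λ (θ q) 0 w σ q = q - σ • e₀ := by
      simp [perturbedPoint, sub_eq_add_neg]
    rw [this]
  | @head x y h _ ih =>
    obtain ⟨-, hyq, b₁, hb₁, hchain⟩ := ih
    have hxD : x ∈ D' := by
      obtain ⟨γ, γ', -, -, rfl, -, hP⟩ := h
      exact (hP 0 (left_mem_Icc.2 zero_le_one)).1
    have hxy : θ x ≤ θ y := by
      have h1 := (norm_nonneg _).trans
        (hG.norm_sub_le_of_isCurveStep (h.mono (fun _ _ h => h) hD'D))
      have hL := hG.one_le
      nlinarith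
    obtain ⟨b₀, hb₀, hpert⟩ := hstep D' hD' x y h (θ q) hyq (hlD' q hq x hxD) b₁ hb₁
    exact ⟨hxD, hxy.trans hyq, b₀, hb₀, fun w σ h1 h2 h3 =>
      Relation.ReflTransGen.head (hpert w σ h1 h2 h3) (hchain w σ h1 h2 h3)⟩

end ConeField

/-! ### Causal chains in an achronal graph and supporting paraboloids -/

section ConeField

variable {E W : Type*} [NormedAddCommGroup E] [NormedSpace ℝ E]
  [NormedAddCommGroup W] [NormedSpace ℝ W]
  {G : E → E →L[ℝ] E →L[ℝ] ℝ} {G' : E → E →L[ℝ] E →L[ℝ] E →L[ℝ] ℝ}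
  {θ : E →L[ℝ] ℝ} {e₀ : E} {D : Set E} {L c α : ℝ}

lemma IsCurveStep.left_mem {P : E → E → Prop} {z z' : E} (h : IsCurveStep P D z z') : z ∈ D := by
  obtain ⟨γ, γ', -, -, rfl, -, hP⟩ := h
  exact (hP 0 (left_mem_Icc.2 zero_le_one)).1

lemma IsCurveStep.right_mem {P : E → E → Prop} {z z' : E} (h : IsCurveStep P D z z') :
    z' ∈ D := by
  obtain ⟨γ, γ', -, -, -, rfl, hP⟩ := h
  exact (hP 1 (right_mem_Icc.2 zero_le_one)).1

lemma IsConeField.norm_sub_le_of_chain (hG : IsConeField G G' θ e₀ D L c α) {z q : E}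
    (h : Relation.ReflTransGen (IsCurveStep (ConeCausal G θ) D) z q) :
    ‖q - z‖ ≤ L * (θ q - θ z) := by
  induction h with
  | refl => simp
  | @tail x y _ hxy ih =>
    have h1 := hG.norm_sub_le_of_isCurveStep hxy
    have h2 : y - z = (y - x) + (x - z) := by abel
    rw [h2]
    linarith [norm_add_le (y - x) (x - z)]

/-- A causal chain cannot leave a ball whose radius is proportional to the elapsed clock time. -/
lemma IsConeField.chain_inter_closedBall (hG : IsConeField G G' θ e₀ D L c α) {z q : E}
    (h : Relation.ReflTransGen (IsCurveStep (ConeCausal G θ) D) z q) :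
    Relation.ReflTransGen (IsCurveStep (ConeCausal G θ)
      (D ∩ Metric.closedBall z (L * (θ q - θ z)))) z q := by
  induction h with
  | refl => exact Relation.ReflTransGen.refl
  | @tail x y hzx hxy ih =>
    have h1 := (norm_nonneg _).trans (hG.norm_sub_le_of_isCurveStep hxy)
    have h0 := hG.norm_sub_le_of_chain hzx
    have hsub : D ∩ Metric.closedBall z (L * (θ x - θ z)) ⊆
        D ∩ Metric.closedBall z (L * (θ y - θ z)) :=
      inter_subset_inter_right _ (Metric.closedBall_subset_closedBall (by linarith))
    refine Relation.ReflTransGen.tail (Relation.ReflTransGen.mono (fun a b hab =>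
      hab.mono (fun _ _ h => h) hsub) _ _ ih) ?_
    · obtain ⟨γ, γ', hc, hγ, rfl, rfl, hP⟩ := hxy
      refine ⟨γ, γ', hc, hγ, rfl, rfl, fun s hs => ⟨⟨(hP s hs).1, ?_⟩, (hP s hs).2⟩⟩
      have h2 := hG.norm_sub_le_of_coneCausal hγ hP le_rfl hs.1 hs.2
      have h3 := (norm_nonneg _).trans (hG.norm_sub_le_of_coneCausal hγ hP hs.1 hs.2 le_rfl)
      rw [Metric.mem_closedBall, dist_eq_norm]
      have h4 : γ s - z = (γ s - γ 0) + (γ 0 - z) := by abel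
      rw [h4]
      linarith [norm_add_le (γ s - γ 0) (γ 0 - z)]

/-- In a cone field over a ball, let `H` be achronal, the graph of `h` near the center, and such
that every point of `H` is the starting point of a causal curve that reaches another point of `H`.
Then `h` has supporting paraboloids of uniform opening at all points near the center. -/
theorem IsConeField.exists_uniform_support [FiniteDimensional ℝ W] {z₀ : E} {R : ℝ}
    (hG : IsConeField G G' θ e₀ (Metric.ball z₀ R) L c α) (hR : 0 < R)
    {pr : E →L[ℝ] W} {ι : W →L[ℝ] E} (hpre : pr e₀ = 0) (hprι : ∀ w, pr (ι w) = w)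
    {H : Set E}
    (hach : ∀ p ∈ H ∩ Metric.ball z₀ R, ∀ q ∈ H ∩ Metric.ball z₀ R,
      ¬ Relation.TransGen (IsCurveStep (ConeTimelike G θ) (Metric.ball z₀ R)) p q)
    (hhor : ∀ p ∈ H ∩ Metric.ball z₀ R, ∀ V : Set E, IsOpen V → V ⊆ Metric.ball z₀ R → p ∈ V →
      ∃ q ∈ H, q ≠ p ∧ Relation.ReflTransGen (IsCurveStep (ConeCausal G θ) V) p q)
    {h : W → ℝ} {x₀ : W} {r R₁ : ℝ} (hr : 0 < r) (hR₁ : 16 * L ^ 2 * R₁ ≤ R)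
    (hcont : ContinuousOn h (Metric.ball x₀ r))
    (hgraph : ∀ x ∈ Metric.ball x₀ r, h x • e₀ + ι x ∈ H ∧ ‖h x • e₀ + ι x - z₀‖ ≤ R₁)
    (hgraph' : ∀ z ∈ H ∩ Metric.ball z₀ R, pr z ∈ Metric.ball x₀ r →
      z = h (pr z) • e₀ + ι (pr z)) :
    ∃ r₁ > 0, ∃ C K : ℝ, r₁ ≤ r ∧ ∀ x ∈ Metric.ball x₀ r₁, ∃ b : W →L[ℝ] ℝ, ‖b‖ ≤ K ∧
      ∀ y ∈ Metric.ball x₀ r₁, h x + b (y - x) - C * ‖y - x‖ ^ 2 ≤ h y := by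
  have hL := hG.one_le
  have hL0 : 0 < L := by linarith
  have hα := hG.width_pos
  obtain ⟨D, hD⟩ : ∃ D, D = Metric.ball z₀ R := ⟨_, rfl⟩
  obtain ⟨D', hD'⟩ : ∃ D', D' = Metric.ball z₀ (R / 2) := ⟨_, rfl⟩
  rw [← hD] at hG hach hhor hgraph'
  have hmemD : ∀ z, ‖z - z₀‖ < R → z ∈ D := fun z hz => by
    rw [hD, Metric.mem_ball, dist_eq_norm]; exact hz
  have hconv : Convex ℝ D := by rw [hD]; exact convex_ball _ _
  have hD'ball : ∀ z ∈ D', Metric.ball z (R / 2) ⊆ D := by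
    intro z hz y hy
    rw [hD', Metric.mem_ball] at hz
    rw [Metric.mem_ball] at hy
    rw [hD, Metric.mem_ball]
    linarith [dist_triangle y z z₀]
  have hθabs : ∀ v, |θ v| ≤ L * ‖v‖ := fun v => by
    rw [← Real.norm_eq_abs]
    exact (θ.le_opNorm v).trans (mul_le_mul_of_nonneg_right hG.norm_functional_le (norm_nonneg v))
  have hlD' : ∀ x ∈ D', ∀ y ∈ D', θ x - θ y ≤ L * R := by
    intro x hx y hy
    rw [hD', Metric.mem_ball] at hx hy
    have h1 : ‖x - y‖ ≤ R := by
      rw [← dist_eq_norm]; linarith [dist_triangle_right x y z₀]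
    rw [← map_sub]
    exact (le_abs_self _).trans ((hθabs _).trans (by gcongr))
  obtain ⟨Kb, hKb, Λ, hΛ, C₀, hC₀, σ₀, hσ₀, hpert⟩ := hG.exists_perturbed_chain ι
    (l := L * R) (ρ := R / 2) (by positivity) (by positivity)
  replace hpert := hpert D' hD'ball hlD'
  obtain ⟨σ₁, hσ₁, hσ₁₀, hσ₁R⟩ : ∃ σ₁ > 0, σ₁ ≤ σ₀ ∧ σ₁ * (16 * L ^ 3) ≤ R := by
    refine ⟨min σ₀ (R / (16 * L ^ 3)), by positivity, min_le_left _ _, ?_⟩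
    rw [← le_div_iff₀ (by positivity)]
    exact min_le_right _ _
  obtain ⟨M, hM⟩ : ∃ M, M = Real.exp (Λ * (L * R)) := ⟨_, rfl⟩
  have hM0 : 0 < M := by rw [hM]; exact Real.exp_pos _
  have hR₁R : 0 ≤ R₁ ∧ R₁ ≤ R / 16 := by
    have h1 := (norm_nonneg _).trans (hgraph x₀ (Metric.mem_ball_self hr)).2
    refine ⟨h1, ?_⟩
    nlinarith only [mul_le_mul_of_nonneg_right (one_le_pow₀ hL (n := 2)) h1, hR₁]
  -- points just below points of the graph, and causal chains between them, stay in `D'`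
  have hbelow : ∀ p, ‖p - z₀‖ ≤ R₁ → ∀ η, 0 ≤ η → η * (16 * L ^ 3) ≤ R →
      ‖p - η • e₀ - z₀‖ ≤ R / 4 := by
    intro p hp η hη hηR
    have h1 : p - η • e₀ - z₀ = (p - z₀) - η • e₀ := by abel
    have h2 : ‖η • e₀‖ ≤ η * L := by
      rw [norm_smul, Real.norm_of_nonneg hη]
      exact mul_le_mul_of_nonneg_left hG.norm_vector_le hη
    have h3 : η * L ≤ η * L ^ 3 :=
      mul_le_mul_of_nonneg_left (le_self_pow₀ hL (by norm_num)) hη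
    rw [h1]
    linarith [norm_sub_le (p - z₀) (η • e₀), hR₁R.2]
  have hloc : ∀ p q, ‖p - z₀‖ ≤ R₁ → ‖q - z₀‖ ≤ R₁ → ∀ η, 0 ≤ η → η * (16 * L ^ 3) ≤ R →
      Relation.ReflTransGen (IsCurveStep (ConeCausal G θ) D) (p - η • e₀) q →
      Relation.ReflTransGen (IsCurveStep (ConeCausal G θ) D') (p - η • e₀) q := by
    intro p q hp hq η hη hηR hpq
    refine Relation.ReflTransGen.mono (fun a b hab => hab.mono (fun _ _ h => h) ?_) _ _
      (hG.chain_inter_closedBall hpq)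
    rintro z ⟨-, hz⟩
    rw [Metric.mem_closedBall, dist_eq_norm] at hz
    rw [hD', Metric.mem_ball, dist_eq_norm]
    have h1 := hbelow p hp η hη hηR
    have h2 : θ q - θ (p - η • e₀) ≤ L * (2 * R₁ + η * L) := by
      rw [← map_sub]
      refine (le_abs_self _).trans ((hθabs _).trans (mul_le_mul_of_nonneg_left ?_ hL0.le))
      have e : q - (p - η • e₀) = (q - z₀) - (p - z₀) + η • e₀ := by abel
      have h3 : ‖η • e₀‖ ≤ η * L := by
        rw [norm_smul, Real.norm_of_nonneg hη]
        exact mul_le_mul_of_nonneg_left hG.norm_vector_le hη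
      rw [e]
      linarith [norm_add_le ((q - z₀) - (p - z₀)) (η • e₀), norm_sub_le (q - z₀) (p - z₀)]
    have h3 : L * (θ q - θ (p - η • e₀)) ≤ 2 * (L ^ 2 * R₁) + η * L ^ 3 := by
      have := mul_le_mul_of_nonneg_left h2 hL0.le
      linarith only [this]
    have h5 : ‖p - η • e₀ - z₀‖ ≤ R₁ + η * L := by
      have h1 : p - η • e₀ - z₀ = (p - z₀) - η • e₀ := by abel
      have h2 : ‖η • e₀‖ ≤ η * L := by
        rw [norm_smul, Real.norm_of_nonneg hη]
        exact mul_le_mul_of_nonneg_left hG.norm_vector_le hη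
      rw [h1]
      linarith [norm_sub_le (p - z₀) (η • e₀)]
    have h6 : η * L ≤ η * L ^ 3 :=
      mul_le_mul_of_nonneg_left (le_self_pow₀ hL (by norm_num)) hη
    have e : z - z₀ = (z - (p - η • e₀)) + (p - η • e₀ - z₀) := by abel
    rw [e]
    linarith [norm_add_le (z - (p - η • e₀)) (p - η • e₀ - z₀), hR₁R.2]
  have hvert : ∀ z, ∀ t : ℝ, t > 0 → z ∈ D → z + t • e₀ ∈ D →
      IsCurveStep (ConeTimelike G θ) D z (z + t • e₀) := by
    intro z t ht hz hz'
    have := hG.isCurveStep_segment subset_rfl hconv (v := 0) (t := t) ht (by simpa using hα.le) hz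
      (by simpa using hz')
    simpa using this
  -- `q` can be reached from points arbitrarily close below `p`
  let reach : E → E → Prop := fun p q => ∀ ε : ℝ, ε > 0 → ∃ η : ℝ, 0 < η ∧ η < ε ∧
    Relation.ReflTransGen (IsCurveStep (ConeCausal G θ) D) (p - η • e₀) q
  obtain ⟨gp, hgp⟩ : ∃ gp : W → E, gp = fun x => h x • e₀ + ι x := ⟨_, rfl⟩
  have hprgp : ∀ x, pr (gp x) = x := fun x => by simp [hgp, hpre, hprι]
  obtain ⟨K, hK⟩ : ∃ K, K = gp '' Metric.closedBall x₀ (r / 2) := ⟨_, rfl⟩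
  have hballs : Metric.closedBall x₀ (r / 2) ⊆ Metric.ball x₀ r :=
    Metric.closedBall_subset_ball (by linarith)
  have hKcomp : IsCompact K := by
    have : ContinuousOn gp (Metric.closedBall x₀ (r / 2)) := by
      rw [hgp]
      exact ((hcont.mono hballs).smul continuousOn_const).add ι.continuous.continuousOn
    rw [hK]
    exact (isCompact_closedBall _ _).image_of_continuousOn this
  have hKH : ∀ p ∈ K, p ∈ H ∧ ‖p - z₀‖ ≤ R₁ := by
    intro p hp
    rw [hK] at hp
    obtain ⟨x, hx, rfl⟩ := hp
    rw [hgp]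
    exact hgraph x (hballs hx)
  have hKD : ∀ p ∈ K, p ∈ D := fun p hp => hmemD p (by linarith [(hKH p hp).2, hR₁R.2])
  obtain ⟨δ, hδ⟩ : ∃ δ, δ = r / (8 * (‖pr‖ + 1) * L) := ⟨_, rfl⟩
  have hδ0 : 0 < δ := by rw [hδ]; have := norm_nonneg pr; positivity
  -- every point of the graph near the center reaches a point at a uniform distance
  have hreach : ∀ x ∈ Metric.ball x₀ (r / 4), ∃ q ∈ K, reach (gp x) q ∧
      2 * δ * L ≤ ‖q - gp x‖ := by
    intro x hx
    rw [Metric.mem_ball] at hx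
    obtain ⟨p, hp⟩ : ∃ p, p = gp x := ⟨_, rfl⟩
    rw [← hp]
    have hpK : p ∈ K := by
      rw [hK, hp]
      exact mem_image_of_mem _ (Metric.mem_closedBall.2 (by linarith))
    have hpR := (hKH p hpK).2
    have hQcl : IsClosed {q | q ∈ K ∧ reach p q} := by
      refine isClosed_of_closure_subset fun q hq => ?_
      have hqK : q ∈ K := by
        have := closure_mono (fun q hq => hq.1 : {q | q ∈ K ∧ reach p q} ⊆ K) hq
        rwa [hKcomp.isClosed.closure_eq] at this
      refine ⟨hqK, fun ε hε => ?_⟩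
      obtain ⟨σ, hσ, hσ1, hσ2, hσ3⟩ : ∃ σ > 0, σ ≤ σ₀ ∧ σ * M < ε / 2 ∧
          σ * (16 * L ^ 3) ≤ R := by
        refine ⟨min σ₀ (min (ε / (4 * M)) (R / (16 * L ^ 3))), by positivity, min_le_left _ _,
          ?_, ?_⟩
        · have := (min_le_right σ₀ (min (ε / (4 * M)) (R / (16 * L ^ 3)))).trans (min_le_left _ _)
          rw [le_div_iff₀ (by positivity)] at this
          linarith
        · have := (min_le_right σ₀ (min (ε / (4 * M)) (R / (16 * L ^ 3)))).trans (min_le_right _ _)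
          rwa [le_div_iff₀ (by positivity)] at this
      obtain ⟨q', ⟨hq'K, hq'⟩, hqq'⟩ := Metric.mem_closure_iff.1 hq (α * σ) (by positivity)
      obtain ⟨η, hη, hηε, hchain⟩ := hq' (min (ε / 2) (R / (16 * L ^ 3))) (by positivity)
      have hηR : η * (16 * L ^ 3) ≤ R := by
        have := hηε.le.trans (min_le_right _ _)
        rwa [le_div_iff₀ (by positivity)] at this
      have hchain' := hloc p q' hpR (hKH q' hq'K).2 η hη.le hηR hchain
      have hq'D' : q' ∈ D' := by
        rw [hD', Metric.mem_ball, dist_eq_norm]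
        linarith [(hKH q' hq'K).2, hR₁R.2]
      -- push a chain to a nearby `q'` down, and join its end below `q'` to `q` by a segment
      obtain ⟨b, -, hb⟩ := hpert q' hq'D' _ hchain'
      have hshift := hb 0 σ hσ hσ1 (by simpa using hσ.le)
      have hpD' : p - η • e₀ ∈ D' := by
        rw [hD', Metric.mem_ball, dist_eq_norm]
        linarith [hbelow p hpR η hη.le hηR]
      have hexp : Real.exp (Λ * (θ q' - θ (p - η • e₀))) ≤ M := by
        rw [hM]
        gcongr
        exact hlD' _ hq'D' _ hpD'
      have hpt : perturbedPoint θ e₀ ι Λ (θ q') b 0 σ (p - η • e₀) =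
          p - (η + σ * Real.exp (Λ * (θ q' - θ (p - η • e₀)))) • e₀ := by
        simp only [perturbedPoint, map_zero, zero_sub, smul_zero, add_zero, neg_smul, add_smul]
        abel
      rw [hpt] at hshift
      refine ⟨_, by positivity, ?_, (Relation.ReflTransGen.mono (fun a b hab =>
        hab.mono (fun _ _ h => h.coneCausal) subset_rfl) _ _ hshift).tail ?_⟩
      · have h1 := hηε.trans_le (min_le_left _ _)
        have h2 := mul_le_mul_of_nonneg_left hexp hσ.le
        linarith
      · have h1 : q = q' - σ • e₀ + σ • (e₀ + σ⁻¹ • (q - q')) := by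
          rw [smul_add, smul_inv_smul₀ hσ.ne']; abel
        have h2 : ‖σ⁻¹ • (q - q')‖ ≤ α := by
          rw [norm_smul, norm_inv, Real.norm_of_nonneg hσ.le, inv_mul_le_iff₀ hσ, ← dist_eq_norm]
          linarith
        have h3 := hG.isCurveStep_segment subset_rfl hconv (z := q' - σ • e₀) hσ h2
          (hmemD _ (by linarith [hbelow q' (hKH q' hq'K).2 σ hσ.le hσ3]))
          (by rw [← h1]; exact hKD q hqK)
        rw [← h1] at h3
        exact h3.mono (fun _ _ h => h.coneCausal) subset_rfl
    have hQcomp : IsCompact {q | q ∈ K ∧ reach p q} :=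
      hKcomp.of_isClosed_subset hQcl fun q hq => hq.1
    have hQne : {q | q ∈ K ∧ reach p q}.Nonempty := by
      refine ⟨p, hpK, fun ε hε => ⟨min (ε / 2) (R / (16 * L ^ 3)), by positivity,
        (min_le_left _ _).trans_lt (by linarith), Relation.ReflTransGen.single ?_⟩⟩
      have h1 := min_le_right (ε / 2) (R / (16 * L ^ 3))
      rw [le_div_iff₀ (by positivity)] at h1
      have h2 := hvert (p - (min (ε / 2) (R / (16 * L ^ 3))) • e₀)
        (min (ε / 2) (R / (16 * L ^ 3))) (by positivity)
        (hmemD _ (by linarith [hbelow p hpR _ (by positivity) h1]))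
        (by rw [sub_add_cancel]; exact hKD p hpK)
      rw [sub_add_cancel] at h2
      exact h2.mono (fun _ _ h => h.coneCausal) subset_rfl
    obtain ⟨q, ⟨hqK, hpq⟩, hmax⟩ := hQcomp.exists_isMaxOn hQne θ.continuous.continuousOn
    refine ⟨q, hqK, hpq, ?_⟩
    -- `q` lies outside a smaller cylinder, because otherwise the horizon condition would extend
    -- the chain beyond the maximum of the clock
    have hout : r / 2 ≤ dist (pr q) x₀ := by
      by_contra! hlt
      obtain ⟨q', hq'H, hne, hchain⟩ := hhor q ⟨(hKH q hqK).1, hKD q hqK⟩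
        (D ∩ pr ⁻¹' Metric.ball x₀ (r / 2))
        ((by rw [hD]; exact Metric.isOpen_ball : IsOpen D).inter
          (Metric.isOpen_ball.preimage pr.continuous)) inter_subset_left ⟨hKD q hqK, hlt⟩
      have hq'mem : q' ∈ D ∩ pr ⁻¹' Metric.ball x₀ (r / 2) := by
        rcases Relation.ReflTransGen.cases_tail hchain with h | ⟨_, -, h⟩
        · exact absurd h hne
        · exact h.right_mem
      have hq'K : q' ∈ K := by
        rw [hK, hgraph' q' ⟨hq'H, hq'mem.1⟩ (Metric.ball_subset_ball (by linarith) hq'mem.2)]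
        rw [hgp]
        exact ⟨pr q', Metric.ball_subset_closedBall hq'mem.2, rfl⟩
      have hchainD : Relation.ReflTransGen (IsCurveStep (ConeCausal G θ) D) q q' :=
        Relation.ReflTransGen.mono (fun a b hab => hab.mono (fun _ _ h => h) inter_subset_left)
          _ _ hchain
      have h1 : θ q' ≤ θ q := hmax ⟨hq'K, fun ε hε => by
        obtain ⟨η, h1, h2, h3⟩ := hpq ε hε
        exact ⟨η, h1, h2, h3.trans hchainD⟩⟩
      have h2 := hG.norm_sub_le_of_chain hchainD
      have h3 : 0 < ‖q' - q‖ := norm_pos_iff.2 (sub_ne_zero.2 hne)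
      nlinarith
    have h1 : dist (pr q) x ≤ ‖pr‖ * ‖q - p‖ := by
      rw [dist_eq_norm, ← hprgp x, ← hp, ← map_sub]
      exact pr.le_opNorm _
    have h2 : r / 4 ≤ (‖pr‖ + 1) * ‖q - p‖ := by
      linarith [dist_triangle (pr q) x x₀, norm_nonneg (q - p)]
    have h3 : 2 * δ * L = r / 4 / (‖pr‖ + 1) := by
      have := norm_nonneg pr
      rw [hδ]; field_simp; ring
    rw [h3, div_le_iff₀ (by have := norm_nonneg pr; positivity)]
    linarith
  -- the radius is such that the displacements stay in the range of the perturbation lemma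
  obtain ⟨r₁, hr₁, hr₁r, hr₁σ⟩ : ∃ r₁ > 0, r₁ ≤ r / 4 ∧ C₀ * (2 * r₁ / δ) ^ 2 ≤ σ₁ / 2 := by
    refine ⟨min (r / 4) (δ * Real.sqrt (σ₁ / (2 * C₀)) / 2), by positivity, min_le_left _ _, ?_⟩
    have h1 : 2 * min (r / 4) (δ * Real.sqrt (σ₁ / (2 * C₀)) / 2) / δ ≤
        Real.sqrt (σ₁ / (2 * C₀)) := by
      rw [div_le_iff₀ hδ0]
      linarith [min_le_right (r / 4) (δ * Real.sqrt (σ₁ / (2 * C₀)) / 2)]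
    have h2 := pow_le_pow_left₀ (by positivity) h1 2
    rw [Real.sq_sqrt (by positivity)] at h2
    calc _ ≤ C₀ * (σ₁ / (2 * C₀)) := mul_le_mul_of_nonneg_left h2 hC₀.le
      _ = σ₁ / 2 := by field_simp
  refine ⟨r₁, hr₁, C₀ * M / δ ^ 2, Kb / δ, by linarith, fun x hx => ?_⟩
  have hx4 : x ∈ Metric.ball x₀ (r / 4) := Metric.ball_subset_ball hr₁r hx
  obtain ⟨q, hqK, hpq, hqp⟩ := hreach x hx4
  obtain ⟨p, hp⟩ : ∃ p, p = gp x := ⟨_, rfl⟩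
  rw [← hp] at hpq hqp
  have hpK : p ∈ K := by
    rw [hK, hp]
    refine mem_image_of_mem _ (Metric.ball_subset_closedBall
      (Metric.ball_subset_ball (by linarith) hx4))
  -- a support up to an arbitrarily small error
  have happrox : ∀ ε > 0, ∃ b : W →L[ℝ] ℝ, ‖b‖ ≤ Kb / δ ∧ ∀ y ∈ Metric.ball x₀ r₁,
      h x + b (y - x) - C₀ * M / δ ^ 2 * ‖y - x‖ ^ 2 - ε * (1 + M) ≤ h y := by
    intro ε hε
    obtain ⟨η, hη, hηε, hchain⟩ := hpq
      (min ε (min (R / (16 * L ^ 3)) (min (σ₁ / 2) δ))) (by positivity)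
    have hηε' : η ≤ ε := hηε.le.trans (min_le_left _ _)
    have hηR : η * (16 * L ^ 3) ≤ R := by
      have := hηε.le.trans ((min_le_right _ _).trans (min_le_left _ _))
      rwa [le_div_iff₀ (by positivity)] at this
    have hησ : η ≤ σ₁ / 2 :=
      hηε.le.trans ((min_le_right _ _).trans ((min_le_right _ _).trans (min_le_left _ _)))
    have hηδ : η ≤ δ :=
      hηε.le.trans ((min_le_right _ _).trans ((min_le_right _ _).trans (min_le_right _ _)))
    have hpR := (hKH p hpK).2
    have hqR := (hKH q hqK).2
    have hqD' : q ∈ D' := by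
      rw [hD', Metric.mem_ball, dist_eq_norm]
      linarith [hR₁R.2]
    have hpD' : p - η • e₀ ∈ D' := by
      rw [hD', Metric.mem_ball, dist_eq_norm]
      linarith [hbelow p hpR η hη.le hηR]
    obtain ⟨len, hlen⟩ : ∃ len, len = θ q - θ (p - η • e₀) := ⟨_, rfl⟩
    have hlenδ : δ ≤ len := by
      have h1 := hG.norm_sub_le_of_chain hchain
      rw [← hlen] at h1
      have h2 : ‖q - p‖ ≤ ‖q - (p - η • e₀)‖ + η * L := by
        have e : q - p = q - (p - η • e₀) - η • e₀ := by abel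
        have h3 : ‖η • e₀‖ ≤ η * L := by
          rw [norm_smul, Real.norm_of_nonneg hη.le]
          exact mul_le_mul_of_nonneg_left hG.norm_vector_le hη.le
        rw [e]
        exact (norm_sub_le _ _).trans (by linarith)
      have h3 := mul_le_mul_of_nonneg_right hηδ hL0.le
      have h4 : L * δ ≤ L * len := by linarith
      exact le_of_mul_le_mul_left h4 hL0
    have hlen0 : 0 < len := hδ0.trans_le hlenδ
    obtain ⟨b, hbK, hb⟩ := hpert q hqD' _ (hloc p q hpR hqR η hη.le hηR hchain)
    refine ⟨len⁻¹ • b, ?_, fun y hy => ?_⟩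
    · rw [norm_smul, norm_inv, Real.norm_of_nonneg hlen0.le, ← div_eq_inv_mul]
      gcongr
    obtain ⟨w, hw⟩ : ∃ w, w = len⁻¹ • (y - x) := ⟨_, rfl⟩
    have hwn : ‖w‖ ≤ ‖y - x‖ / δ := by
      rw [hw, norm_smul, norm_inv, Real.norm_of_nonneg hlen0.le, ← div_eq_inv_mul]
      gcongr
    have hyx : ‖y - x‖ ≤ 2 * r₁ := by
      rw [← dist_eq_norm]
      rw [Metric.mem_ball] at hx hy
      linarith [dist_triangle_right y x x₀]
    obtain ⟨σ, hσ⟩ : ∃ σ, σ = C₀ * ‖w‖ ^ 2 + η := ⟨_, rfl⟩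
    have hσ0 : 0 < σ := by rw [hσ]; positivity
    have hσσ₁ : σ ≤ σ₁ := by
      have h1 : ‖w‖ ^ 2 ≤ (2 * r₁ / δ) ^ 2 :=
        pow_le_pow_left₀ (norm_nonneg w) (hwn.trans (by gcongr)) 2
      have h2 := mul_le_mul_of_nonneg_left h1 hC₀.le
      rw [hσ]
      linarith
    have htl := hb w σ hσ0 (hσσ₁.trans hσ₁₀) (by rw [hσ]; linarith)
    obtain ⟨S, hS⟩ : ∃ S, S = h x - η + (b w - σ * Real.exp (Λ * len)) := ⟨_, rfl⟩
    have hpt : perturbedPoint θ e₀ ι Λ (θ q) b w σ (p - η • e₀) = S • e₀ + ι y := by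
      simp only [perturbedPoint]
      rw [← hlen, hw, ← map_smul, smul_inv_smul₀ hlen0.ne', map_sub, hp, hgp, ← hw, hS]
      simp only [add_smul, sub_smul]
      abel
    rw [hpt] at htl
    have hqD : q ∈ D := hKD q hqK
    have htl' : Relation.TransGen (IsCurveStep (ConeTimelike G θ) D) (S • e₀ + ι y) q := by
      have h1 := hvert (q - σ • e₀) σ hσ0 (hmemD _ (by
        linarith [hbelow q hqR σ hσ0.le ((mul_le_mul_of_nonneg_right hσσ₁
          (by positivity)).trans hσ₁R)])) (by rw [sub_add_cancel]; exact hqD)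
      rw [sub_add_cancel] at h1
      exact Relation.TransGen.tail' htl h1
    -- a point strictly above the graph could not be joined to `q`, by achronality
    have hSle : S ≤ h y := by
      by_contra! hlt
      have hyr : y ∈ Metric.ball x₀ r := Metric.ball_subset_ball (by linarith) hy
      have hyH := hgraph y hyr
      have hyD : h y • e₀ + ι y ∈ D := hmemD _ (by linarith [hR₁R.2])
      have hSD : S • e₀ + ι y ∈ D := by
        rcases Relation.TransGen.head'_iff.1 htl' with ⟨_, h, -⟩
        exact h.left_mem
      have e : h y • e₀ + ι y + (S - h y) • e₀ = S • e₀ + ι y := by rw [sub_smul]; abel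
      have hst := hvert (h y • e₀ + ι y) (S - h y) (by linarith) hyD (by rw [e]; exact hSD)
      rw [e] at hst
      exact hach _ ⟨hyH.1, hyD⟩ q ⟨(hKH q hqK).1, hqD⟩ (Relation.TransGen.head hst htl')
    have hbw : (len⁻¹ • b) (y - x) = b w := by rw [hw]; simp
    have hexp : Real.exp (Λ * len) ≤ M := by
      rw [hM, hlen]
      gcongr
      exact hlD' _ hqD' _ hpD'
    have h1 : σ * Real.exp (Λ * len) ≤ C₀ * M / δ ^ 2 * ‖y - x‖ ^ 2 + η * M := by
      have h2 : C₀ * ‖w‖ ^ 2 ≤ C₀ * (‖y - x‖ / δ) ^ 2 := by gcongr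
      have h3 : C₀ * M / δ ^ 2 * ‖y - x‖ ^ 2 = C₀ * (‖y - x‖ / δ) ^ 2 * M := by
        rw [div_pow]; ring
      rw [h3, ← add_mul]
      exact mul_le_mul (by linarith) hexp (Real.exp_pos _).le (by positivity)
    have h2 := mul_le_mul_of_nonneg_right hηε' hM0.le
    rw [hbw]
    linarith
  -- the slopes of the approximate supports are bounded, so they have a limit
  choose b hbK hb using fun k : ℕ => happrox (1 / ((k : ℝ) + 1)) (by positivity)
  obtain ⟨b', hb', φ, hφ, hlim⟩ := (isCompact_closedBall (0 : W →L[ℝ] ℝ) (Kb / δ)).tendsto_subseq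
    (x := b) fun k => by simpa using hbK k
  refine ⟨b', by simpa using hb', fun y hy => ?_⟩
  have h1 : Filter.Tendsto (fun k => h x + b (φ k) (y - x) - C₀ * M / δ ^ 2 * ‖y - x‖ ^ 2 -
      1 / ((φ k : ℝ) + 1) * (1 + M)) Filter.atTop
      (𝓝 (h x + b' (y - x) - C₀ * M / δ ^ 2 * ‖y - x‖ ^ 2 - 0 * (1 + M))) := by
    refine Filter.Tendsto.sub ((Filter.Tendsto.const_add _ ?_).sub_const _)
      (Filter.Tendsto.mul_const _ ?_)
    · exact ((ContinuousLinearMap.apply ℝ ℝ (y - x)).continuous.tendsto b').comp hlim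
    · exact tendsto_one_div_add_atTop_nhds_zero_nat.comp hφ.tendsto_atTop
  rw [zero_mul, sub_zero] at h1
  exact le_of_tendsto h1 (Filter.Eventually.of_forall fun k => hb (φ k) y hy)

end ConeField

/-! ### The cone field of a Lorentzian metric near a point -/

section Lorentz

variable {E : Type*} [NormedAddCommGroup E] [NormedSpace ℝ E]

lemma IsConeField.mono {G : E → E →L[ℝ] E →L[ℝ] ℝ} {G' : E → E →L[ℝ] E →L[ℝ] E →L[ℝ] ℝ}
    {θ : E →L[ℝ] ℝ} {e₀ : E} {D D' : Set E} {L c α : ℝ}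
    (hG : IsConeField G G' θ e₀ D L c α) (h : D' ⊆ D) : IsConeField G G' θ e₀ D' L c α where
  symm z hz := hG.symm z (h hz)
  continuousOn := hG.continuousOn.mono h
  continuousOn' := hG.continuousOn'.mono h
  norm_le z hz := hG.norm_le z (h hz)
  norm_le' z hz := hG.norm_le' z (h hz)
  taylor z hz w hw := hG.taylor z (h hz) w (h hw)
  norm_functional_le := hG.norm_functional_le
  norm_vector_le := hG.norm_vector_le
  one_le := hG.one_le
  pos := hG.pos
  cone z hz := hG.cone z (h hz)
  width_pos := hG.width_pos
  wide z hz := hG.wide z (h hz)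

/-- For a Lorentzian form the orthogonal complement of every timelike vector is positive, not only
that of the one vector in the definition of the signature. -/
lemma pos_of_orthogonal_of_neg {B : E →L[ℝ] E →L[ℝ] ℝ} (hB : ∀ u v, B u v = B v u)
    (hlor : ∃ v, B v v < 0 ∧ ∀ w, B v w = 0 → w ≠ 0 → 0 < B w w) {T w : E} (hT : B T T < 0)
    (hTw : B T w = 0) (hw : w ≠ 0) : 0 < B w w := by
  obtain ⟨v, hv, hpos⟩ := hlor
  have hdec : ∀ x, ∃ a s, x = a • v + s ∧ B v s = 0 := fun x =>
    ⟨B v x / B v v, x - (B v x / B v v) • v, by abel, by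
      simp only [map_sub, map_smul, smul_eq_mul]; field_simp [hv.ne]; ring⟩
  have hnn : ∀ t, B v t = 0 → 0 ≤ B t t := fun t ht => by
    rcases eq_or_ne t 0 with rfl | h
    · simp
    · exact (hpos t ht h).le
  obtain ⟨a, s, rfl, hs⟩ := hdec T
  obtain ⟨b, t, rfl, ht⟩ := hdec w
  have hs' : B s v = 0 := by rw [hB, hs]
  have ht' : B t v = 0 := by rw [hB, ht]
  simp only [map_add, map_smul, add_apply, smul_apply, smul_eq_mul, hs, ht, hs', ht', mul_zero,
    add_zero, zero_add] at hT hTw ⊢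
  have hss := hnn s hs
  have hcs : 0 ≤ B t t * (B t t * B s s - B s t ^ 2) := by
    have h := hnn (B t t • s - B s t • t) (by simp [hs, ht])
    simp only [map_sub, map_smul, sub_apply, smul_apply, smul_eq_mul, hB t s] at h
    linarith only [h]
  have ha : a ≠ 0 := by
    rintro rfl
    linarith
  rcases eq_or_ne t 0 with rfl | ht0
  · have hb : b = 0 := by
      have : a * (b * B v v) = 0 := by simp at hTw; simp; tauto
      rcases mul_eq_zero.1 this with h | h
      · exact absurd h ha
      · exact (mul_eq_zero.1 h).resolve_right hv.ne
    simp [hb] at hw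
  · have htt := hpos t ht ht0
    have h1 : 0 ≤ B t t * B s s - B s t ^ 2 := nonneg_of_mul_nonneg_right hcs htt
    have h2 : B s t = -(a * (b * B v v)) := by linarith
    rw [h2] at h1
    have h3 : B t t * B s s < B t t * (-(a * (a * B v v))) :=
      mul_lt_mul_of_pos_left (by linarith) htt
    have h4 : 0 < (a ^ 2 * (-B v v)) * (b * (b * B v v) + B t t) := by nlinarith only [h1, h3]
    exact (mul_pos_iff_of_pos_left (mul_pos (by positivity) (by linarith))).1 h4

/-- A Lorentzian form becomes positive definite when a multiple of the square of the functional
`B T`, with `T` timelike, is added to it. -/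
lemma exists_coercive_add_sq [FiniteDimensional ℝ E] {B : E →L[ℝ] E →L[ℝ] ℝ}
    (hB : ∀ u v, B u v = B v u)
    (hlor : ∃ v, B v v < 0 ∧ ∀ w, B v w = 0 → w ≠ 0 → 0 < B w w) {T : E} (hT : B T T < 0) :
    ∃ m > 0, ∃ k > 0, ∀ u, m * ‖u‖ ^ 2 ≤ B u u + k * B u T ^ 2 := by
  have hk : 0 < 2 / (-B T T) := div_pos two_pos (by linarith)
  have hpd : ∀ u, u ≠ 0 → 0 < B u u + 2 / (-B T T) * B u T ^ 2 := by
    intro u hu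
    obtain ⟨a, ha⟩ : ∃ a, a = B u T / B T T := ⟨_, rfl⟩
    obtain ⟨w, hw⟩ : ∃ w, w = u - a • T := ⟨_, rfl⟩
    have hu' : u = a • T + w := by rw [hw]; abel
    have hTw : B T w = 0 := by
      rw [hw, map_sub, map_smul, hB T u, ha, smul_eq_mul, div_mul_cancel₀ _ hT.ne, sub_self]
    have hwT : B w T = 0 := by rw [hB, hTw]
    have h1 : B u T = a * B T T := by rw [ha, div_mul_cancel₀ _ hT.ne]
    have h2 : B u u = a ^ 2 * B T T + B w w := by
      rw [hu']
      simp only [map_add, map_smul, add_apply, smul_apply, smul_eq_mul, hTw, hwT]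
      ring
    have h3 : 2 / (-B T T) * (a * B T T) ^ 2 = -(2 * (a ^ 2 * B T T)) := by
      field_simp [hT.ne]
    rw [h1, h2, h3]
    rcases eq_or_ne w 0 with rfl | hw0
    · have ha0 : a ≠ 0 := by
        rintro rfl
        simp at hu'
        exact hu hu'
      have : 0 < a ^ 2 * (-B T T) := mul_pos (by positivity) (by linarith)
      simp only [map_zero]
      linarith
    · have h4 := pos_of_orthogonal_of_neg hB hlor hT hTw hw0
      have : 0 ≤ a ^ 2 * (-B T T) := mul_nonneg (by positivity) (by linarith)
      linarith
  have hcont : Continuous fun u => B u u + 2 / (-B T T) * B u T ^ 2 := by fun_prop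
  rcases (Metric.sphere (0 : E) 1).eq_empty_or_nonempty with he | hne
  · refine ⟨1, one_pos, _, hk, fun u => ?_⟩
    have : u = 0 := by
      by_contra hu
      have : ‖u‖⁻¹ • u ∈ Metric.sphere (0 : E) 1 := by simp [norm_smul, hu]
      rw [he] at this
      exact this
    simp [this]
  · obtain ⟨x, hx, hmin⟩ := (isCompact_sphere (0 : E) 1).exists_isMinOn hne hcont.continuousOn
    have hx0 : x ≠ 0 := by
      rintro rfl
      simp at hx
    refine ⟨_, hpd x hx0, _, hk, fun u => ?_⟩
    rcases eq_or_ne u 0 with rfl | hu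
    · simp
    have hu0 : 0 < ‖u‖ := norm_pos_iff.2 hu
    have h1 : ‖u‖⁻¹ • u ∈ Metric.sphere (0 : E) 1 := by simp [norm_smul, hu]
    have h2 := hmin h1
    simp only [mem_ofPred_eq, map_smul, smul_apply, smul_eq_mul] at h2
    have h3 := mul_le_mul_of_nonneg_right h2 (sq_nonneg ‖u‖)
    refine h3.trans_eq ?_
    field_simp

/-- The quadratic inequality behind both the transversality of causal vectors to a timelike
direction `e` and the comparison of time orientations: `B` is nonnegative on `ker θ`. -/
lemma apply_le_of_nonneg_on_ker {B : E →L[ℝ] E →L[ℝ] ℝ} (hB : ∀ u v, B u v = B v u)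
    {θ : E →L[ℝ] ℝ} (hθ : ∀ w, θ w = 0 → 0 ≤ B w w) {e u : E} {a τ : ℝ} (ha : B e e ≤ -a)
    (ha0 : 0 < a) (he : 0 < θ e) (heτ : θ e ≤ τ) (hu : B u u ≤ 0) (huθ : 0 < θ u) :
    B u e ≤ -(a / (2 * τ)) * θ u := by
  obtain ⟨l, hl⟩ : ∃ l, l = θ u / θ e := ⟨_, rfl⟩
  have hl0 : 0 < l := by rw [hl]; positivity
  have h1 := hθ (u - l • e) (by rw [map_sub, map_smul, hl, smul_eq_mul, div_mul_cancel₀ _ he.ne',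
    sub_self])
  simp only [map_sub, map_smul, sub_apply, smul_apply, smul_eq_mul, hB e u] at h1
  have h2 : l * (2 * B u e) ≤ l * (-(l * a)) := by
    have := mul_le_mul_of_nonneg_left ha (by positivity : 0 ≤ l * l)
    linarith
  have h3 := le_of_mul_le_mul_left h2 hl0
  have h4 : θ u / τ ≤ l := by rw [hl]; gcongr
  have h5 := mul_le_mul_of_nonneg_right h4 ha0.le
  have h6 : a / (2 * τ) * θ u = θ u / τ * a / 2 := by
    have : τ ≠ 0 := (he.trans_le heτ).ne'
    field_simp
  linarith

/-- A `C^2` Lorentzian metric is a cone field near each point, with the functional `-G (·, T)` as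
clock, and the time orientation given by a continuous timelike field `T` is that of the clock. -/
theorem exists_isConeField [FiniteDimensional ℝ E] {G : E → E →L[ℝ] E →L[ℝ] ℝ} {z₀ : E}
    (hG : ContDiffAt ℝ 2 G z₀) (hsymm : ∀ᶠ z in 𝓝 z₀, ∀ u v, G z u v = G z v u)
    (hlor : ∃ v, G z₀ v v < 0 ∧ ∀ w, G z₀ v w = 0 → w ≠ 0 → 0 < G z₀ w w)
    {T : E → E} (hT : ContinuousAt T z₀) (hTT : G z₀ (T z₀) (T z₀) < 0) {e₀ : E}
    (he : G z₀ e₀ e₀ < 0) (heT : G z₀ e₀ (T z₀) < 0) :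
    ∃ R > 0, ∃ (θ : E →L[ℝ] ℝ) (L c α : ℝ),
      IsConeField G (fderiv ℝ G) θ e₀ (Metric.ball z₀ R) L c α ∧
      ∀ z ∈ Metric.ball z₀ R, ∀ u, u ≠ 0 → G z u u ≤ 0 → (G z u (T z) < 0 ↔ 0 < θ u) := by
  have hsymm₀ := hsymm.self_of_nhds
  obtain ⟨m, hm, k, hk, hcoer⟩ := exists_coercive_add_sq hsymm₀ hlor hTT
  obtain ⟨θ, hθ⟩ : ∃ θ : E →L[ℝ] ℝ, θ = -(G z₀ (T z₀)) := ⟨_, rfl⟩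
  have hθu : ∀ u, θ u = -G z₀ u (T z₀) := fun u => by rw [hθ, neg_apply, hsymm₀]
  have hGc : ContinuousAt G z₀ := hG.continuousAt
  have hG1 : ContDiffAt ℝ 1 (fderiv ℝ G) z₀ := hG.fderiv_right (by norm_num)
  have hG1c : ContinuousAt (fderiv ℝ G) z₀ := hG1.continuousAt
  -- all conditions hold near the point
  have hcoer' : ∀ᶠ z in 𝓝 z₀, ∀ u, m / 2 * ‖u‖ ^ 2 ≤ G z u u + k * θ u ^ 2 := by
    filter_upwards [Metric.continuousAt_iff'.1 hGc (m / 2) (by positivity)] with z hz u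
    rw [dist_eq_norm] at hz
    have h1 := hcoer u
    have h2 : |(G z - G z₀) u u| ≤ m / 2 * ‖u‖ * ‖u‖ := abs_apply₂_le _ hz.le le_rfl le_rfl
    simp only [sub_apply] at h2
    rw [hθu]
    linarith only [h1, (abs_le.1 h2).1]
  have hee : ∀ᶠ z in 𝓝 z₀, G z e₀ e₀ < G z₀ e₀ e₀ / 2 :=
    ContinuousAt.eventually_lt (by fun_prop) continuousAt_const (by linarith)
  have hTTz : ∀ᶠ z in 𝓝 z₀, G z (T z) (T z) < 0 :=
    ContinuousAt.eventually_lt ((hGc.clm_apply hT).clm_apply hT) continuousAt_const hTT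
  have hθT : ∀ᶠ z in 𝓝 z₀, 0 < θ (T z) :=
    ContinuousAt.eventually_lt continuousAt_const (by fun_prop) (by rw [hθu]; linarith)
  have hdiff : ∀ᶠ z in 𝓝 z₀, ContDiffAt ℝ 2 G z := hG.eventually (by simp)
  have hnorm : ∀ᶠ z in 𝓝 z₀, ‖G z‖ < ‖G z₀‖ + 1 :=
    ContinuousAt.eventually_lt (by fun_prop) continuousAt_const (by linarith)
  have hnorm' : ∀ᶠ z in 𝓝 z₀, ‖fderiv ℝ G z‖ < ‖fderiv ℝ G z₀‖ + 1 :=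
    ContinuousAt.eventually_lt hG1c.norm continuousAt_const (by linarith)
  obtain ⟨K, t, ht, hK⟩ := hG1.exists_lipschitzOnWith
  have hwide : ∀ᶠ y : E × E in 𝓝 (z₀, 0), G y.1 (e₀ + y.2) (e₀ + y.2) < 0 ∧ 0 < θ (e₀ + y.2) := by
    have h1 : ContinuousAt (fun y : E × E => G y.1) (z₀, 0) :=
      ContinuousAt.comp (x := ((z₀, 0) : E × E)) (f := Prod.fst) hGc continuousAt_fst
    have h2 : ContinuousAt (fun y : E × E => e₀ + y.2) (z₀, 0) := by fun_prop
    refine (ContinuousAt.eventually_lt ((h1.clm_apply h2).clm_apply h2) continuousAt_const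
      (by simpa using he)).and (ContinuousAt.eventually_lt continuousAt_const
        (θ.continuous.continuousAt.comp h2) ?_)
    simp only [add_zero, hθu]
    linarith
  obtain ⟨R₂, hR₂, hwide⟩ := Metric.eventually_nhds_iff_ball.1 hwide
  obtain ⟨R₁, hR₁, hall⟩ := Metric.eventually_nhds_iff_ball.1 (hsymm.and (hcoer'.and (hee.and
    (hTTz.and (hθT.and (hdiff.and (hnorm.and (hnorm'.and ht))))))))
  obtain ⟨R, hR, hRR₁, hRR₂⟩ : ∃ R > 0, R ≤ R₁ ∧ R ≤ R₂ :=
    ⟨min R₁ R₂, by positivity, min_le_left _ _, min_le_right _ _⟩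
  replace hall : ∀ z ∈ Metric.ball z₀ R, _ := fun z hz => hall z (Metric.ball_subset_ball hRR₁ hz)
  have hker : ∀ z ∈ Metric.ball z₀ R, ∀ w, θ w = 0 → 0 ≤ G z w w := fun z hz w hw => by
    have := (hall z hz).2.1 w
    rw [hw] at this
    have h2 : 0 ≤ m / 2 * ‖w‖ ^ 2 := by positivity
    linarith
  have heθ : 0 < θ e₀ := by rw [hθu]; linarith
  obtain ⟨C, hC0, hC⟩ : ∃ C, 0 ≤ C ∧ k = m / 2 * C ^ 2 :=
    ⟨Real.sqrt (2 * k / m), Real.sqrt_nonneg _, by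
      rw [Real.sq_sqrt (by positivity)]; field_simp⟩
  obtain ⟨L, hL⟩ : ∃ L, L = ‖G z₀‖ + 1 + ‖fderiv ℝ G z₀‖ + K + ‖θ‖ + ‖e₀‖ + C := ⟨_, rfl⟩
  have n1 := norm_nonneg (G z₀)
  have n2 := norm_nonneg (fderiv ℝ G z₀)
  have n3 := norm_nonneg θ
  have n4 := norm_nonneg e₀
  have n5 : (0 : ℝ) ≤ K := K.2
  refine ⟨R, hR, θ, L, -(G z₀ e₀ e₀ / 2) / (2 * θ e₀), R₂ / 2, ?_, ?_⟩
  · refine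
      { symm := fun z hz => (hall z hz).1
        continuousOn := fun z hz =>
          (hall z hz).2.2.2.2.2.1.continuousAt.continuousWithinAt
        continuousOn' := fun z hz => ((hall z hz).2.2.2.2.2.1.fderiv_right (m := 1)
          (by norm_num)).continuousAt.continuousWithinAt
        norm_le := fun z hz => by linarith [(hall z hz).2.2.2.2.2.2.1]
        norm_le' := fun z hz => by linarith [(hall z hz).2.2.2.2.2.2.2.1]
        taylor := ?_
        norm_functional_le := by linarith
        norm_vector_le := by linarith
        one_le := by linarith
        pos := div_pos (by linarith) (by positivity)
        cone := ?_
        width_pos := by positivity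
        wide := ?_ }
    · intro z hz w hw
      have hconv : Convex ℝ (Metric.ball z₀ R ∩ Metric.closedBall z ‖w - z‖) :=
        (convex_ball _ _).inter (convex_closedBall _ _)
      have h1 := hconv.norm_image_sub_le_of_norm_hasFDerivWithin_le' (f := G)
        (f' := fderiv ℝ G) (φ := fderiv ℝ G z) (C := K * ‖w - z‖) (x := z) (y := w)
        (fun x hx => ((hall x hx.1).2.2.2.2.2.1.differentiableAt
          (by norm_num)).hasFDerivAt.hasFDerivWithinAt)
        (fun x hx => by
          have h2 := hK.norm_sub_le (hall x hx.1).2.2.2.2.2.2.2.2 (hall z hz).2.2.2.2.2.2.2.2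
          refine h2.trans (mul_le_mul_of_nonneg_left ?_ n5)
          have := hx.2
          rwa [Metric.mem_closedBall, dist_eq_norm] at this)
        ⟨hz, Metric.mem_closedBall_self (norm_nonneg _)⟩
        ⟨hw, by rw [Metric.mem_closedBall, dist_eq_norm]⟩
      refine h1.trans ?_
      rw [mul_assoc, ← sq]
      exact mul_le_mul_of_nonneg_right (by linarith) (sq_nonneg _)
    · intro z hz u hu hθ0
      constructor
      · have h1 := (hall z hz).2.1 u
        have h2 : m / 2 * ‖u‖ ^ 2 ≤ m / 2 * (C * θ u) ^ 2 := by
          rw [mul_pow, ← mul_assoc, ← hC]; linarith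
        have h3 := le_of_mul_le_mul_left h2 (by positivity)
        have h4 := abs_le_of_sq_le_sq' h3 (by positivity) |>.2
        exact h4.trans (mul_le_mul_of_nonneg_right (by linarith) hθ0.le)
      · have := apply_le_of_nonneg_on_ker (hall z hz).1 (hker z hz) (e := e₀)
          (a := -(G z₀ e₀ e₀ / 2)) (by linarith [(hall z hz).2.2.1]) (by linarith) heθ le_rfl hu hθ0
        linarith
    · intro z hz v hv
      refine hwide (z, v) ?_
      rw [← ball_prod_same]
      exact ⟨Metric.ball_subset_ball hRR₂ hz, by rw [mem_ball_zero_iff]; linarith⟩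
  · intro z hz u hu0 huu
    have key : ∀ w, G z w w ≤ 0 → 0 < θ w → G z w (T z) < 0 := fun w hw hw0 => by
      have h1 := apply_le_of_nonneg_on_ker (hall z hz).1 (hker z hz) (e := T z)
        (a := -G z (T z) (T z)) (by linarith) (by linarith [(hall z hz).2.2.2.1])
        (hall z hz).2.2.2.2.1 le_rfl hw hw0
      have h2 : 0 < -G z (T z) (T z) / (2 * θ (T z)) * θ w :=
        mul_pos (div_pos (by linarith [(hall z hz).2.2.2.1])
          (by linarith [(hall z hz).2.2.2.2.1])) hw0
      linarith
    refine ⟨fun h => ?_, key u huu⟩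
    rcases lt_trichotomy (θ u) 0 with h0 | h0 | h0
    · have := key (-u) (by simpa using huu) (by simpa using h0)
      simp only [map_neg, neg_apply] at this
      linarith
    · have h1 := (hall z hz).2.1 u
      rw [h0] at h1
      have h2 : 0 < ‖u‖ := norm_pos_iff.2 hu0
      have : 0 < m / 2 * ‖u‖ ^ 2 := by positivity
      linarith
    · exact h0

end Lorentz

/-! ### The metric and causal curves in a coordinate system -/

namespace Spacetime

variable {n : ℕ} {M : Type*} [TopologicalSpace M]
  [ChartedSpace (EuclideanSpace ℝ (Fin (n + 1))) M]

local notation "𝔼" => EuclideanSpace ℝ (Fin (n + 1))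

lemma mdifferentiable_of_mem_maximalAtlas {e : OpenPartialHomeomorph M 𝔼}
    (he : e ∈ IsManifold.maximalAtlas 𝓘(ℝ, 𝔼) 3 M) : e.MDifferentiable 𝓘(ℝ, 𝔼) 𝓘(ℝ, 𝔼) :=
  ⟨(contMDiffOn_of_mem_maximalAtlas he).mdifferentiableOn (by norm_num),
    (contMDiffOn_symm_of_mem_maximalAtlas he).mdifferentiableOn (by norm_num)⟩

lemma mfderiv_symm_mfderiv {e : OpenPartialHomeomorph M 𝔼}
    (he : e ∈ IsManifold.maximalAtlas 𝓘(ℝ, 𝔼) 3 M) {x : M} (hx : x ∈ e.source)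
    (v : TangentSpace 𝓘(ℝ, 𝔼) x) :
    mfderiv 𝓘(ℝ, 𝔼) 𝓘(ℝ, 𝔼) e.symm (e x) (mfderiv 𝓘(ℝ, 𝔼) 𝓘(ℝ, 𝔼) e x v) = v :=
  DFunLike.congr_fun ((mdifferentiable_of_mem_maximalAtlas he).symm_comp_deriv hx) v

lemma mfderiv_symm_eq {e : OpenPartialHomeomorph M 𝔼}
    (he : e ∈ IsManifold.maximalAtlas 𝓘(ℝ, 𝔼) 3 M) {x : M} (hx : x ∈ e.source)
    {v : TangentSpace 𝓘(ℝ, 𝔼) x} {u : 𝔼} (h : mfderiv 𝓘(ℝ, 𝔼) 𝓘(ℝ, 𝔼) e x v = u) :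
    mfderiv 𝓘(ℝ, 𝔼) 𝓘(ℝ, 𝔼) e.symm (e x) u = v := by
  rw [← h]
  exact mfderiv_symm_mfderiv he hx v

lemma mfderiv_mfderiv_symm {e : OpenPartialHomeomorph M 𝔼}
    (he : e ∈ IsManifold.maximalAtlas 𝓘(ℝ, 𝔼) 3 M) {z : 𝔼} (hz : z ∈ e.target) (u : 𝔼) :
    mfderiv 𝓘(ℝ, 𝔼) 𝓘(ℝ, 𝔼) e (e.symm z) (mfderiv 𝓘(ℝ, 𝔼) 𝓘(ℝ, 𝔼) e.symm z u) = u :=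
  DFunLike.congr_fun ((mdifferentiable_of_mem_maximalAtlas he).comp_symm_deriv hz) u

/-- A `C^1` curve in coordinates is a `C^1` curve in the manifold. -/
lemma contMDiffOn_symm_comp {e : OpenPartialHomeomorph M 𝔼}
    (he : e ∈ IsManifold.maximalAtlas 𝓘(ℝ, 𝔼) 3 M) {γ γ' : ℝ → 𝔼}
    (hγ' : ContinuousOn γ' (Icc 0 1))
    (hγ : ∀ s ∈ Icc (0 : ℝ) 1, HasDerivWithinAt γ (γ' s) (Icc 0 1) s)
    (hmem : ∀ s ∈ Icc (0 : ℝ) 1, γ s ∈ e.target) :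
    ContMDiffOn 𝓘(ℝ, ℝ) 𝓘(ℝ, 𝔼) 1 (e.symm ∘ γ) (Icc 0 1) ∧
      ∀ s ∈ Icc (0 : ℝ) 1, mfderivWithin 𝓘(ℝ, ℝ) 𝓘(ℝ, 𝔼) (e.symm ∘ γ) (Icc 0 1) s (1 : ℝ) =
        mfderiv 𝓘(ℝ, 𝔼) 𝓘(ℝ, 𝔼) e.symm (γ s) (γ' s) := by
  have hu : UniqueDiffOn ℝ (Icc (0 : ℝ) 1) := uniqueDiffOn_Icc_zero_one
  have h1 : ContDiffOn ℝ 1 γ (Icc 0 1) := (contDiffOn_one_iff_derivWithin hu).2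
    ⟨fun s hs => (hγ s hs).differentiableWithinAt,
      hγ'.congr fun s hs => (hγ s hs).derivWithin (hu s hs)⟩
  have hes := contMDiffOn_symm_of_mem_maximalAtlas he
  refine ⟨(hes.of_le (by norm_num)).comp h1.contMDiffOn hmem, fun s hs => ?_⟩
  have h2 : HasMFDerivWithinAt 𝓘(ℝ, ℝ) 𝓘(ℝ, 𝔼) γ (Icc 0 1) s
      (ContinuousLinearMap.toSpanSingleton ℝ (γ' s)) :=
    (hγ s hs).hasFDerivWithinAt.hasMFDerivWithinAt
  have h3 := ((mdifferentiable_of_mem_maximalAtlas he).mdifferentiableAt_symm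
    (hmem s hs)).hasMFDerivAt
  have h4 := (h3.comp_hasMFDerivWithinAt s h2).mfderivWithin
    (uniqueDiffOn_Icc_zero_one.uniqueMDiffOn s hs)
  rw [h4]
  exact congrArg (fun u : 𝔼 => (mfderiv 𝓘(ℝ, 𝔼) 𝓘(ℝ, 𝔼) e.symm (γ s) u : TangentSpace 𝓘(ℝ, 𝔼) _))
    (by simp : ContinuousLinearMap.toSpanSingleton ℝ (γ' s) (1 : ℝ) = γ' s)

/-- A `C^1` curve in the manifold is a `C^1` curve in coordinates. -/
lemma hasDerivWithinAt_comp {e : OpenPartialHomeomorph M 𝔼}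
    (he : e ∈ IsManifold.maximalAtlas 𝓘(ℝ, 𝔼) 3 M) {γ : ℝ → M}
    (hγ : ContMDiffOn 𝓘(ℝ, ℝ) 𝓘(ℝ, 𝔼) 1 γ (Icc 0 1))
    (hmem : ∀ s ∈ Icc (0 : ℝ) 1, γ s ∈ e.source) :
    ∃ γ' : ℝ → 𝔼, ContinuousOn γ' (Icc 0 1) ∧
      ∀ s ∈ Icc (0 : ℝ) 1, HasDerivWithinAt (e ∘ γ) (γ' s) (Icc 0 1) s ∧
        γ' s = mfderiv 𝓘(ℝ, 𝔼) 𝓘(ℝ, 𝔼) e (γ s)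
          (mfderivWithin 𝓘(ℝ, ℝ) 𝓘(ℝ, 𝔼) γ (Icc 0 1) s (1 : ℝ)) := by
  have hu : UniqueDiffOn ℝ (Icc (0 : ℝ) 1) := uniqueDiffOn_Icc_zero_one
  have h1 : ContDiffOn ℝ 1 (e ∘ γ) (Icc 0 1) :=
    (((contMDiffOn_of_mem_maximalAtlas he).of_le (by norm_num)).comp hγ hmem).contDiffOn
  obtain ⟨h2, h3⟩ := (contDiffOn_one_iff_derivWithin hu).1 h1
  refine ⟨_, h3, fun s hs => ⟨(h2 s hs).hasDerivWithinAt, ?_⟩⟩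
  have h4 := ((mdifferentiable_of_mem_maximalAtlas he).mdifferentiableAt (hmem s hs)).hasMFDerivAt
  have h5 := (hγ.mdifferentiableOn one_ne_zero s hs).hasMFDerivWithinAt
  have h6 := (h4.comp_hasMFDerivWithinAt s h5).mfderivWithin (hu.uniqueMDiffOn s hs)
  rw [mfderivWithin_eq_fderivWithin] at h6
  rw [← fderivWithin_derivWithin]
  exact DFunLike.congr_fun h6 (1 : ℝ)

variable [IsManifold 𝓘(ℝ, EuclideanSpace ℝ (Fin (n + 1))) 4 M]

/-- The components of the metric in the coordinates `e`, as a bilinear form on `ℝ^(n+1)`. -/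
noncomputable def chartMetric (g : Spacetime n M) (e : OpenPartialHomeomorph M 𝔼) (z : 𝔼) :
    𝔼 →L[ℝ] 𝔼 →L[ℝ] ℝ :=
  ContinuousLinearMap.bilinearComp (E := 𝔼) (F := 𝔼) (E' := 𝔼) (F' := 𝔼) (g.metric (e.symm z))
    (mfderiv 𝓘(ℝ, 𝔼) 𝓘(ℝ, 𝔼) e.symm z) (mfderiv 𝓘(ℝ, 𝔼) 𝓘(ℝ, 𝔼) e.symm z)

/-- The components of the time orientation in the coordinates `e`. -/
noncomputable def chartField (g : Spacetime n M) (e : OpenPartialHomeomorph M 𝔼) (z : 𝔼) : 𝔼 :=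
  mfderiv 𝓘(ℝ, 𝔼) 𝓘(ℝ, 𝔼) e (e.symm z) (g.timeField (e.symm z))

lemma chartMetric_apply (g : Spacetime n M) (e : OpenPartialHomeomorph M 𝔼) (z u v : 𝔼) :
    g.chartMetric e z u v = g.metric (e.symm z) (mfderiv 𝓘(ℝ, 𝔼) 𝓘(ℝ, 𝔼) e.symm z u)
      (mfderiv 𝓘(ℝ, 𝔼) 𝓘(ℝ, 𝔼) e.symm z v) := rfl

lemma mfderiv_symm_chartField (g : Spacetime n M) {e : OpenPartialHomeomorph M 𝔼}
    (he : e ∈ IsManifold.maximalAtlas 𝓘(ℝ, 𝔼) 3 M) {z : 𝔼} (hz : z ∈ e.target) :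
    mfderiv 𝓘(ℝ, 𝔼) 𝓘(ℝ, 𝔼) e.symm z (g.chartField e z) = g.timeField (e.symm z) := by
  have := mfderiv_symm_mfderiv he (e.map_target hz) (g.timeField (e.symm z))
  rwa [e.right_inv hz] at this

lemma contDiffOn_chartMetric (g : Spacetime n M) {e : OpenPartialHomeomorph M 𝔼}
    (he : e ∈ IsManifold.maximalAtlas 𝓘(ℝ, 𝔼) 3 M) :
    ContDiffOn ℝ 2 (g.chartMetric e) e.target := by
  have : IsManifold 𝓘(ℝ, 𝔼) 3 M := IsManifold.of_le (n := 4) (by norm_cast)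
  have hes := contMDiffOn_symm_of_mem_maximalAtlas he
  have hvec : ∀ u : 𝔼, ContMDiffOn 𝓘(ℝ, 𝔼) (𝓘(ℝ, 𝔼).prod 𝓘(ℝ, 𝔼)) 2
      (fun z => (⟨e.symm z, mfderiv 𝓘(ℝ, 𝔼) 𝓘(ℝ, 𝔼) e.symm z u⟩ : TangentBundle 𝓘(ℝ, 𝔼) M))
      e.target := by
    intro u
    have h1 := hes.contMDiffOn_tangentMapWithin (m := 2) (by norm_num)
      e.open_target.uniqueMDiffOn
    have h2 : ContMDiffOn 𝓘(ℝ, 𝔼) (𝓘(ℝ, 𝔼).prod 𝓘(ℝ, 𝔼)) 2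
        (fun z : 𝔼 => (⟨z, u⟩ : TangentBundle 𝓘(ℝ, 𝔼) 𝔼)) e.target :=
      contMDiffOn_vectorSpace_iff_contDiffOn (V := fun _ => u).2 contDiffOn_const
    refine (h1.comp h2 fun z hz => hz).congr fun z hz => ?_
    simp only [Function.comp, tangentMapWithin, mfderivWithin_of_isOpen e.open_target hz]
  refine contDiffOn_clm_apply.2 fun u => contDiffOn_clm_apply.2 fun v => ?_
  intro z hz
  have : ContMDiffWithinAt 𝓘(ℝ, 𝔼) (𝓘(ℝ, 𝔼).prod 𝓘(ℝ, ℝ)) 2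
      (fun z => TotalSpace.mk' ℝ (E := Bundle.Trivial M ℝ) (e.symm z)
        (g.metric (e.symm z) (mfderiv 𝓘(ℝ, 𝔼) 𝓘(ℝ, 𝔼) e.symm z u)
          (mfderiv 𝓘(ℝ, 𝔼) 𝓘(ℝ, 𝔼) e.symm z v))) e.target z := by
    apply ContMDiffWithinAt.clm_bundle_apply₂ (F₁ := 𝔼) (F₂ := 𝔼)
    · exact (g.contMDiff_metric.of_le (by norm_num)).contMDiffAt.comp_contMDiffWithinAt z
        ((hes z hz).of_le (by norm_num))
    · exact hvec u z hz
    · exact hvec v z hz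
  simp only [contMDiffWithinAt_totalSpace] at this
  exact this.2.contDiffWithinAt

lemma continuousOn_chartField (g : Spacetime n M) {e : OpenPartialHomeomorph M 𝔼}
    (he : e ∈ IsManifold.maximalAtlas 𝓘(ℝ, 𝔼) 3 M) :
    ContinuousOn (g.chartField e) e.target := by
  have h1 := (contMDiffOn_of_mem_maximalAtlas he).continuousOn_tangentMapWithin (by norm_num)
    e.open_source.uniqueMDiffOn
  have h2 : ContinuousOn (fun z : 𝔼 => (⟨e.symm z, g.timeField (e.symm z)⟩ :
      TangentBundle 𝓘(ℝ, 𝔼) M)) e.target :=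
    g.continuous_timeField.comp_continuousOn e.continuousOn_symm
  have h3 := (contMDiff_snd_tangentBundle_modelSpace 𝔼 𝓘(ℝ, 𝔼) (n := 0)).continuous
  refine (h3.comp_continuousOn (h1.comp h2 fun z hz => e.map_target hz)).congr fun z hz => ?_
  simp only [Function.comp, tangentMapWithin,
    mfderivWithin_of_isOpen e.open_source (e.map_target hz)]
  rfl

lemma chartMetric_lorentzian (g : Spacetime n M) {e : OpenPartialHomeomorph M 𝔼}
    (he : e ∈ IsManifold.maximalAtlas 𝓘(ℝ, 𝔼) 3 M) {z : 𝔼} (hz : z ∈ e.target) :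
    ∃ v, g.chartMetric e z v v < 0 ∧
      ∀ w, g.chartMetric e z v w = 0 → w ≠ 0 → 0 < g.chartMetric e z w w := by
  obtain ⟨v, hv, hpos⟩ := g.lorentzian (e.symm z)
  have hs : mfderiv 𝓘(ℝ, 𝔼) 𝓘(ℝ, 𝔼) e.symm z (mfderiv 𝓘(ℝ, 𝔼) 𝓘(ℝ, 𝔼) e (e.symm z) v) = v := by
    have := mfderiv_symm_mfderiv he (e.map_target hz) v
    rwa [e.right_inv hz] at this
  obtain ⟨v', rfl⟩ : ∃ v' : 𝔼, mfderiv 𝓘(ℝ, 𝔼) 𝓘(ℝ, 𝔼) e.symm z v' = v := ⟨_, hs⟩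
  refine ⟨v', hv, fun w hw hw0 => hpos _ hw fun h0 => hw0 ?_⟩
  have := mfderiv_mfderiv_symm he hz w
  exact (this.symm.trans (congrArg (mfderiv 𝓘(ℝ, 𝔼) 𝓘(ℝ, 𝔼) e (e.symm z)) h0)).trans (map_zero _)

variable {g : Spacetime n M} {e : OpenPartialHomeomorph M (EuclideanSpace ℝ (Fin (n + 1)))}
  {θ : EuclideanSpace ℝ (Fin (n + 1)) →L[ℝ] ℝ} {D : Set (EuclideanSpace ℝ (Fin (n + 1)))}

/-- Coordinate timelike curves are timelike curves of the spacetime. -/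
lemma timelikeStep_of_isCurveStep (he : e ∈ IsManifold.maximalAtlas 𝓘(ℝ, 𝔼) 3 M)
    (hD : D ⊆ e.target)
    (hθ : ∀ z ∈ D, ∀ u, u ≠ 0 → g.chartMetric e z u u ≤ 0 →
      (g.chartMetric e z u (g.chartField e z) < 0 ↔ 0 < θ u)) {z z' : 𝔼}
    (h : IsCurveStep (ConeTimelike (g.chartMetric e) θ) D z z') {U : Set M}
    (hU : e.symm '' D ⊆ U) : g.TimelikeStep U (e.symm z) (e.symm z') := by
  obtain ⟨γ, γ', hγ', hγ, rfl, rfl, hP⟩ := h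
  obtain ⟨h1, h2⟩ := contMDiffOn_symm_comp he hγ' hγ fun s hs => hD (hP s hs).1
  refine ⟨e.symm ∘ γ, h1, rfl, rfl, fun s hs => ⟨hU (mem_image_of_mem _ (hP s hs).1), ?_⟩⟩
  obtain ⟨hmem, htl, h0⟩ := hP s hs
  rw [h2 s hs]
  refine ⟨htl, ?_⟩
  have hne : γ' s ≠ 0 := fun h => by simp [h] at h0
  have := (hθ _ hmem _ hne htl.le).2 h0
  rwa [chartMetric_apply, mfderiv_symm_chartField g he (hD hmem)] at this

/-- Causal curves of the spacetime in the coordinate domain are causal in coordinates. -/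
lemma isCurveStep_of_causalStep (he : e ∈ IsManifold.maximalAtlas 𝓘(ℝ, 𝔼) 3 M)
    (hθ : ∀ z ∈ D, ∀ u, u ≠ 0 → g.chartMetric e z u u ≤ 0 →
      (g.chartMetric e z u (g.chartField e z) < 0 ↔ 0 < θ u)) {V : Set 𝔼} (hV : V ⊆ D)
    {x y : M} (h : g.CausalStep (e.source ∩ e ⁻¹' V) x y) :
    IsCurveStep (ConeCausal (g.chartMetric e) θ) V (e x) (e y) := by
  obtain ⟨γ, hγ, rfl, rfl, hP⟩ := h
  obtain ⟨γ', hγ', hγ2⟩ := hasDerivWithinAt_comp he hγ fun s hs => (hP s hs).1.1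
  refine ⟨e ∘ γ, γ', hγ', fun s hs => (hγ2 s hs).1, rfl, rfl, fun s hs => ⟨(hP s hs).1.2, ?_⟩⟩
  obtain ⟨⟨hsrc, hsV⟩, hne, hc, hf⟩ := hP s hs
  have hv := mfderiv_symm_mfderiv he hsrc
    (mfderivWithin 𝓘(ℝ, ℝ) 𝓘(ℝ, 𝔼) γ (Icc 0 1) s (1 : ℝ))
  rw [← (hγ2 s hs).2] at hv
  have hsymm : e.symm (e (γ s)) = γ s := e.left_inv hsrc
  have hne' : γ' s ≠ 0 := fun h => hne (by rw [h] at hv; exact hv.symm.trans (map_zero _))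
  have key : ∀ w : TangentSpace 𝓘(ℝ, 𝔼) (γ s), ∀ u : 𝔼,
      mfderiv 𝓘(ℝ, 𝔼) 𝓘(ℝ, 𝔼) e (γ s) w = u →
      g.chartMetric e (e (γ s)) (γ' s) u = g.metric (γ s)
        (mfderivWithin 𝓘(ℝ, ℝ) 𝓘(ℝ, 𝔼) γ (Icc 0 1) s (1 : ℝ)) w := by
    intro w u hu
    rw [chartMetric_apply, hv, mfderiv_symm_eq he hsrc hu, hsymm]
  have hc' : g.chartMetric e (e (γ s)) (γ' s) (γ' s) ≤ 0 := by
    rw [key _ _ (hγ2 s hs).2.symm]; exact hc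
  refine ⟨hc', (hθ _ (hV hsV) _ hne' hc').1 ?_⟩
  rw [key (g.timeField (γ s)) _ (by rw [chartField, hsymm])]
  exact hf

end Spacetime

/-! ### Null hypersurfaces as graphs -/

section TimeSpace

variable {n : ℕ}

/-- The projection to the spatial coordinates, as a continuous linear map. -/
noncomputable def spacePartL (n : ℕ) :
    EuclideanSpace ℝ (Fin (n + 1)) →L[ℝ] EuclideanSpace ℝ (Fin n) :=
  LinearMap.toContinuousLinearMap
    { toFun := spacePart
      map_add' := fun x y => by ext i; simp [spacePart]
      map_smul' := fun t x => by ext i; simp [spacePart] }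

/-- The inclusion `𝐱 ↦ (0, 𝐱)` of the spatial coordinates, as a continuous linear map. -/
noncomputable def spaceInclL (n : ℕ) :
    EuclideanSpace ℝ (Fin n) →L[ℝ] EuclideanSpace ℝ (Fin (n + 1)) :=
  LinearMap.toContinuousLinearMap
    { toFun := timeSpace 0
      map_add' := fun x y => by
        ext i
        refine Fin.cases ?_ (fun j => ?_) i <;> simp [timeSpace]
      map_smul' := fun t x => by
        ext i
        refine Fin.cases ?_ (fun j => ?_) i <;> simp [timeSpace] }

@[simp] lemma spacePartL_apply (z : EuclideanSpace ℝ (Fin (n + 1))) :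
    spacePartL n z = spacePart z := rfl

@[simp] lemma spaceInclL_apply (x : EuclideanSpace ℝ (Fin n)) : spaceInclL n x = timeSpace 0 x :=
  rfl

@[simp] lemma timeSpace_zero_apply (t : ℝ) (x : EuclideanSpace ℝ (Fin n)) :
    timeSpace t x 0 = t := by
  simp [timeSpace]

@[simp] lemma timeSpace_succ_apply (t : ℝ) (x : EuclideanSpace ℝ (Fin n)) (i : Fin n) :
    timeSpace t x i.succ = x i := by
  simp [timeSpace]

@[simp] lemma spacePart_timeSpace (t : ℝ) (x : EuclideanSpace ℝ (Fin n)) :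
    spacePart (timeSpace t x) = x := by
  ext i
  simp [spacePart]

lemma timeSpace_spacePart (z : EuclideanSpace ℝ (Fin (n + 1))) :
    timeSpace (z 0) (spacePart z) = z := by
  ext i
  refine Fin.cases ?_ (fun j => ?_) i <;> simp [spacePart]

lemma timeSpace_eq (t : ℝ) (x : EuclideanSpace ℝ (Fin n)) :
    timeSpace t x = t • EuclideanSpace.single (0 : Fin (n + 1)) (1 : ℝ) + spaceInclL n x := by
  ext i
  refine Fin.cases ?_ (fun j => ?_) i <;> simp

lemma spacePart_sub (z w : EuclideanSpace ℝ (Fin (n + 1))) :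
    spacePart (z - w) = spacePart z - spacePart w := map_sub (spacePartL n) z w

lemma norm_timeSpace_zero (x : EuclideanSpace ℝ (Fin n)) : ‖timeSpace 0 x‖ = ‖x‖ := by
  simp [EuclideanSpace.norm_eq, Fin.sum_univ_succ]

lemma norm_le_abs_add_norm_spacePart (z : EuclideanSpace ℝ (Fin (n + 1))) :
    ‖z‖ ≤ |z 0| + ‖spacePart z‖ := by
  conv_lhs => rw [← timeSpace_spacePart z, timeSpace_eq]
  refine (norm_add_le _ _).trans (add_le_add ?_ ?_)
  · rw [norm_smul]; simp
  · rw [spaceInclL_apply, norm_timeSpace_zero]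

lemma abs_apply_zero_le_norm (z : EuclideanSpace ℝ (Fin (n + 1))) : |z 0| ≤ ‖z‖ := by
  simpa using PiLp.norm_apply_le z 0

lemma IsBSCLoc.congr {d : ℕ} {f f' : EuclideanSpace ℝ (Fin d) → ℝ}
    {Ω : Set (EuclideanSpace ℝ (Fin d))} (hf : IsBSCLoc f Ω) (h : EqOn f' f Ω) :
    IsBSCLoc f' Ω := by
  intro x₀ hx₀
  obtain ⟨O, h1, h2, h3, h4, hO, ⟨K, hK⟩, ρ, hρ, S, _, _, b, c, hb, hc, hmax⟩ := hf x₀ hx₀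
  refine ⟨O, h1, h2, h3, h4, hO, ⟨K, fun x hx y hy => ?_⟩, ρ, hρ, S, _, inferInstance, b, c, hb,
    hc, fun x hx => ?_⟩
  · rw [h (hO hx), h (hO hy)]
    exact hK hx hy
  · rw [h (hO hx)]
    exact hmax x hx

end TimeSpace

section Graph

variable {n : ℕ}

/-- Achronality makes a set a Lipschitz graph over its spatial projection: a segment between two of
its points that is closer to the vertical than the cones would be timelike. -/
lemma IsConeField.width_mul_abs_le
    {G : EuclideanSpace ℝ (Fin (n + 1)) → EuclideanSpace ℝ (Fin (n + 1)) →L[ℝ]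
      EuclideanSpace ℝ (Fin (n + 1)) →L[ℝ] ℝ}
    {G' : EuclideanSpace ℝ (Fin (n + 1)) → EuclideanSpace ℝ (Fin (n + 1)) →L[ℝ]
      EuclideanSpace ℝ (Fin (n + 1)) →L[ℝ] EuclideanSpace ℝ (Fin (n + 1)) →L[ℝ] ℝ}
    {θ : EuclideanSpace ℝ (Fin (n + 1)) →L[ℝ] ℝ} {D H : Set (EuclideanSpace ℝ (Fin (n + 1)))}
    {L c α : ℝ} (hG : IsConeField G G' θ (EuclideanSpace.single 0 1) D L c α) (hD : Convex ℝ D)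
    (hach : ∀ p ∈ H ∩ D, ∀ q ∈ H ∩ D, ¬ Relation.TransGen (IsCurveStep (ConeTimelike G θ) D) p q)
    {z w : EuclideanSpace ℝ (Fin (n + 1))} (hz : z ∈ H ∩ D) (hw : w ∈ H ∩ D) :
    α * |w 0 - z 0| ≤ ‖spacePart w - spacePart z‖ := by
  wlog hzw : z 0 ≤ w 0 generalizing z w
  · rw [abs_sub_comm, norm_sub_rev]
    exact this hw hz (le_of_not_ge hzw)
  rcases hzw.eq_or_lt with h | h
  · simp [h]
  rw [abs_of_nonneg (sub_nonneg.2 hzw)]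
  by_contra! hlt
  obtain ⟨t, ht⟩ : ∃ t, t = w 0 - z 0 := ⟨_, rfl⟩
  have ht0 : 0 < t := by rw [ht]; linarith
  rw [← ht] at hlt
  have hw' : z + t • (EuclideanSpace.single 0 1 + t⁻¹ • spaceInclL n (spacePart w - spacePart z)) =
      w := by
    rw [smul_add, smul_inv_smul₀ ht0.ne', ← timeSpace_eq, ht, ← spacePart_sub]
    have : w 0 - z 0 = (w - z) 0 := rfl
    rw [this, timeSpace_spacePart]
    abel
  refine hach z hz w hw (Relation.TransGen.single ?_)
  have := hG.isCurveStep_segment subset_rfl hD ht0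
    (v := t⁻¹ • spaceInclL n (spacePart w - spacePart z)) (by
      rw [norm_smul, norm_inv, Real.norm_of_nonneg ht0.le, spaceInclL_apply, norm_timeSpace_zero,
        inv_mul_le_iff₀ ht0]
      linarith) hz.2 (by rw [hw']; exact hw.2)
  rwa [hw'] at this

/-- Invariance of domain: an `n`-dimensional topological hypersurface that projects injectively to
the spatial coordinates projects onto a neighborhood. -/
lemma image_spacePart_mem_nhds {M : Type*} [TopologicalSpace M]
    {e : OpenPartialHomeomorph M (EuclideanSpace ℝ (Fin (n + 1)))}
    {H W : Set M} (φ : ↥(H ∩ W) ≃ₜ EuclideanSpace ℝ (Fin n)) {p : M}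
    (hp : p ∈ H ∩ W) (hpe : p ∈ e.source) {D : Set (EuclideanSpace ℝ (Fin (n + 1)))}
    (hD : D ∈ 𝓝 (e p)) (hinj : InjOn spacePart (e '' (e.source ∩ H) ∩ D)) :
    spacePart '' (e '' (e.source ∩ H) ∩ D) ∈ 𝓝 (spacePart (e p)) := by
  obtain ⟨f, hf⟩ : ∃ f : EuclideanSpace ℝ (Fin n) → EuclideanSpace ℝ (Fin n),
      f = fun y => spacePart (e (φ.symm y)) := ⟨_, rfl⟩
  obtain ⟨V, hV⟩ : ∃ V : Set (EuclideanSpace ℝ (Fin n)),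
      V = {y | (φ.symm y : M) ∈ e.source ∩ e ⁻¹' D} := ⟨_, rfl⟩
  have hφc : Continuous fun y => (φ.symm y : M) := continuous_subtype_val.comp φ.symm.continuous
  have hVn : V ∈ 𝓝 (φ ⟨p, hp⟩) := by
    rw [hV]
    refine hφc.continuousAt.preimage_mem_nhds ?_
    rw [φ.symm_apply_apply]
    exact Filter.inter_mem (e.open_source.mem_nhds hpe)
      ((e.continuousAt hpe).preimage_mem_nhds hD)
  have hmem : ∀ y ∈ V, e (φ.symm y) ∈ e '' (e.source ∩ H) ∩ D := by
    intro y hy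
    rw [hV] at hy
    exact ⟨mem_image_of_mem _ ⟨hy.1, (φ.symm y).2.1⟩, hy.2⟩
  have hfc : ContinuousOn f V := by
    rw [hf]
    refine (spacePartL n).continuous.comp_continuousOn
      (e.continuousOn.comp hφc.continuousOn fun y hy => ?_)
    rw [hV] at hy
    exact hy.1
  have hfi : InjOn f V := by
    intro y hy y' hy' h
    rw [hf] at h
    have h1 := hinj (hmem y hy) (hmem y' hy') h
    rw [hV] at hy hy'
    have h2 := e.injOn hy.1 hy'.1 h1
    exact φ.symm.injective (Subtype.ext h2)
  have := image_mem_nhds_of_continuousOn_injOn hVn hfc hfi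
  rw [hf] at this
  simp only [φ.symm_apply_apply] at this
  refine Filter.mem_of_superset this ?_
  rintro _ ⟨y, hy, rfl⟩
  exact mem_image_of_mem _ (hmem y hy)

end Graph

namespace Spacetime

variable {n : ℕ} {M : Type*} [TopologicalSpace M]
  [ChartedSpace (EuclideanSpace ℝ (Fin (n + 1))) M]
  [IsManifold 𝓘(ℝ, EuclideanSpace ℝ (Fin (n + 1))) 4 M]

lemma IsAchronalIn.mono {g : Spacetime n M} {H U V : Set M} (h : g.IsAchronalIn H U)
    (hVU : V ⊆ U) : g.IsAchronalIn H V := fun p hp q hq hpq =>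
  h p ⟨hp.1, hVU hp.2⟩ q ⟨hq.1, hVU hq.2⟩ (Relation.TransGen.mono (fun _ _ ⟨γ, h1, h2, h3, h4⟩ =>
    ⟨γ, h1, h2, h3, fun t ht => ⟨hVU (h4 t ht).1, (h4 t ht).2⟩⟩) _ _ hpq)

end Spacetime

section Graph

variable {n : ℕ}

/-- The purely local part of the argument, in coordinates: an achronal set `H` in a cone field,
each of whose points is the starting point of a causal curve that returns to `H`, and which
projects onto neighborhoods, is the graph of a `BSC_loc` function. -/
theorem IsConeField.exists_graph_isBSCLoc
    {G : EuclideanSpace ℝ (Fin (n + 1)) → EuclideanSpace ℝ (Fin (n + 1)) →L[ℝ]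
      EuclideanSpace ℝ (Fin (n + 1)) →L[ℝ] ℝ}
    {G' : EuclideanSpace ℝ (Fin (n + 1)) → EuclideanSpace ℝ (Fin (n + 1)) →L[ℝ]
      EuclideanSpace ℝ (Fin (n + 1)) →L[ℝ] EuclideanSpace ℝ (Fin (n + 1)) →L[ℝ] ℝ}
    {θ : EuclideanSpace ℝ (Fin (n + 1)) →L[ℝ] ℝ} {H : Set (EuclideanSpace ℝ (Fin (n + 1)))}
    {z₀ : EuclideanSpace ℝ (Fin (n + 1))} {L c α R : ℝ}
    (hG : IsConeField G G' θ (EuclideanSpace.single 0 1) (Metric.ball z₀ R) L c α) (hR : 0 < R)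
    (hach : ∀ p ∈ H ∩ Metric.ball z₀ R, ∀ q ∈ H ∩ Metric.ball z₀ R,
      ¬ Relation.TransGen (IsCurveStep (ConeTimelike G θ) (Metric.ball z₀ R)) p q)
    (hhor : ∀ p ∈ H ∩ Metric.ball z₀ R, ∀ V : Set (EuclideanSpace ℝ (Fin (n + 1))), IsOpen V →
      V ⊆ Metric.ball z₀ R → p ∈ V →
      ∃ q ∈ H, q ≠ p ∧ Relation.ReflTransGen (IsCurveStep (ConeCausal G θ) V) p q)
    (hproj : ∀ D ∈ 𝓝 z₀, InjOn spacePart (H ∩ D) → spacePart '' (H ∩ D) ∈ 𝓝 (spacePart z₀)) :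
    ∃ r > 0, ∃ ε > 0, ∃ h : EuclideanSpace ℝ (Fin n) → ℝ,
      (∀ t ∈ Metric.ball (z₀ 0) ε, ∀ x ∈ Metric.ball (spacePart z₀) r,
        timeSpace t x ∈ Metric.ball z₀ R) ∧
      (∀ x ∈ Metric.ball (spacePart z₀) r, h x ∈ Metric.ball (z₀ 0) ε) ∧
      (∀ t ∈ Metric.ball (z₀ 0) ε, ∀ x ∈ Metric.ball (spacePart z₀) r,
        timeSpace t x ∈ H ↔ t = h x) ∧
      ContinuousOn h (Metric.ball (spacePart z₀) r) ∧
      IsBSCLoc h (Metric.ball (spacePart z₀) r) := by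
  have hL := hG.one_le
  have hα := hG.width_pos
  have hlip : ∀ z ∈ H ∩ Metric.ball z₀ R, ∀ w ∈ H ∩ Metric.ball z₀ R,
      α * |w 0 - z 0| ≤ ‖spacePart w - spacePart z‖ := fun z hz w hw =>
    hG.width_mul_abs_le (convex_ball _ _) hach hz hw
  have hinj : InjOn spacePart (H ∩ Metric.ball z₀ R) := by
    intro z hz w hw hzw
    have h1 := hlip z hz w hw
    rw [hzw, sub_self, norm_zero] at h1
    have h2 : |w 0 - z 0| ≤ 0 := by
      by_contra! h
      have := mul_pos hα h
      linarith
    have h3 : w 0 = z 0 := sub_eq_zero.1 (abs_nonpos_iff.1 h2)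
    rw [← timeSpace_spacePart z, ← timeSpace_spacePart w, hzw, h3]
  obtain ⟨R₁, hR₁, hR₁L⟩ : ∃ R₁ > 0, 16 * L ^ 2 * R₁ = R :=
    ⟨R / (16 * L ^ 2), by positivity, by field_simp⟩
  have hR₁R : R₁ ≤ R / 16 := by
    nlinarith only [mul_le_mul_of_nonneg_right (one_le_pow₀ hL (n := 2)) hR₁.le, hR₁L]
  obtain ⟨r₀, hr₀, hr₀s⟩ := Metric.mem_nhds_iff.1 (hproj _ (Metric.ball_mem_nhds z₀ hR₁)
    (hinj.mono (inter_subset_inter_right _ (Metric.ball_subset_ball (by linarith)))))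
  obtain ⟨r, hr, hrr₀, hrR⟩ : ∃ r > 0, r ≤ r₀ ∧ r ≤ R / 2 :=
    ⟨min r₀ (R / 2), by positivity, min_le_left _ _, min_le_right _ _⟩
  have hex : ∀ x ∈ Metric.ball (spacePart z₀) r, ∃ t : ℝ,
      timeSpace t x ∈ H ∩ Metric.ball z₀ R₁ := by
    intro x hx
    obtain ⟨z, hz, rfl⟩ := hr₀s (Metric.ball_subset_ball hrr₀ hx)
    exact ⟨z 0, by rwa [timeSpace_spacePart]⟩
  choose! h hh using hex
  have hhR : ∀ x ∈ Metric.ball (spacePart z₀) r, timeSpace (h x) x ∈ H ∩ Metric.ball z₀ R :=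
    fun x hx => ⟨(hh x hx).1, Metric.ball_subset_ball (by linarith) (hh x hx).2⟩
  have huniq : ∀ z ∈ H ∩ Metric.ball z₀ R, spacePart z ∈ Metric.ball (spacePart z₀) r →
      z = timeSpace (h (spacePart z)) (spacePart z) := fun z hz hzr =>
    hinj hz (hhR _ hzr) (spacePart_timeSpace _ _).symm
  have hcont : ContinuousOn h (Metric.ball (spacePart z₀) r) := by
    refine (LipschitzOnWith.of_dist_le_mul (K := ⟨α⁻¹, by positivity⟩)
      fun x hx y hy => ?_).continuousOn
    have := hlip _ (hhR y hy) _ (hhR x hx)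
    simp only [timeSpace_zero_apply, spacePart_timeSpace] at this
    rw [Real.dist_eq, dist_eq_norm]
    change _ ≤ α⁻¹ * _
    rwa [← div_eq_inv_mul, le_div_iff₀' hα]
  obtain ⟨r₁, hr₁, C, K, hr₁r, hsupp⟩ := hG.exists_uniform_support hR
    (pr := spacePartL n) (ι := spaceInclL n) (h := h) (x₀ := spacePart z₀) (r := r) (R₁ := R₁)
    (by ext i; simp [spacePart]) (by simp) hach hhor hr hR₁L.le hcont
    (fun x hx => by
      rw [← timeSpace_eq, ← dist_eq_norm]
      exact ⟨(hh x hx).1, (Metric.mem_ball.1 (hh x hx).2).le⟩)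
    (fun z hz hzr => by rw [← timeSpace_eq]; exact huniq z hz hzr)
  have hsub : Metric.ball (spacePart z₀) r₁ ⊆ Metric.ball (spacePart z₀) r :=
    Metric.ball_subset_ball hr₁r
  have hcyl : ∀ t ∈ Metric.ball (z₀ 0) (R / 2), ∀ x ∈ Metric.ball (spacePart z₀) r₁,
      timeSpace t x ∈ Metric.ball z₀ R := by
    intro t ht x hx
    have h1 := norm_le_abs_add_norm_spacePart (timeSpace t x - z₀)
    rw [spacePart_sub, spacePart_timeSpace, ← dist_eq_norm, ← dist_eq_norm] at h1
    have h2 : (timeSpace t x - z₀) 0 = t - z₀ 0 := by simp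
    rw [h2, ← Real.dist_eq] at h1
    rw [Metric.mem_ball] at ht hx ⊢
    linarith
  refine ⟨r₁, hr₁, R / 2, by positivity, h, hcyl, fun x hx => ?_, fun t ht x hx => ⟨fun hH => ?_,
    fun hth => ?_⟩, hcont.mono hsub, ?_⟩
  · have h1 := abs_apply_zero_le_norm (timeSpace (h x) x - z₀)
    have h2 : (timeSpace (h x) x - z₀) 0 = h x - z₀ 0 := by simp
    have h3 := (hh x (hsub hx)).2
    rw [h2, ← Real.dist_eq, ← dist_eq_norm] at h1
    rw [Metric.mem_ball] at h3 ⊢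
    linarith
  · have h1 := huniq _ ⟨hH, hcyl t ht x hx⟩ (by rw [spacePart_timeSpace]; exact hsub hx)
    have h2 := congrArg (fun z : EuclideanSpace ℝ (Fin (n + 1)) => z 0) h1
    simpa using h2
  · rw [hth]
    exact (hh x (hsub hx)).1
  · refine isBSCLoc_of_forall_exists_support fun x₁ hx₁ => ?_
    obtain ⟨r₂, hr₂, hr₂s⟩ := Metric.isOpen_iff.1 Metric.isOpen_ball x₁ hx₁
    refine ⟨r₂, hr₂, C, K, hr₂s, fun x hx => ?_⟩
    obtain ⟨b, hbK, hb⟩ := hsupp x (hr₂s hx)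
    refine ⟨(InnerProductSpace.toDual ℝ _).symm b, by simpa using hbK, fun y hy => ?_⟩
    rw [InnerProductSpace.toDual_symm_apply]
    exact hb y (hr₂s hy)

/-- The parametrization of a graph in coordinates is a topological embedding. -/
lemma isEmbedding_domRestrict_symm_timeSpace {M : Type*} [TopologicalSpace M]
    (e : OpenPartialHomeomorph M (EuclideanSpace ℝ (Fin (n + 1))))
    {h : EuclideanSpace ℝ (Fin n) → ℝ} {B : Set (EuclideanSpace ℝ (Fin n))}
    (hh : ContinuousOn h B) (hB : ∀ x ∈ B, timeSpace (h x) x ∈ e.target) :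
    IsEmbedding (B.domRestrict fun x => e.symm (timeSpace (h x) x)) := by
  obtain ⟨Z, hZ⟩ : ∃ Z : B → EuclideanSpace ℝ (Fin (n + 1)),
      Z = fun x : B => timeSpace (h x) x := ⟨_, rfl⟩
  have hZc : Continuous Z := by
    rw [hZ]
    simp only [timeSpace_eq]
    exact (hh.domRestrict.smul continuous_const).add
      ((spaceInclL n).continuous.comp continuous_subtype_val)
  have hZe : IsEmbedding Z := by
    refine IsEmbedding.of_comp hZc (spacePartL n).continuous ?_
    have : (spacePartL n) ∘ Z = Subtype.val := by
      ext1 x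
      simp [hZ]
    rw [this]
    exact IsEmbedding.subtypeVal
  have hZt : ∀ x, Z x ∈ e.target := fun x => by rw [hZ]; exact hB x x.2
  have h1 := IsEmbedding.subtypeVal.comp
    (e.toHomeomorphSourceTarget.symm.isEmbedding.comp (hZe.codRestrict e.target hZt))
  convert h1 using 1
  ext1 x
  simp [hZ]

end Graph

namespace Spacetime

variable {n : ℕ} {M : Type*} [TopologicalSpace M]
  [ChartedSpace (EuclideanSpace ℝ (Fin (n + 1))) M]
  [IsManifold 𝓘(ℝ, EuclideanSpace ℝ (Fin (n + 1))) 4 M]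

/-- The transfer of `IsConeField.exists_graph_isBSCLoc` to the manifold. -/
theorem isBSCGraphNear_of_isFutureNullHypersurface {g : Spacetime n M} {H : Set M}
    (hH : g.IsFutureNullHypersurface H) {p : M} (hp : p ∈ H)
    {e : OpenPartialHomeomorph M (EuclideanSpace ℝ (Fin (n + 1)))} (he : g.IsFutureChartAt e p) :
    IsBSCGraphNear e H p := by
  obtain ⟨heA, hpe, v, hv, hvv, hvT⟩ := he
  obtain ⟨⟨hloc, hachr⟩, hhor⟩ := hH
  obtain ⟨U, hU, hpU, hUach⟩ := hachr p hp
  obtain ⟨W, hW, hpW, ⟨φ⟩⟩ := hloc p hp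
  obtain ⟨z₀, hz₀⟩ : ∃ z₀, z₀ = e p := ⟨_, rfl⟩
  have hz₀t : z₀ ∈ e.target := by rw [hz₀]; exact e.map_source hpe
  have hsz₀ : e.symm z₀ = p := by rw [hz₀, e.left_inv hpe]
  have hev := mfderiv_symm_eq heA hpe hv
  have hcone := exists_isConeField (G := g.chartMetric e) (z₀ := z₀) (T := g.chartField e)
    (e₀ := EuclideanSpace.single 0 1)
    ((g.contDiffOn_chartMetric heA).contDiffAt (e.open_target.mem_nhds hz₀t))
    (Filter.Eventually.of_forall fun z u v => g.symm _ _ _) (g.chartMetric_lorentzian heA hz₀t)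
    ((g.continuousOn_chartField heA).continuousAt (e.open_target.mem_nhds hz₀t))
    (by
      rw [chartMetric_apply, mfderiv_symm_chartField g heA hz₀t]
      exact g.timelike_timeField _)
    (by
      rw [hz₀, chartMetric_apply, hev, e.left_inv hpe]
      exact hvv)
    (by
      rw [chartMetric_apply, mfderiv_symm_chartField g heA hz₀t, hz₀, hev, e.left_inv hpe]
      exact hvT)
  obtain ⟨R₀, hR₀, θ, L, c, α, hG₀, hθ₀⟩ := hcone
  have hnhds : e.target ∩ e.symm ⁻¹' U ∈ 𝓝 z₀ :=
    Filter.inter_mem (e.open_target.mem_nhds hz₀t)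
      ((e.symm.continuousAt hz₀t).preimage_mem_nhds (by rw [hsz₀]; exact hU.mem_nhds hpU))
  obtain ⟨R₁, hR₁, hR₁s⟩ := Metric.mem_nhds_iff.1 hnhds
  obtain ⟨R, hR, hRR₀, hRR₁⟩ : ∃ R > 0, R ≤ R₀ ∧ R ≤ R₁ :=
    ⟨min R₀ R₁, by positivity, min_le_left _ _, min_le_right _ _⟩
  have hG := hG₀.mono (Metric.ball_subset_ball hRR₀)
  have hθ := fun z hz => hθ₀ z (Metric.ball_subset_ball hRR₀ hz)
  have hball : Metric.ball z₀ R ⊆ e.target ∩ e.symm ⁻¹' U :=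
    (Metric.ball_subset_ball hRR₁).trans hR₁s
  have hballt : Metric.ball z₀ R ⊆ e.target := hball.trans inter_subset_left
  have hmem : ∀ z ∈ e.target, z ∈ e '' (e.source ∩ H) ↔ e.symm z ∈ H := by
    refine fun z hz => ⟨?_, fun h => ⟨e.symm z, ⟨e.map_target hz, h⟩, e.right_inv hz⟩⟩
    rintro ⟨x, ⟨hx, hxH⟩, rfl⟩
    rwa [e.left_inv hx]
  have hgraph := hG.exists_graph_isBSCLoc (H := e '' (e.source ∩ H)) hR
    (by
      intro x hx y hy hxy
      refine hUach (e.symm x) ⟨(hmem x (hballt hx.2)).1 hx.1, (hball hx.2).2⟩ (e.symm y)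
        ⟨(hmem y (hballt hy.2)).1 hy.1, (hball hy.2).2⟩ ?_
      exact Relation.TransGen.lift e.symm (fun a b hab => timelikeStep_of_isCurveStep heA hballt
        hθ hab (image_subset_iff.2 fun z hz => (hball hz).2)) _ _ hxy)
    (by
      intro x hx V hV hVR hxV
      have hsub : e.source ∩ e ⁻¹' V ⊆ U := fun y hy => by
        have := (hball (hVR hy.2)).2
        rwa [mem_preimage, e.left_inv hy.1] at this
      have hxt := hballt hx.2
      obtain ⟨q, ⟨hq, hqH⟩, hqx⟩ := hhor (e.symm x) ((hmem x hxt).1 hx.1) (e.source ∩ e ⁻¹' V)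
        (e.isOpen_inter_preimage hV)
        ⟨e.map_target hxt, by rw [mem_preimage, e.right_inv hxt]; exact hxV⟩ (hUach.mono hsub)
      have hqs : q ∈ e.source := by
        rcases Relation.ReflTransGen.cases_tail hq with h | ⟨y, -, γ, -, -, h1, h2⟩
        · exact absurd h hqx
        · rw [← h1]
          exact (h2 1 (right_mem_Icc.2 zero_le_one)).1.1
      refine ⟨e q, mem_image_of_mem _ ⟨hqs, hqH⟩, fun h => hqx ?_, ?_⟩
      · rw [← h, e.left_inv hqs]
      · have := Relation.ReflTransGen.lift e (fun a b hab =>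
          isCurveStep_of_causalStep heA hθ hVR hab) _ _ hq
        rwa [Function.onFun, e.right_inv hxt] at this)
    (fun D hD hinj => by
      rw [hz₀] at hD ⊢
      exact image_spacePart_mem_nhds φ ⟨hp, hpW⟩ hpe hD hinj)
  obtain ⟨r, hr, ε, hε, h, h1, h2, h3, hcont, hbsc⟩ := hgraph
  rw [hz₀] at h1 h2 h3 hcont hbsc
  rw [hz₀] at hballt
  have hψ : ∀ x ∈ Metric.ball (spacePart (e p)) r, timeSpace (h x) x ∈ e.target :=
    fun x hx => hballt (h1 _ (h2 x hx) x hx)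
  have hcomp : ∀ i, IsBSCLoc (fun x => e (e.symm (timeSpace (h x) x)) i)
      (Metric.ball (spacePart (e p)) r) := by
    refine Fin.cases (hbsc.congr fun x hx => ?_) fun i =>
      (isBSCLoc_coord Metric.isOpen_ball i).congr fun x hx => ?_
    · simp only [e.right_inv (hψ x hx), timeSpace_zero_apply]
    · simp only [e.right_inv (hψ x hx), timeSpace_succ_apply]
  exact ⟨r, hr, ε, hε, h, fun t ht x hx => hballt (h1 t ht x hx), h2,
    fun t ht x hx => (hmem _ (hballt (h1 t ht x hx))).symm.trans (h3 t ht x hx), hbsc,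
    hbsc.isLowerC 2, isEmbedding_domRestrict_symm_timeSpace e hcont hψ,
    fun i => ⟨hcomp i, (hcomp i).isLowerC 2⟩⟩

end Spacetime

/-! ### Existence of coordinates and time reversal -/

namespace Spacetime

variable {n : ℕ} {M : Type*} [TopologicalSpace M]
  [ChartedSpace (EuclideanSpace ℝ (Fin (n + 1))) M]

local notation "𝔼" => EuclideanSpace ℝ (Fin (n + 1))

/-- A nonzero tangent vector has any given nonzero components in some coordinates, which are
obtained from a chart by a linear change of variables. -/
lemma exists_mem_maximalAtlas_mfderiv_eq [IsManifold 𝓘(ℝ, EuclideanSpace ℝ (Fin (n + 1))) 3 M]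
    (p : M) {v : TangentSpace 𝓘(ℝ, 𝔼) p} (hv : v ≠ 0) {u : 𝔼} (hu : u ≠ 0) :
    ∃ e ∈ IsManifold.maximalAtlas 𝓘(ℝ, 𝔼) 3 M, p ∈ e.source ∧
      mfderiv 𝓘(ℝ, 𝔼) 𝓘(ℝ, 𝔼) e p v = u := by
  obtain ⟨c, hc⟩ : ∃ c, c = chartAt 𝔼 p := ⟨_, rfl⟩
  have hcA : c ∈ IsManifold.maximalAtlas 𝓘(ℝ, 𝔼) 3 M := by
    rw [hc]; exact IsManifold.chart_mem_maximalAtlas p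
  have hpc : p ∈ c.source := by rw [hc]; exact mem_chart_source 𝔼 p
  obtain ⟨w, hw⟩ : ∃ w : 𝔼, mfderiv 𝓘(ℝ, 𝔼) 𝓘(ℝ, 𝔼) c p v = w := ⟨_, rfl⟩
  have hw0 : w ≠ 0 := by
    rintro rfl
    exact hv ((mfderiv_symm_eq hcA hpc hw).symm.trans (map_zero _))
  obtain ⟨A, hA⟩ := SeparatingDual.exists_continuousLinearEquiv_apply_eq (R := ℝ) hw0 hu
  have h1 := contMDiffOn_of_mem_maximalAtlas hcA
  have h2 := contMDiffOn_symm_of_mem_maximalAtlas hcA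
  refine ⟨c.transHomeomorph A.toHomeomorph, ?_, hpc, ?_⟩
  · rw [IsManifold.mem_maximalAtlas_iff_contMDiffOn]
    refine ⟨A.contDiff.contMDiff.comp_contMDiffOn h1,
      h2.comp A.symm.contDiff.contMDiff.contMDiffOn fun z hz => hz⟩
  · have h3 : HasMFDerivAt 𝓘(ℝ, 𝔼) 𝓘(ℝ, 𝔼) A (c p) (A : 𝔼 →L[ℝ] 𝔼) :=
      A.hasFDerivAt.hasMFDerivAt
    have h4 := ((mdifferentiable_of_mem_maximalAtlas hcA).mdifferentiableAt hpc).hasMFDerivAt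
    have h5 := (h3.comp p h4).mfderiv
    refine (DFunLike.congr_fun h5 v).trans ?_
    exact (congrArg A hw).trans hA

/-- Reversing the parameter of a curve reverses its velocity. -/
lemma contMDiffOn_comp_one_sub {γ : ℝ → M}
    (hγ : ContMDiffOn 𝓘(ℝ, ℝ) 𝓘(ℝ, 𝔼) 1 γ (Icc 0 1)) :
    ContMDiffOn 𝓘(ℝ, ℝ) 𝓘(ℝ, 𝔼) 1 (fun t => γ (1 - t)) (Icc 0 1) ∧
      ∀ t ∈ Icc (0 : ℝ) 1,
        mfderivWithin 𝓘(ℝ, ℝ) 𝓘(ℝ, 𝔼) (fun t => γ (1 - t)) (Icc 0 1) t (1 : ℝ) =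
          -mfderivWithin 𝓘(ℝ, ℝ) 𝓘(ℝ, 𝔼) γ (Icc 0 1) (1 - t) (1 : ℝ) := by
  have hmaps : MapsTo (fun t : ℝ => 1 - t) (Icc 0 1) (Icc 0 1) := fun t ht =>
    ⟨by linarith [ht.2], by linarith [ht.1]⟩
  have hs : ContDiff ℝ 1 fun t : ℝ => 1 - t := by fun_prop
  refine ⟨hγ.comp hs.contMDiff.contMDiffOn hmaps, fun t ht => ?_⟩
  have h1 : HasMFDerivWithinAt 𝓘(ℝ, ℝ) 𝓘(ℝ, ℝ) (fun t : ℝ => 1 - t) (Icc 0 1) t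
      (-ContinuousLinearMap.id ℝ ℝ : ℝ →L[ℝ] ℝ) :=
    ((hasFDerivAt_id t).const_sub 1).hasFDerivWithinAt.hasMFDerivWithinAt
  have h2 := (hγ.mdifferentiableOn one_ne_zero (1 - t) (hmaps ht)).hasMFDerivWithinAt
  have h3 := (h2.comp t h1 hmaps).mfderivWithin (uniqueDiffOn_Icc_zero_one.uniqueMDiffOn t ht)
  refine (DFunLike.congr_fun h3 (1 : ℝ)).trans ?_
  exact map_neg (mfderivWithin 𝓘(ℝ, ℝ) 𝓘(ℝ, 𝔼) γ (Icc 0 1) (1 - t)) (1 : ℝ)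

variable [IsManifold 𝓘(ℝ, EuclideanSpace ℝ (Fin (n + 1))) 4 M]

/-- The spacetime with the opposite time orientation. -/
noncomputable def reverse (g : Spacetime n M) : Spacetime n M where
  metric := g.metric
  symm := g.symm
  lorentzian := g.lorentzian
  contMDiff_metric := g.contMDiff_metric
  timeField x := -g.timeField x
  continuous_timeField := by
    have h := contMDiff_zero_iff (I := 𝓘(ℝ, 𝔼)) (I' := 𝓘(ℝ, 𝔼).prod 𝓘(ℝ, 𝔼)).2
      g.continuous_timeField
    exact (ContMDiff.neg_section h).continuous
  timelike_timeField x := by simpa using g.timelike_timeField x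

lemma reverse_reverse (g : Spacetime n M) : g.reverse.reverse = g := by
  cases g
  simp [reverse]

lemma TimelikeStep.reverse {g : Spacetime n M} {U : Set M} {p q : M} (h : g.TimelikeStep U p q) :
    g.reverse.TimelikeStep U q p := by
  obtain ⟨γ, hγ, rfl, rfl, hP⟩ := h
  obtain ⟨h1, h2⟩ := contMDiffOn_comp_one_sub hγ
  refine ⟨_, h1, by simp, by simp, fun t ht => ?_⟩
  obtain ⟨hU, h3, h4⟩ := hP (1 - t) ⟨by linarith [ht.2], by linarith [ht.1]⟩
  rw [h2 t ht]
  refine ⟨hU, ?_, ?_⟩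
  · simpa [Spacetime.reverse] using h3
  · simpa [Spacetime.reverse] using h4

lemma CausalStep.reverse {g : Spacetime n M} {U : Set M} {p q : M} (h : g.CausalStep U p q) :
    g.reverse.CausalStep U q p := by
  obtain ⟨γ, hγ, rfl, rfl, hP⟩ := h
  obtain ⟨h1, h2⟩ := contMDiffOn_comp_one_sub hγ
  refine ⟨_, h1, by simp, by simp, fun t ht => ?_⟩
  obtain ⟨hU, h0, h3, h4⟩ := hP (1 - t) ⟨by linarith [ht.2], by linarith [ht.1]⟩
  rw [h2 t ht]
  refine ⟨hU, neg_ne_zero.2 h0, ?_, ?_⟩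
  · simpa [Spacetime.reverse] using h3
  · simpa [Spacetime.reverse] using h4

lemma IsAchronalIn.reverse {g : Spacetime n M} {H U : Set M} (h : g.IsAchronalIn H U) :
    g.reverse.IsAchronalIn H U := fun p hp q hq hpq =>
  h q hq p hp (Relation.TransGen.swap _ _ (Relation.TransGen.mono (fun a b hab => by
    have := TimelikeStep.reverse hab
    rwa [reverse_reverse] at this) _ _ hpq))

lemma IsPastNullHypersurface.reverse {g : Spacetime n M} {H : Set M}
    (h : g.IsPastNullHypersurface H) : g.reverse.IsFutureNullHypersurface H := by
  obtain ⟨⟨h1, h2⟩, h3⟩ := h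
  refine ⟨⟨h1, fun p hp => ?_⟩, fun p hp U hU hpU hach => ?_⟩
  · obtain ⟨U, hU, hpU, hach⟩ := h2 p hp
    exact ⟨U, hU, hpU, hach.reverse⟩
  · have hach' := hach.reverse
    rw [reverse_reverse] at hach'
    obtain ⟨q, hqH, hqp, hne⟩ := h3 p hp U hU hpU hach'
    exact ⟨q, ⟨Relation.ReflTransGen.swap _ _ (Relation.ReflTransGen.mono
      (fun a b hab => CausalStep.reverse hab) _ _ hqp), hqH⟩, hne⟩

lemma IsPastChartAt.reverse {g : Spacetime n M} {p : M} {e : OpenPartialHomeomorph M 𝔼}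
    (h : g.IsPastChartAt e p) : g.reverse.IsFutureChartAt e p := by
  obtain ⟨h1, h2, v, h3, h4, h5⟩ := h
  refine ⟨h1, h2, v, h3, ?_, ?_⟩
  · simpa [Spacetime.reverse] using h4
  · simpa [Spacetime.reverse] using h5

lemma timeField_ne_zero (g : Spacetime n M) (p : M) : g.timeField p ≠ 0 := fun h => by
  have := g.timelike_timeField p
  simp [h] at this

lemma exists_isFutureChartAt (g : Spacetime n M) (p : M) : ∃ e, g.IsFutureChartAt e p := by
  have : IsManifold 𝓘(ℝ, 𝔼) 3 M := IsManifold.of_le (n := 4) (by norm_cast)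
  obtain ⟨e, he, hp, hv⟩ := exists_mem_maximalAtlas_mfderiv_eq p (g.timeField_ne_zero p)
    (u := EuclideanSpace.single 0 1) (by simp)
  exact ⟨e, he, hp, _, hv, g.timelike_timeField p, g.timelike_timeField p⟩

lemma exists_isPastChartAt (g : Spacetime n M) (p : M) : ∃ e, g.IsPastChartAt e p := by
  obtain ⟨e, he, hp, v, hv, h1, h2⟩ := g.reverse.exists_isFutureChartAt p
  refine ⟨e, he, hp, v, hv, ?_, ?_⟩
  · simpa [Spacetime.reverse] using h1
  · simpa [Spacetime.reverse] using h2

end Spacetime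

theorem mainTheorem8 {n : ℕ} (hn : 1 ≤ n) {M : Type*} [TopologicalSpace M] [T2Space M]
    [ParacompactSpace M] [ChartedSpace (EuclideanSpace ℝ (Fin (n + 1))) M]
    [IsManifold 𝓘(ℝ, EuclideanSpace ℝ (Fin (n + 1))) 4 M] (g : Spacetime n M) (H : Set M) :
    (g.IsFutureNullHypersurface H → ∀ p ∈ H,
      (∃ e, g.IsFutureChartAt e p) ∧ ∀ e, g.IsFutureChartAt e p → IsBSCGraphNear e H p) ∧
    (g.IsPastNullHypersurface H → ∀ p ∈ H,
      (∃ e, g.IsPastChartAt e p) ∧ ∀ e, g.IsPastChartAt e p → IsBSCGraphNear e H p) := by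
  refine ⟨fun hH p hp => ⟨g.exists_isFutureChartAt p, fun e he => ?_⟩,
    fun hH p hp => ⟨g.exists_isPastChartAt p, fun e he => ?_⟩⟩
  · exact Spacetime.isBSCGraphNear_of_isFutureNullHypersurface hH hp he
  · exact Spacetime.isBSCGraphNear_of_isFutureNullHypersurface hH.reverse hp he.reverse
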